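/- **Notation.** Let $N\ge 1$. *Bethe algebra.* Let $e_{ab}$ be the matrix units of $\mathfrak{gl}_N=\mathfrak{gl}_N(\mathbb C)$, let $\mathfrak{gl}_N[t]$ be the current algebra, and put $e_{ab}(u)=\sum_{s\ge 0}(e_{ab}\otimes t^s)u^{-s-1}$. For an $N\times N$ matrix over a noncommutative algebra let $\operatorname{rdet}(a_{ij})=\sum_{\sigma\in S_N}(-1)^\sigma a_{1\sigma(1)}a_{2\sigma(2)}\cdots a_{N\sigma(N)}$. With $\partial=d/du$ and commuting variables $\boldsymbol\lambda=(\lambda_1,\dots,\lambda_N)$, write $$\operatorname{rdet}\bigl(\delta_{ij}(\partial-\lambda_i)-e_{ji}(u)\bigr)_{i,j=1}^N=\partial^N+\sum_{i=1}^N B_i(u)\,\partial^{N-i},\qquad B_i(u)=\sum_{j\ge0}B_{ij}u^{-j}.$$ The Bethe algebra $\mathcal B_N$ is the unital subalgebra of $U(\mathfrak{gl}_N[t])[\boldsymbol\lambda]$ generated by all $B_{ij}$, $1\le i\le N$, $j\ge 0$. *The space $\mathcal V_{\mathbf 1}$.* Let $V=\mathbb C^N$ with standard basis $\epsilon_1,\dots,\epsilon_N$,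 and let $\mathcal V=V^{\otimes N}\otimes\mathbb C[z_1,\dots,z_N,\lambda_1,\dots,\lambda_N]$. On $\mathcal V$ the element $e_{ab}\otimes t^r$ acts as $\sum_k z_k^r e_{ab}^{(k)}$, where $e_{ab}^{(k)}$ is $e_{ab}$ acting on the $k$-th tensor factor, and $\lambda_i$ acts by multiplication. Let $\mathcal V_{\mathbf 1}=\{v\in\mathcal V: e_{ii}v=v,\ i=1,\dots,N\}$; it is the free $\mathbb C[\boldsymbol z,\boldsymbol\lambda]$-module with basis $\epsilon_\sigma=\epsilon_{\sigma(1)}\otimes\cdots\otimes\epsilon_{\sigma(N)}$, $\sigma\in S_N$, and it is preserved by $\mathcal B_N$. Let $\bar{\mathcal B}_N$ be the image of $\mathcal B_N$ in $\operatorname{End}(\mathcal V_{\mathbf 1})$. For $\sigma\in S_N$ let $$\sigma^L\bigl(p(\boldsymbol z,\lambda_1,\dots,\lambda_N)\,\epsilon_{i_1}\otimes\cdots\otimes\epsilon_{i_N}\bigr)=p(\boldsymbol z,\lambda_{\sigma(1)},\dots,\lambda_{\sigma(N)})\,\epsilon_{\sigma(i_1)}\otimes\cdots\otimes\epsilon_{\sigma(i_N)},$$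 $$\sigma^R\bigl(p(z_1,\dots,z_N,\boldsymbol\lambda)\,\epsilon_{i_1}\otimes\cdots\otimes\epsilon_{i_N}\bigr)=p(z_{\sigma(1)},\dots,z_{\sigma(N)},\boldsymbol\lambda)\,\epsilon_{i_{\sigma^{-1}(1)}}\otimes\cdots\otimes\epsilon_{i_{\sigma^{-1}(N)}},$$ and let $\mathcal V_{\mathbf 1}^{S^L\times S^R}$ be the space of $v\in\mathcal V_{\mathbf 1}$ with $\sigma^Lv=\sigma^Rv=v$ for all $\sigma\in S_N$. *Cherednik algebra.* Let $H_N$ be the rational Cherednik algebra of $S_N$: the unital complex algebra generated by the group $S_N$ and elements $x_i,y_i$ ($1\le i\le N$) with relations $[x_i,x_j]=[y_i,y_j]=0$, $\sigma x_i=x_{\sigma(i)}\sigma$, $\sigma y_i=y_{\sigma(i)}\sigma$ for $\sigma\in S_N$, $[x_i,y_j]=s_{ij}$ for $i\ne j$, and $[x_i,y_i]=-\sum_{a\ne i}s_{ia}$, where $s_{ij}$ is the transposition of $i$ and $j$. Let $e=\frac1{N!}\sum_{\sigma\in S_N}\sigma$, and let $U_N=eH_Ne$ be the spherical subalgebra,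 an algebra with unit $e$. Let $\iota:\mathcal V_{\mathbf 1}\to H_N$ be the linear map with $$\iota\bigl(p(\boldsymbol z)q(\boldsymbol\lambda)\epsilon_\tau\bigr)=q(\boldsymbol x)\,\tau\,p(\boldsymbol y)$$ for all $\tau\in S_N$ and all polynomials $p,q$. **Corollary.** The map $\iota$ is an isomorphism of vector spaces. The algebra $\bar{\mathcal B}_N$ is isomorphic to the spherical subalgebra $U_N$. Moreover, $\mathcal V_{\mathbf 1}^{S^L\times S^R}$ is stable under $\bar{\mathcal B}_N$, is a cyclic $\bar{\mathcal B}_N$-module, and is identified by $\iota$ with the regular representation of $U_N$. That is, there is an isomorphism of unital algebras $\Phi:\bar{\mathcal B}_N\to U_N$ such that $\iota$ restricts to a linear isomorphism $\mathcal V_{\mathbf 1}^{S^L\times S^R}\to U_N$ and $\iota(bv)=\Phi(b)\,\iota(v)$ for all $b\in\bar{\mathcal B}_N$ and $v\in\mathcal V_{\mathbf 1}^{S^L\times S^R}$. -/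

import Mathlib

open scoped TensorProduct Polynomial

noncomputable section

namespace Gaudin

attribute [local instance 100] LieRing.ofAssociativeRing

/-! ### Formal differential operators in `u` with coefficients in `A[[u⁻¹]]`

A formal power series in `u⁻¹` over a (noncommutative) ring `A` is an element of `PowerSeries A`:
the coefficient at `n` is the coefficient of `u⁻ⁿ`. -/

section DiffOp

variable {A : Type*} [Ring A] [Algebra ℂ A]

/-- The formal differentiation `∂ = d/du` on `A[[u⁻¹]]`: it sends `a u⁻ᵐ` to `-m a u⁻ᵐ⁻¹`. -/
def duSeries : PowerSeries A →ₗ[ℂ] PowerSeries A where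
  toFun f := PowerSeries.mk fun n => Nat.casesOn n 0 fun m => -((m : A) * PowerSeries.coeff m f)
  map_add' f g := by
    ext n; cases n <;> simp [mul_add, add_comm]
  map_smul' c f := by
    ext n; cases n <;> simp

theorem coeff_duSeries_zero (f : PowerSeries A) : PowerSeries.coeff 0 (duSeries f) = 0 := by
  simp [duSeries]

theorem coeff_duSeries_succ (f : PowerSeries A) (m : ℕ) :
    PowerSeries.coeff (m + 1) (duSeries f) = -((m : A) * PowerSeries.coeff m f) := by
  simp [duSeries]

variable (A) in
/-- Differential operators `∑ₖ aₖ(u) ∂ᵏ` (finite sums, coefficients written on the left), as a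
vector space: the value at `k` is the coefficient `aₖ(u)` of `∂ᵏ`. -/
abbrev DiffOp := ℕ →₀ PowerSeries A

/-- Composition on the left with `∂`: `∂ ∘ (b ∂ᵏ) = b' ∂ᵏ + b ∂ᵏ⁺¹`. -/
def dOp : Module.End ℂ (DiffOp A) :=
  Finsupp.mapRange.linearMap duSeries + Finsupp.lmapDomain (PowerSeries A) ℂ Nat.succ

/-- Composition on the left with the multiplication by a series `a(u)`: `a ∘ (b ∂ᵏ) = (a b) ∂ᵏ`. -/
def coefOp : PowerSeries A →+* Module.End ℂ (DiffOp A) :=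
  Module.toModuleEnd ℂ (DiffOp A)

/-- The algebra of differential operators is realised in its left regular representation, that is
inside `Module.End ℂ (DiffOp A)`, by the operators `dOp` and `coefOp a`. The coefficients `aₖ(u)` of
an operator `P = ∑ₖ aₖ(u) ∂ᵏ` are recovered from the operator of left composition with `P` by
applying it to `1`; see `dOp_mul_coefOp` and `normalForm_sum`. -/
def normalForm (P : Module.End ℂ (DiffOp A)) : DiffOp A := P (Finsupp.single 0 1)

theorem duSeries_mul (f g : PowerSeries A) :
    duSeries (f * g) = duSeries f * g + f * duSeries g := by
  ext n
  cases n with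
  | zero =>
    rw [map_add, PowerSeries.coeff_mul, PowerSeries.coeff_mul, coeff_duSeries_zero]
    simp only [Finset.Nat.antidiagonal_zero, Finset.sum_singleton, coeff_duSeries_zero, zero_mul,
      mul_zero, add_zero]
  | succ m =>
    rw [coeff_duSeries_succ, map_add, PowerSeries.coeff_mul, PowerSeries.coeff_mul,
      PowerSeries.coeff_mul, Finset.Nat.sum_antidiagonal_succ, Finset.Nat.sum_antidiagonal_succ']
    simp only [coeff_duSeries_zero, coeff_duSeries_succ, zero_mul, mul_zero, zero_add]
    rw [Finset.mul_sum, ← Finset.sum_neg_distrib, ← Finset.sum_add_distrib]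
    refine Finset.sum_congr rfl fun p hp => ?_
    rw [← Finset.HasAntidiagonal.mem_antidiagonal.mp hp, Nat.cast_add, add_mul, neg_add, neg_mul,
      mul_neg, mul_assoc, ← mul_assoc, ← mul_assoc (PowerSeries.coeff p.1 f),
      ← (Nat.cast_commute p.2 (PowerSeries.coeff p.1 f)).eq, mul_assoc (p.2 : A)]

theorem dOp_single (k : ℕ) (b : PowerSeries A) :
    dOp (Finsupp.single k b) = Finsupp.single k (duSeries b) + Finsupp.single (k + 1) b := by
  simp [dOp, Finsupp.mapDomain_single]

theorem coefOp_single (a : PowerSeries A) (k : ℕ) (b : PowerSeries A) :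
    coefOp a (Finsupp.single k b) = Finsupp.single k (a * b) := by
  simp [coefOp]

/-- The defining commutation relation `∂ ∘ a = a ∘ ∂ + a'`. -/
theorem dOp_mul_coefOp (a : PowerSeries A) :
    dOp * coefOp a = coefOp a * dOp + coefOp (duSeries a) := by
  refine Finsupp.lhom_ext fun k b => ?_
  simp only [Module.End.mul_apply, LinearMap.add_apply, coefOp_single, dOp_single, map_add,
    duSeries_mul, Finsupp.single_add]
  abel

/-- The normal form of `∑ₖ aₖ(u) ∂ᵏ` is given by the coefficients `aₖ(u)`. -/
theorem normalForm_sum (a : DiffOp A) :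
    normalForm (a.sum fun k f => coefOp f * dOp ^ k) = a := by
  have h : ∀ k : ℕ, (dOp ^ k : Module.End ℂ (DiffOp A)) (Finsupp.single 0 1)
      = Finsupp.single k 1 := by
    intro k
    induction k with
    | zero => simp
    | succ k ih =>
      rw [pow_succ', Module.End.mul_apply, ih, dOp_single]
      have h1 : duSeries (1 : PowerSeries A) = 0 := by
        ext n
        cases n with
        | zero => rw [coeff_duSeries_zero, map_zero]
        | succ m => rw [coeff_duSeries_succ]; cases m <;> simp [PowerSeries.coeff_one]
      rw [h1, Finsupp.single_zero, zero_add]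
  unfold normalForm
  rw [Finsupp.sum, LinearMap.sum_apply]
  conv_rhs => rw [← Finsupp.sum_single a]
  refine Finset.sum_congr rfl fun k _ => ?_
  rw [Module.End.mul_apply, h k, coefOp_single, mul_one]

end DiffOp

/-- The row determinant of a matrix with entries in a possibly noncommutative ring:
`∑ σ, (-1)^σ a_{1σ(1)} a_{2σ(2)} ⋯ a_{Nσ(N)}`. -/
def rdet {R : Type*} [Ring R] {N : ℕ} (M : Matrix (Fin N) (Fin N) R) : R :=
  ∑ σ : Equiv.Perm (Fin N), (Equiv.Perm.sign σ : ℤ) • (List.ofFn fun i => M i (σ i)).prod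

/-! ### The Bethe algebra -/

variable (N : ℕ)

/-- The current Lie algebra `gl_N[t]`: matrices with entries in `ℂ[t]`, with the commutator. -/
abbrev CurrentAlgebra := Matrix (Fin N) (Fin N) ℂ[X]

/-- The enveloping algebra `U(gl_N[t])`. -/
abbrev UCurrent := UniversalEnvelopingAlgebra ℂ (CurrentAlgebra N)

/-- `U(gl_N[t])[λ₁, …, λ_N]`, as `ℂ[λ] ⊗ U(gl_N[t])`. -/
def ULam := MvPolynomial (Fin N) ℂ ⊗[ℂ] UCurrent N

instance : Ring (ULam N) := inferInstanceAs (Ring (MvPolynomial (Fin N) ℂ ⊗[ℂ] UCurrent N))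

instance : Algebra ℂ (ULam N) :=
  inferInstanceAs (Algebra ℂ (MvPolynomial (Fin N) ℂ ⊗[ℂ] UCurrent N))

variable {N}

/-- The inclusion of `U(gl_N[t])` in `U(gl_N[t])[λ]`. -/
def ofU : UCurrent N →ₐ[ℂ] ULam N :=
  (Algebra.TensorProduct.includeRight :
    UCurrent N →ₐ[ℂ] MvPolynomial (Fin N) ℂ ⊗[ℂ] UCurrent N)

/-- The inclusion of `ℂ[λ]` in `U(gl_N[t])[λ]`. -/
def ofLam : MvPolynomial (Fin N) ℂ →ₐ[ℂ] ULam N :=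
  (Algebra.TensorProduct.includeLeft :
    MvPolynomial (Fin N) ℂ →ₐ[ℂ] MvPolynomial (Fin N) ℂ ⊗[ℂ] UCurrent N)

/-- The element `e_{ab} ⊗ tʳ` of `U(gl_N[t])[λ]`. -/
def eT (a b : Fin N) (r : ℕ) : ULam N :=
  ofU (UniversalEnvelopingAlgebra.ι ℂ (Matrix.single a b (Polynomial.X ^ r) : CurrentAlgebra N))

/-- The element `λᵢ` of `U(gl_N[t])[λ]`. -/
def lam (i : Fin N) : ULam N := ofLam (MvPolynomial.X i)

/-- The generating series `e_{ab}(u) = ∑ₛ (e_{ab} ⊗ tˢ) u⁻ˢ⁻¹`. -/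
def eSeries (a b : Fin N) : PowerSeries (ULam N) :=
  PowerSeries.mk fun n => Nat.casesOn n 0 fun s => eT a b s

variable (N)

/-- The matrix with entry `δᵢⱼ (∂ - λᵢ) - e_{ji}(u)` in row `i` and column `j`. -/
def betheMatrix : Matrix (Fin N) (Fin N) (Module.End ℂ (DiffOp (ULam N))) :=
  fun i j => (if i = j then dOp - coefOp (PowerSeries.C (lam i)) else 0) - coefOp (eSeries j i)

/-- The universal operator `𝒟 = ∂^N + ∑ᵢ Bᵢ(u) ∂^{N-i}`, in normal form. -/
def universalOp : DiffOp (ULam N) := normalForm (rdet (betheMatrix N))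

/-- `B_{ij}`: the coefficient of `u⁻ʲ` in `Bᵢ(u)`, where `Bᵢ(u)` is the coefficient of `∂^{N-i}` in
the universal operator. -/
def betheCoeff (i j : ℕ) : ULam N := PowerSeries.coeff j (universalOp N (N - i))

/-- The Bethe algebra: the unital subalgebra of `U(gl_N[t])[λ]` generated by the `B_{ij}`,
`i = 1, …, N`, `j ≥ 0`. -/
def betheAlgebra : Subalgebra ℂ (ULam N) :=
  Algebra.adjoin ℂ {b | ∃ i j : ℕ, 1 ≤ i ∧ i ≤ N ∧ b = betheCoeff N i j}

/-! ### The module `𝒱 = V^{⊗N} ⊗ ℂ[z, λ]` -/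

/-- `ℂ[z, λ]`, where `z_k` is `X (Sum.inl k)` and `λ_k` is `X (Sum.inr k)`. -/
abbrev PolyZL := MvPolynomial (Fin N ⊕ Fin N) ℂ

/-- `V^{⊗N}` for the vector representation `V = ℂ^N`. -/
abbrev TensorPow := ⨂[ℂ] _ : Fin N, (Fin N → ℂ)

/-- The space of polynomials in `z, λ` with coefficients in `V^{⊗N}`. -/
abbrev VSpace := PolyZL N ⊗[ℂ] TensorPow N

variable {N}

/-- The operator `g^{(k)}` on `V^{⊗N}`: the matrix `g` acting on the `k`-th factor. -/
def slot (k : Fin N) : Matrix (Fin N) (Fin N) ℂ →ₗ[ℂ] Module.End ℂ (TensorPow N) where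
  toFun g := PiTensorProduct.map (Function.update (fun _ => LinearMap.id) k (Matrix.toLin' g))
  map_add' g h := by rw [map_add, PiTensorProduct.map_update_add]
  map_smul' c g := by rw [map_smul, PiTensorProduct.map_update_smul, RingHom.id_apply]

theorem slot_mul (k : Fin N) (g h : Matrix (Fin N) (Fin N) ℂ) :
    slot k g * slot k h = slot k (g * h) := by
  change PiTensorProduct.map _ * PiTensorProduct.map _ = PiTensorProduct.map _
  rw [← PiTensorProduct.map_mul]
  congr 1
  funext i
  rcases eq_or_ne i k with rfl | hi
  · simp [Matrix.toLin'_mul, Module.End.mul_eq_comp]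
  · simp [hi, Module.End.mul_eq_comp]

theorem slot_comm {k l : Fin N} (hkl : k ≠ l) (g h : Matrix (Fin N) (Fin N) ℂ) :
    slot k g * slot l h = slot l h * slot k g := by
  change PiTensorProduct.map _ * PiTensorProduct.map _
    = PiTensorProduct.map _ * PiTensorProduct.map _
  rw [← PiTensorProduct.map_mul, ← PiTensorProduct.map_mul]
  congr 1
  funext i
  rcases eq_or_ne i k with rfl | hi
  · simp [hkl, Module.End.mul_eq_comp]
  · simp [hi, Module.End.mul_eq_comp]

instance : Ring (Module.End (PolyZL N) (VSpace N)) := Module.End.instRing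

instance : Algebra (PolyZL N) (Module.End (PolyZL N) (VSpace N)) := Module.End.instAlgebra _ _ _

instance : Algebra ℂ (Module.End (PolyZL N) (VSpace N)) := Module.End.instAlgebra _ _ _

instance : IsScalarTower ℂ (PolyZL N) (Module.End (PolyZL N) (VSpace N)) :=
  LinearMap.instIsScalarTower

/-- For `φ : M_N(ℂ) → S`, the extension `∑ (e_{ab} ⊗ f_{ab}(t)) ↦ ∑ f_{ab}(z) φ(e_{ab})`. -/
def matExt {R S : Type*} [CommRing R] [Algebra ℂ R] [Ring S] [Algebra ℂ S] [Algebra R S]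
    [IsScalarTower ℂ R S] (z : R) (φ : Matrix (Fin N) (Fin N) ℂ →ₗ[ℂ] S) :
    CurrentAlgebra N →ₗ[ℂ] S where
  toFun M := ∑ a, ∑ b, Polynomial.aeval z (M a b) • φ (Matrix.single a b 1)
  map_add' M M' := by
    simp only [Matrix.add_apply, map_add, add_smul, Finset.sum_add_distrib]
  map_smul' c M := by
    simp only [Matrix.smul_apply, map_smul, smul_assoc, Finset.smul_sum, RingHom.id_apply]

theorem matExt_mul {R S : Type*} [CommRing R] [Algebra ℂ R] [Ring S] [Algebra ℂ S] [Algebra R S]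
    [IsScalarTower ℂ R S] (z : R) (φ : Matrix (Fin N) (Fin N) ℂ →ₗ[ℂ] S)
    (hφ : ∀ g h, φ g * φ h = φ (g * h)) (M M' : CurrentAlgebra N) :
    matExt z φ M * matExt z φ M' = matExt z φ (M * M') := by
  have key : ∀ a b c d : Fin N, φ (Matrix.single a b 1) * φ (Matrix.single c d 1) =
      if b = c then φ (Matrix.single a d 1) else 0 := by
    intro a b c d
    rw [hφ]
    split_ifs with h
    · subst h; simp
    · rw [Matrix.single_mul_single_of_ne _ _ _ _ h, map_zero]
  have h1 : ∀ a b c d : Fin N,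
      (Polynomial.aeval z (M a b) • φ (Matrix.single a b 1)) *
        (Polynomial.aeval z (M' c d) • φ (Matrix.single c d 1)) =
      if b = c then Polynomial.aeval z (M a b * M' c d) • φ (Matrix.single a d 1) else 0 := by
    intro a b c d
    rw [smul_mul_smul_comm, key, smul_ite, smul_zero, map_mul]
  have hL : matExt z φ M * matExt z φ M' = ∑ a, ∑ b, ∑ d,
      Polynomial.aeval z (M a b * M' b d) • φ (Matrix.single a d 1) := by
    simp only [matExt, LinearMap.coe_mk, AddHom.coe_mk, Finset.sum_mul]
    refine Finset.sum_congr rfl fun a _ => Finset.sum_congr rfl fun b _ => ?_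
    simp only [Finset.mul_sum, h1]
    rw [Finset.sum_comm]
    refine Finset.sum_congr rfl fun d _ => ?_
    rw [Finset.sum_ite_eq, if_pos (Finset.mem_univ b)]
  rw [hL]
  simp only [matExt, LinearMap.coe_mk, AddHom.coe_mk, Matrix.mul_apply, map_sum, Finset.sum_smul]
  exact Finset.sum_congr rfl fun a _ => Finset.sum_comm

theorem matExt_comm {R S : Type*} [CommRing R] [Algebra ℂ R] [Ring S] [Algebra ℂ S] [Algebra R S]
    [IsScalarTower ℂ R S] (z z' : R) (φ φ' : Matrix (Fin N) (Fin N) ℂ →ₗ[ℂ] S)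
    (h : ∀ g g', φ g * φ' g' = φ' g' * φ g) (M M' : CurrentAlgebra N) :
    matExt z φ M * matExt z' φ' M' = matExt z' φ' M' * matExt z φ M := by
  have h' : Commute (∑ a, ∑ b, Polynomial.aeval z (M a b) • φ (Matrix.single a b 1))
      (∑ a, ∑ b, Polynomial.aeval z' (M' a b) • φ' (Matrix.single a b 1)) := by
    refine Commute.sum_left _ _ _ fun a _ => Commute.sum_left _ _ _ fun b _ =>
      Commute.sum_right _ _ _ fun c _ => Commute.sum_right _ _ _ fun d _ => ?_
    exact Commute.smul_left (Commute.smul_right (h _ _) _) _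
  exact h'

/-- The action of `gl_N[t]` through the `k`-th factor: `e_{ab} ⊗ tʳ` acts as `z_kʳ e_{ab}^{(k)}`. -/
def slotAction (k : Fin N) : CurrentAlgebra N →ₗ[ℂ] Module.End (PolyZL N) (VSpace N) :=
  matExt (MvPolynomial.X (Sum.inl k) : PolyZL N)
    ((Module.End.baseChangeHom ℂ (PolyZL N) (TensorPow N)).toLinearMap ∘ₗ slot k)

theorem slotAction_mul (k : Fin N) (M M' : CurrentAlgebra N) :
    slotAction k M * slotAction k M' = slotAction k (M * M') := by
  refine matExt_mul _ _ (fun g h => ?_) M M'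
  change Module.End.baseChangeHom ℂ (PolyZL N) (TensorPow N) (slot k g) *
    Module.End.baseChangeHom ℂ (PolyZL N) (TensorPow N) (slot k h) =
    Module.End.baseChangeHom ℂ (PolyZL N) (TensorPow N) (slot k (g * h))
  rw [← map_mul, slot_mul]

theorem slotAction_comm {k l : Fin N} (hkl : k ≠ l) (M M' : CurrentAlgebra N) :
    slotAction k M * slotAction l M' = slotAction l M' * slotAction k M := by
  refine matExt_comm _ _ _ _ (fun g h => ?_) M M'
  change Module.End.baseChangeHom ℂ (PolyZL N) (TensorPow N) (slot k g) *
    Module.End.baseChangeHom ℂ (PolyZL N) (TensorPow N) (slot l h) =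
    Module.End.baseChangeHom ℂ (PolyZL N) (TensorPow N) (slot l h) *
    Module.End.baseChangeHom ℂ (PolyZL N) (TensorPow N) (slot k g)
  rw [← map_mul, ← map_mul, slot_comm hkl]

theorem lie_sum_of_commute {ι S : Type*} [Fintype ι] [DecidableEq ι] [Ring S] (f g : ι → S)
    (h : ∀ i j, i ≠ j → f i * g j = g j * f i) :
    ⁅∑ i, f i, ∑ i, g i⁆ = ∑ i, (f i * g i - g i * f i) := by
  rw [Ring.lie_def, Finset.sum_mul_sum, Finset.sum_mul_sum,
    Finset.sum_comm (f := fun i j => g i * f j), ← Finset.sum_sub_distrib]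
  refine Finset.sum_congr rfl fun i _ => ?_
  rw [← Finset.sum_sub_distrib, Finset.sum_eq_single i]
  · intro j _ hj
    rw [h i j hj.symm, sub_self]
  · simp

/-- The action of `gl_N[t]` on `V^{⊗N} ⊗ ℂ[z, λ]`: the element `e_{ab} ⊗ tʳ` acts as
`∑ₖ z_kʳ e_{ab}^{(k)}`, that is, `g(u)` acts as `∑ₖ g^{(k)} / (u - z_k)`. -/
def currentAction : CurrentAlgebra N →ₗ⁅ℂ⁆ Module.End (PolyZL N) (VSpace N) where
  toLinearMap := ∑ k, slotAction k
  map_lie' := by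
    intro M M'
    simp only [AddHom.toFun_eq_coe, LinearMap.coe_toAddHom, LinearMap.sum_apply]
    rw [lie_sum_of_commute _ _ fun i j hij => slotAction_comm hij M M']
    refine Finset.sum_congr rfl fun k _ => ?_
    rw [slotAction_mul, slotAction_mul, ← map_sub, Ring.lie_def]

/-- The action of `U(gl_N[t])[λ]` on `V^{⊗N} ⊗ ℂ[z, λ]`, the variables `λᵢ` acting by
multiplication. All these operators are `ℂ[z, λ]`-linear. -/
def ulamAction : ULam N →ₐ[ℂ] Module.End (PolyZL N) (VSpace N) :=
  (Algebra.TensorProduct.lift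
    (((Algebra.ofId (PolyZL N) (Module.End (PolyZL N) (VSpace N))).restrictScalars ℂ).comp
      (MvPolynomial.rename Sum.inr))
    (UniversalEnvelopingAlgebra.lift ℂ currentAction)
    (fun p _ => Algebra.commutes (MvPolynomial.rename Sum.inr p : PolyZL N) _) :
    MvPolynomial (Fin N) ℂ ⊗[ℂ] UCurrent N →ₐ[ℂ] Module.End (PolyZL N) (VSpace N))

variable (N)

/-- The subspace `𝒱_𝟏` of `V^{⊗N} ⊗ ℂ[z, λ]` of `gl_N`-weight `(1, …, 1)`: the vectors `v` with
`e_{ii} v = v` for all `i`. -/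
def V1 : Submodule (PolyZL N) (VSpace N) where
  carrier := {v | ∀ i : Fin N, ulamAction (eT i i 0) v = v}
  add_mem' hv hw i := by rw [map_add, hv i, hw i]
  zero_mem' i := map_zero _
  smul_mem' p v hv i := by rw [map_smul, hv i]

/-! ### The Bethe algebra preserves the weight space -/

section Weight

variable {A : Type*} [Ring A]

/-- All coefficients `c` of the series satisfy `[h, c] = k c`. -/
def SeriesWt (h : A) (k : ℤ) (f : PowerSeries A) : Prop :=
  ∀ n, h * PowerSeries.coeff n f - PowerSeries.coeff n f * h = k • PowerSeries.coeff n f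

/-- All coefficients `c` of the differential operator satisfy `[h, c] = k c`. -/
def OpWt (h : A) (k : ℤ) (P : DiffOp A) : Prop := ∀ m, SeriesWt h k (P m)

theorem SeriesWt.zero (h : A) (k : ℤ) : SeriesWt h k 0 := by
  intro n; simp

theorem SeriesWt.add {h : A} {k : ℤ} {f g : PowerSeries A} (hf : SeriesWt h k f)
    (hg : SeriesWt h k g) : SeriesWt h k (f + g) := by
  intro n
  rw [map_add, smul_add, ← hf n, ← hg n]; noncomm_ring

theorem SeriesWt.zsmul {h : A} {k : ℤ} {f : PowerSeries A} (hf : SeriesWt h k f) (c : ℤ) :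
    SeriesWt h k (c • f) := by
  intro n
  rw [map_zsmul, smul_comm k c, ← hf n, smul_sub, mul_smul_comm, smul_mul_assoc]

theorem SeriesWt.mul {h : A} {k l : ℤ} {f g : PowerSeries A} (hf : SeriesWt h k f)
    (hg : SeriesWt h l g) : SeriesWt h (k + l) (f * g) := by
  intro n
  rw [PowerSeries.coeff_mul, Finset.mul_sum, Finset.sum_mul, ← Finset.sum_sub_distrib,
    Finset.smul_sum]
  refine Finset.sum_congr rfl fun p _ => ?_
  rw [add_smul, ← smul_mul_assoc, ← hf p.1, ← mul_smul_comm, ← hg p.2]; noncomm_ring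

theorem OpWt.add {h : A} {k : ℤ} {P Q : DiffOp A} (hP : OpWt h k P) (hQ : OpWt h k Q) :
    OpWt h k (P + Q) := fun m => (hP m).add (hQ m)

theorem OpWt.zsmul {h : A} {k : ℤ} {P : DiffOp A} (hP : OpWt h k P) (c : ℤ) :
    OpWt h k (c • P) := fun m => (hP m).zsmul c

theorem OpWt.zero (h : A) (k : ℤ) : OpWt h k (0 : DiffOp A) := fun _ => SeriesWt.zero h k

theorem OpWt.sub {h : A} {k : ℤ} {P Q : DiffOp A} (hP : OpWt h k P) (hQ : OpWt h k Q) :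
    OpWt h k (P - Q) := by
  rw [sub_eq_add_neg, ← neg_one_zsmul]
  exact hP.add (hQ.zsmul _)

theorem OpWt.sum {ι : Type*} {h : A} {k : ℤ} (t : Finset ι) (P : ι → DiffOp A)
    (hP : ∀ i ∈ t, OpWt h k (P i)) : OpWt h k (∑ i ∈ t, P i) := by
  classical
  induction t using Finset.induction_on with
  | empty => exact OpWt.zero h k
  | insert a t ha ih =>
    rw [Finset.sum_insert ha]
    exact (hP a (Finset.mem_insert_self a t)).add
      (ih fun i hi => hP i (Finset.mem_insert_of_mem hi))

variable [Algebra ℂ A]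

theorem SeriesWt.du {h : A} {k : ℤ} {f : PowerSeries A} (hf : SeriesWt h k f) :
    SeriesWt h k (duSeries f) := by
  intro n
  cases n with
  | zero => rw [coeff_duSeries_zero]; simp
  | succ m =>
    rw [coeff_duSeries_succ, smul_neg, ← mul_smul_comm, ← hf m, mul_neg, ← mul_assoc,
      ← (Nat.cast_commute m h).eq]
    noncomm_ring

theorem OpWt.dOp {h : A} {k : ℤ} {P : DiffOp A} (hP : OpWt h k P) : OpWt h k (dOp P) := by
  intro m
  have hd : Gaudin.dOp P m = duSeries (P m) + (Finsupp.mapDomain Nat.succ P) m := rfl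
  rw [hd]
  refine (hP m).du.add ?_
  cases m with
  | zero =>
    rw [Finsupp.mapDomain_of_notMem_range _ _ (by simp)]
    exact SeriesWt.zero h k
  | succ m =>
    rw [← Nat.succ_eq_add_one, Finsupp.mapDomain_apply Nat.succ_injective]
    exact hP m

theorem OpWt.coefOp {h : A} {k l : ℤ} {a : PowerSeries A} {P : DiffOp A} (ha : SeriesWt h l a)
    (hP : OpWt h k P) : OpWt h (l + k) (coefOp a P) := fun m => ha.mul (hP m)

theorem OpWt.list_prod {ι : Type*} {h : A} (F : ι → Module.End ℂ (DiffOp A)) (w : ι → ℤ)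
    (hF : ∀ i k P, OpWt h k P → OpWt h (w i + k) (F i P)) (l : List ι) {P : DiffOp A}
    (hP : OpWt h 0 P) : OpWt h (l.map w).sum ((l.map F).prod P) := by
  induction l with
  | nil => simpa using hP
  | cons i l ih =>
    rw [List.map_cons, List.map_cons, List.sum_cons, List.prod_cons, Module.End.mul_apply]
    exact hF i _ _ ih

end Weight

variable {N}

theorem eSeries_wt (s a b : Fin N) :
    SeriesWt (eT s s 0) ((if s = a then 1 else 0) - (if s = b then 1 else 0)) (eSeries a b) := by
  intro n
  cases n with
  | zero => simp [eSeries]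
  | succ r =>
    simp only [eSeries, PowerSeries.coeff_mk, eT]
    rw [← map_mul ofU, ← map_mul ofU, ← map_sub ofU, ← Ring.lie_def, ← LieHom.map_lie,
      ← map_zsmul ofU, ← map_zsmul (UniversalEnvelopingAlgebra.ι ℂ), Ring.lie_def]
    congr 2
    rcases eq_or_ne s a with rfl | hsa <;> rcases eq_or_ne s b with rfl | hsb
    · simp
    · rw [Matrix.single_mul_single_of_ne _ _ _ _ hsb.symm]; simp [hsb]
    · rw [Matrix.single_mul_single_of_ne _ _ _ _ hsa]; simp [hsa]
    · rw [Matrix.single_mul_single_of_ne _ _ _ _ hsb.symm,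
        Matrix.single_mul_single_of_ne _ _ _ _ hsa]; simp [hsa, hsb]

theorem lam_wt (s i : Fin N) :
    SeriesWt (eT s s 0) 0 (PowerSeries.C (lam i) : PowerSeries (ULam N)) := by
  intro n
  have hc : eT s s 0 * lam i = lam i * (eT s s 0 : ULam N) := by
    have h (p : MvPolynomial (Fin N) ℂ) (g : UCurrent N) :
        ((1 ⊗ₜ g) * (p ⊗ₜ 1) : MvPolynomial (Fin N) ℂ ⊗[ℂ] UCurrent N) = (p ⊗ₜ 1) * (1 ⊗ₜ g) := by
      simp
    exact h _ _
  rw [PowerSeries.coeff_C]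
  split_ifs
  · rw [hc, sub_self, zero_smul]
  · simp

theorem betheMatrix_wt (s i j : Fin N) (k : ℤ) (P : DiffOp (ULam N)) (hP : OpWt (eT s s 0) k P) :
    OpWt (eT s s 0) (((if s = j then 1 else 0) - (if s = i then 1 else 0)) + k)
      (betheMatrix N i j P) := by
  unfold betheMatrix
  rw [LinearMap.sub_apply]
  refine OpWt.sub ?_ (OpWt.coefOp (eSeries_wt s j i) hP)
  rcases eq_or_ne i j with rfl | hij
  · rw [if_pos rfl, sub_self, zero_add, LinearMap.sub_apply]
    refine hP.dOp.sub ?_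
    simpa using OpWt.coefOp (lam_wt s i) hP
  · rw [if_neg hij]
    exact OpWt.zero _ _

theorem universalOp_wt (s : Fin N) : OpWt (eT s s 0) 0 (universalOp N) := by
  unfold universalOp normalForm rdet
  rw [LinearMap.sum_apply]
  refine OpWt.sum _ _ fun σ _ => ?_
  rw [LinearMap.smul_apply]
  refine OpWt.zsmul ?_ _
  have h1 : OpWt (eT s s 0) 0 (Finsupp.single 0 1 : DiffOp (ULam N)) := by
    intro m n
    rw [Finsupp.single_apply]
    split_ifs
    · rw [PowerSeries.coeff_one]; split_ifs <;> simp
    · simp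
  have h2 := OpWt.list_prod (fun i => betheMatrix N i (σ i)) _
    (fun i k P hP => betheMatrix_wt s i (σ i) k P hP) (List.finRange N) h1
  rw [List.ofFn_eq_map]
  convert h2
  rw [← Fin.sum_univ_def, Finset.sum_sub_distrib,
    Equiv.sum_comp σ (fun i => if s = i then (1 : ℤ) else 0), sub_self]

/-- The Bethe algebra commutes with the elements `e_{ss}`. -/
theorem betheAlgebra_commute (s : Fin N) {b : ULam N} (hb : b ∈ betheAlgebra N) :
    eT s s 0 * b = b * eT s s 0 := by
  have hle : betheAlgebra N ≤ Subalgebra.centralizer ℂ {eT s s 0} := by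
    refine Algebra.adjoin_le ?_
    rintro _ ⟨i, j, -, -, rfl⟩
    rw [SetLike.mem_coe, Subalgebra.mem_centralizer_iff]
    rintro _ rfl
    have := universalOp_wt s (N - i) j
    rw [zero_smul] at this
    exact sub_eq_zero.mp this
  exact (Subalgebra.mem_centralizer_iff ℂ).mp (hle hb) _ rfl

theorem betheAlgebra_preserves {b : ULam N} (hb : b ∈ betheAlgebra N) (v : VSpace N)
    (hv : v ∈ V1 N) : ulamAction b v ∈ V1 N := by
  intro i
  rw [← Module.End.mul_apply, ← map_mul, betheAlgebra_commute i hb, map_mul, Module.End.mul_apply,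
    hv i]

variable (N)

/-- The action of the Bethe algebra on `𝒱_𝟏`. -/
def betheAction : betheAlgebra N →ₐ[ℂ] Module.End ℂ (V1 N) where
  toFun b := ((ulamAction (b : ULam N)).restrict (betheAlgebra_preserves b.2)).restrictScalars ℂ
  map_one' := LinearMap.ext fun v => Subtype.ext <| by
    change ulamAction (1 : ULam N) (v : VSpace N) = v
    rw [map_one]; rfl
  map_mul' a b := LinearMap.ext fun v => Subtype.ext <| by
    change ulamAction ((a : ULam N) * (b : ULam N)) (v : VSpace N) =
      ulamAction (a : ULam N) (ulamAction (b : ULam N) (v : VSpace N))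
    rw [map_mul]; rfl
  map_zero' := LinearMap.ext fun v => Subtype.ext <| by
    change ulamAction (0 : ULam N) (v : VSpace N) = 0
    rw [map_zero]; rfl
  map_add' a b := LinearMap.ext fun v => Subtype.ext <| by
    change ulamAction ((a : ULam N) + (b : ULam N)) (v : VSpace N) =
      ulamAction (a : ULam N) (v : VSpace N) + ulamAction (b : ULam N) (v : VSpace N)
    rw [map_add]; rfl
  commutes' c := LinearMap.ext fun v => Subtype.ext <| by
    change ulamAction (algebraMap ℂ (ULam N) c) (v : VSpace N) = c • (v : VSpace N)
    rw [AlgHom.commutes]; rfl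

/-- The image `ℬ̄_N` of the Bethe algebra in `End(𝒱_𝟏)`. -/
def betheImage : Subalgebra ℂ (Module.End ℂ (V1 N)) := (betheAction N).range

/-! ### The rational Cherednik algebra -/

/-- Generators of the rational Cherednik algebra: `xᵢ`, `yᵢ` and the elements of `S_N`. -/
inductive CherednikGen
  | x (i : Fin N)
  | y (i : Fin N)
  | s (σ : Equiv.Perm (Fin N))

variable {N}

/-- The free generator `xᵢ`. -/
abbrev genX (i : Fin N) : FreeAlgebra ℂ (CherednikGen N) := FreeAlgebra.ι ℂ (.x i)

/-- The free generator `yᵢ`. -/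
abbrev genY (i : Fin N) : FreeAlgebra ℂ (CherednikGen N) := FreeAlgebra.ι ℂ (.y i)

/-- The free generator attached to a permutation. -/
abbrev genS (σ : Equiv.Perm (Fin N)) : FreeAlgebra ℂ (CherednikGen N) := FreeAlgebra.ι ℂ (.s σ)

variable (N)

/-- Defining relations of the rational Cherednik algebra of `S_N`; the first two say that the
elements of `S_N` multiply as in the group. -/
inductive CherednikRel : FreeAlgebra ℂ (CherednikGen N) → FreeAlgebra ℂ (CherednikGen N) → Prop
  | perm_one : CherednikRel (genS 1) 1
  | perm_mul (σ τ : Equiv.Perm (Fin N)) : CherednikRel (genS (σ * τ)) (genS σ * genS τ)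
  | x_comm (i j : Fin N) : CherednikRel (genX i * genX j) (genX j * genX i)
  | y_comm (i j : Fin N) : CherednikRel (genY i * genY j) (genY j * genY i)
  | perm_x (σ : Equiv.Perm (Fin N)) (i : Fin N) :
      CherednikRel (genS σ * genX i) (genX (σ i) * genS σ)
  | perm_y (σ : Equiv.Perm (Fin N)) (i : Fin N) :
      CherednikRel (genS σ * genY i) (genY (σ i) * genS σ)
  | x_y_ne (i j : Fin N) (h : i ≠ j) :
      CherednikRel (genX i * genY j - genY j * genX i) (genS (Equiv.swap i j))
  | x_y_eq (i : Fin N) :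
      CherednikRel (genX i * genY i - genY i * genX i)
        (-∑ a ∈ Finset.univ.erase i, genS (Equiv.swap i a))

/-- The rational Cherednik algebra `H_N` associated with `S_N`. -/
def Cherednik := RingQuot (CherednikRel N)

instance : Ring (Cherednik N) := inferInstanceAs (Ring (RingQuot (CherednikRel N)))

instance : Algebra ℂ (Cherednik N) := inferInstanceAs (Algebra ℂ (RingQuot (CherednikRel N)))

/-- The quotient map onto `H_N`. -/
def Cherednik.mk : FreeAlgebra ℂ (CherednikGen N) →ₐ[ℂ] Cherednik N :=
  RingQuot.mkAlgHom ℂ (CherednikRel N)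

variable {N}

/-- The generator `xᵢ` of `H_N`. -/
def Cherednik.x (i : Fin N) : Cherednik N := Cherednik.mk N (genX i)

/-- The generator `yᵢ` of `H_N`. -/
def Cherednik.y (i : Fin N) : Cherednik N := Cherednik.mk N (genY i)

/-- The embedding of `S_N` in `H_N`. -/
def Cherednik.perm : Equiv.Perm (Fin N) →* Cherednik N where
  toFun σ := Cherednik.mk N (genS σ)
  map_one' := (RingQuot.mkAlgHom_rel ℂ CherednikRel.perm_one).trans (map_one (Cherednik.mk N))
  map_mul' σ τ := (RingQuot.mkAlgHom_rel ℂ (CherednikRel.perm_mul σ τ)).trans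
    (map_mul (Cherednik.mk N) _ _)

variable (N)

/-- The symmetrizing element `e = (1/N!) ∑ σ`. -/
def symmetrizer : Cherednik N :=
  ((N.factorial : ℂ)⁻¹) • ∑ σ : Equiv.Perm (Fin N), Cherednik.perm σ

theorem symmetrizer_idem : IsIdempotentElem (symmetrizer N) := by
  have h : ∀ σ : Equiv.Perm (Fin N), Cherednik.perm σ * (∑ τ : Equiv.Perm (Fin N), Cherednik.perm τ)
      = ∑ τ : Equiv.Perm (Fin N), Cherednik.perm τ := by
    intro σ
    rw [Finset.mul_sum]
    simp only [← map_mul]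
    exact Equiv.sum_comp (Equiv.mulLeft σ) (fun τ => Cherednik.perm τ)
  have hN : (N.factorial : ℂ) ≠ 0 := by exact_mod_cast N.factorial_ne_zero
  unfold IsIdempotentElem symmetrizer
  rw [smul_mul_smul_comm, Finset.sum_mul]
  simp only [h]
  rw [Finset.sum_const, Finset.card_univ, Fintype.card_perm, Fintype.card_fin,
    ← Nat.cast_smul_eq_nsmul ℂ, smul_smul, mul_assoc, inv_mul_cancel₀ hN, mul_one]

/-- The spherical subalgebra `U_N = e H_N e`, an algebra with unit `e`. -/
abbrev Spherical := (symmetrizer_idem N).Corner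

instance : Module ℂ (Spherical N) where
  smul c a := ⟨c • (a.1 : Cherednik N), by
    obtain ⟨b, hb⟩ := a.2
    exact ⟨c • b, by simp only [mul_smul_comm, smul_mul_assoc, ← hb]⟩⟩
  one_smul a := Subtype.ext (one_smul ℂ (a.1 : Cherednik N))
  mul_smul c d a := Subtype.ext (mul_smul c d (a.1 : Cherednik N))
  smul_zero c := Subtype.ext (smul_zero c : c • (0 : Cherednik N) = 0)
  smul_add c a b := Subtype.ext (smul_add c (a.1 : Cherednik N) b.1)
  add_smul c d a := Subtype.ext (add_smul c d (a.1 : Cherednik N))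
  zero_smul a := Subtype.ext (zero_smul ℂ (a.1 : Cherednik N))

instance : Algebra ℂ (Spherical N) :=
  Algebra.ofModule (fun c a b => Subtype.ext (smul_mul_assoc c (a.1 : Cherednik N) b.1))
    (fun c a b => Subtype.ext (mul_smul_comm c (a.1 : Cherednik N) b.1))

/-! ### The map `ι` and the two actions of `S_N` -/

variable {N}

/-- The basis vector `ε_{f(1)} ⊗ ⋯ ⊗ ε_{f(N)}` of `V^{⊗N}`. -/
def epsVec (f : Fin N → Fin N) : TensorPow N :=
  PiTensorProduct.tprod ℂ fun k => (Pi.single (f k) 1 : Fin N → ℂ)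

/-- The coordinate of a tensor at `ε_{f(1)} ⊗ ⋯ ⊗ ε_{f(N)}`. -/
def epsCoord (f : Fin N → Fin N) : TensorPow N →ₗ[ℂ] ℂ :=
  PiTensorProduct.lift ((MultilinearMap.mkPiAlgebra ℂ (Fin N) ℂ).compLinearMap
    fun k => LinearMap.proj (f k))

theorem epsCoord_epsVec (f g : Fin N → Fin N) :
    epsCoord f (epsVec g) = if f = g then 1 else 0 := by
  simp only [epsCoord, epsVec, PiTensorProduct.lift.tprod, MultilinearMap.compLinearMap_apply,
    LinearMap.proj_apply, MultilinearMap.mkPiAlgebra_apply, Pi.single_apply]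
  split_ifs with h
  · subst h; simp
  · obtain ⟨k, hk⟩ := Function.ne_iff.mp h
    exact Finset.prod_eq_zero (Finset.mem_univ k) (if_neg hk)

/-- The monomial `x₁^{a₁} ⋯ x_N^{a_N}` in `H_N`. -/
def Cherednik.xMon (a : Fin N → ℕ) : Cherednik N := (List.ofFn fun i => Cherednik.x i ^ a i).prod

/-- The monomial `y₁^{a₁} ⋯ y_N^{a_N}` in `H_N`. -/
def Cherednik.yMon (a : Fin N → ℕ) : Cherednik N := (List.ofFn fun i => Cherednik.y i ^ a i).prod

/-- The linear map `ℂ[z, λ] → H_N` sending `p(z) q(λ)` to `q(x) τ p(y)`. -/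
def normalOrd (τ : Equiv.Perm (Fin N)) : PolyZL N →ₗ[ℂ] Cherednik N :=
  (MvPolynomial.basisMonomials (Fin N ⊕ Fin N) ℂ).constr ℂ fun m =>
    Cherednik.xMon (fun i => m (Sum.inr i)) * Cherednik.perm τ *
      Cherednik.yMon (fun i => m (Sum.inl i))

/-- The linear map `V^{⊗N} ⊗ ℂ[z, λ] → H_N` which sends `p(z) q(λ) ε_τ` to `q(x) τ p(y)` for all
`τ ∈ S_N` (and the other basis vectors of `V^{⊗N}`, which do not have weight `(1, …, 1)`, to `0`). -/
def iotaFull : VSpace N →ₗ[ℂ] Cherednik N :=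
  ∑ τ : Equiv.Perm (Fin N), normalOrd τ ∘ₗ
    (TensorProduct.rid ℂ (PolyZL N)).toLinearMap ∘ₗ (epsCoord τ).lTensor (PolyZL N)

theorem iotaFull_tmul_epsVec (p : PolyZL N) (τ : Equiv.Perm (Fin N)) :
    iotaFull (p ⊗ₜ epsVec τ) = normalOrd τ p := by
  simp only [iotaFull, LinearMap.sum_apply, LinearMap.comp_apply, LinearMap.lTensor_tmul,
    LinearEquiv.coe_coe, TensorProduct.rid_tmul, epsCoord_epsVec]
  rw [Finset.sum_eq_single τ]
  · simp
  · intro σ _ hσ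
    rw [if_neg fun h => hσ (DFunLike.coe_injective h), zero_smul, map_zero]
  · simp

variable (N)

/-- The map `ι : 𝒱_𝟏 → H_N`, `p(z) q(λ) ε_τ ↦ q(x) τ p(y)`. -/
def iota : V1 N →ₗ[ℂ] Cherednik N := iotaFull ∘ₗ ((V1 N).subtype.restrictScalars ℂ)

variable {N}

/-- The left action of `S_N`: it permutes the variables `λᵢ` and the vectors `ε_j`. -/
def leftAct (σ : Equiv.Perm (Fin N)) : VSpace N →ₗ[ℂ] VSpace N :=
  TensorProduct.map (MvPolynomial.rename (Sum.map id σ)).toLinearMap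
    (PiTensorProduct.map fun _ => LinearMap.funLeft ℂ ℂ σ.symm)

/-- The right action of `S_N`: it permutes the variables `zᵢ` and the factors of `V^{⊗N}`. -/
def rightAct (σ : Equiv.Perm (Fin N)) : VSpace N →ₗ[ℂ] VSpace N :=
  TensorProduct.map (MvPolynomial.rename (Sum.map σ id)).toLinearMap
    (PiTensorProduct.reindex ℂ (fun _ => Fin N → ℂ) σ).toLinearMap

theorem leftAct_tmul_epsVec (σ : Equiv.Perm (Fin N)) (p : PolyZL N) (f : Fin N → Fin N) :
    leftAct σ (p ⊗ₜ epsVec f) =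
      MvPolynomial.rename (Sum.map id σ) p ⊗ₜ epsVec fun k => σ (f k) := by
  simp only [leftAct, TensorProduct.map_tmul, epsVec, PiTensorProduct.map_tprod]
  have h : ∀ k, LinearMap.funLeft ℂ ℂ σ.symm (Pi.single (f k) 1 : Fin N → ℂ) =
      Pi.single (σ (f k)) 1 := by
    intro k
    ext i
    simp [LinearMap.funLeft_apply, Pi.single_apply, Equiv.symm_apply_eq]
  simp only [h]
  rfl

theorem rightAct_tmul_epsVec (σ : Equiv.Perm (Fin N)) (p : PolyZL N) (f : Fin N → Fin N) :
    rightAct σ (p ⊗ₜ epsVec f) =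
      MvPolynomial.rename (Sum.map σ id) p ⊗ₜ epsVec fun k => f (σ.symm k) := by
  simp only [rightAct, TensorProduct.map_tmul, epsVec, LinearEquiv.coe_coe,
    PiTensorProduct.reindex_tprod]
  rfl

variable (N)

/-- The subspace of `𝒱_𝟏` of vectors invariant under both the left and the right action. -/
def V1LR : Submodule ℂ (V1 N) where
  carrier := {v | ∀ σ : Equiv.Perm (Fin N), leftAct σ (v : VSpace N) = v ∧
    rightAct σ (v : VSpace N) = v}
  add_mem' {v w} hv hw σ := by
    simp only [Submodule.coe_add, map_add, (hv σ).1, (hv σ).2, (hw σ).1, (hw σ).2, and_self]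
  zero_mem' σ := by simp
  smul_mem' c v hv σ := by
    change leftAct σ (c • (v : VSpace N)) = c • (v : VSpace N) ∧
      rightAct σ (c • (v : VSpace N)) = c • (v : VSpace N)
    rw [map_smul, map_smul, (hv σ).1, (hv σ).2]
    exact ⟨rfl, rfl⟩

end Gaudin

end

noncomputable section

namespace Gaudin

/-! ### Divided differences -/

section DivDiff

open MvPolynomial

/-! Bijectivity of ι is the PBW theorem for `H_N`: every element is uniquely a sum of normally
ordered expressions q(x) τ p(y). Spanning follows from the relations. For uniqueness, `H_N` acts on
⨁_τ ℂ[z, λ] by the formulas that left multiplication must have on normally ordered expressions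
(`polyRep`). There y_i is a Dunkl operator built from divided differences in λ, and applying q(x) τ
p(y) to the unit of the component 1 returns its coordinates (`polyRep_pbw`).

Under ι, multiplication by λ_i is left multiplication by x_i, multiplication by z_k is right
multiplication by y_k, σ^L is left multiplication by σ and σ^R is right multiplication by σ⁻¹. Hence
the doubly invariant vectors correspond to e H_N e. What remains is to show that each b in the image
of the Bethe algebra acts as left multiplication by some c_b ∈ H_N, and that b ↦ c_b e is a
bijection onto e H_N e.

Existence of c_b rests on a Capelli type identity (`sum_sign_rowOp`). On ε_τ the row determinant
equals the sum over σ of sgn(σ) ∏_i (δ_{σ(i),i} (∂ - λ_i) - 1/(u - z_{τ⁻¹(i)})) ε_{στ} with ∂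
ordered to the right, because the corrections from differentiating 1/(u - z) cancel those from two
tensor factors carrying the same index. The coefficients at τ = 1 define `betheElt`. Partial
fractions evaluate the divided differences that arise when x_j moves through it, and the alternating
signs then make it commute with every x_j (`betheElt_mul_x`). It also commutes with S_N. So left
multiplication by it agrees with the Bethe generator on each τ, hence after multiplying by any x on
the left and any y on the right.

Surjectivity is cyclicity of the vector ∑_τ ε_τ. An invariant vector is determined by its coordinate
at the identity, a polynomial invariant under simultaneous permutations of z and λ. Filtered by
degree, Bethe elements act on it by multiplication by symbols (`IsSymbol`). The leading symbols of
the generators yield all polarized power sums ∑_j z_j^s λ_j^a, and by Weyl's theorem on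
polarizations these generate the diagonal invariants; induction on degree finishes.

Injectivity says that c commuting with all x_j and satisfying c e = 0 must vanish
(`eq_zero_of_mul_sum_perm`). Combining left and right multiplications by the x's isolates the
identity term of c ∑_τ τ. -/

theorem X_sub_X_ne_zero {ι : Type*} {i j : ι} (h : i ≠ j) : (X i - X j : MvPolynomial ι ℂ) ≠ 0 :=
  sub_ne_zero.mpr fun e => h (X_injective e)

variable {ι : Type*} [DecidableEq ι]

/-- For the inductive step, p X_k - s(p X_k) = (p - s p) X_k + s(p) (X_k - s X_k), and X_k - s X_k
is 0 or ±(X_i - X_j). -/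
theorem exists_divDiff (i j : ι) (p : MvPolynomial ι ℂ) :
    ∃ q, (X i - X j) * q = p - rename (Equiv.swap i j) p := by
  induction p using MvPolynomial.induction_on with
  | C a => exact ⟨0, by simp⟩
  | add p q hp hq =>
    obtain ⟨a, ha⟩ := hp
    obtain ⟨b, hb⟩ := hq
    exact ⟨a + b, by rw [mul_add, ha, hb, map_add]; ring⟩
  | mul_X p k hp =>
    obtain ⟨a, ha⟩ := hp
    have hk : ∃ c : MvPolynomial ι ℂ, (X i - X j) * c = X k - X (Equiv.swap i j k) := by
      rcases eq_or_ne k i with rfl | hi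
      · exact ⟨1, by simp⟩
      rcases eq_or_ne k j with rfl | hj
      · exact ⟨-1, by simp⟩
      · exact ⟨0, by simp [Equiv.swap_apply_of_ne_of_ne hi hj]⟩
    obtain ⟨c, hc⟩ := hk
    refine ⟨a * X k + rename (Equiv.swap i j) p * c, ?_⟩
    rw [map_mul, rename_X, mul_add, ← mul_assoc, ha, mul_left_comm, hc]
    ring

/-- The divided difference `p ↦ (p - s_{ij} p) / (X i - X j)`. -/
def divDiff (i j : ι) : MvPolynomial ι ℂ →ₗ[ℂ] MvPolynomial ι ℂ where
  -- The value at `i = j` is a convention; the identities below all assume `i ≠ j`.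
  toFun p := if i = j then 0 else (exists_divDiff i j p).choose
  map_add' p q := by
    split_ifs with h
    · simp
    · refine mul_left_cancel₀ (X_sub_X_ne_zero h) ?_
      rw [mul_add, (exists_divDiff i j p).choose_spec, (exists_divDiff i j q).choose_spec,
        (exists_divDiff i j (p + q)).choose_spec, map_add]
      ring
  map_smul' c p := by
    split_ifs with h
    · simp
    · refine mul_left_cancel₀ (X_sub_X_ne_zero h) ?_
      rw [RingHom.id_apply, mul_smul_comm, (exists_divDiff i j p).choose_spec,
        (exists_divDiff i j (c • p)).choose_spec, map_smul, smul_sub]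

theorem divDiff_spec {i j : ι} (h : i ≠ j) (p : MvPolynomial ι ℂ) :
    (X i - X j) * divDiff i j p = p - rename (Equiv.swap i j) p := by
  change (X i - X j) * (if i = j then 0 else (exists_divDiff i j p).choose) = _
  rw [if_neg h, (exists_divDiff i j p).choose_spec]

/-- Cancelling X_i - X_j in a domain is how the properties of divided differences are obtained
below. -/
theorem eq_divDiff {i j : ι} (h : i ≠ j) {p q : MvPolynomial ι ℂ}
    (hq : (X i - X j) * q = p - rename (Equiv.swap i j) p) : divDiff i j p = q :=
  mul_left_cancel₀ (X_sub_X_ne_zero h) ((divDiff_spec h p).trans hq.symm)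

theorem divDiff_mul {i j : ι} (h : i ≠ j) (p q : MvPolynomial ι ℂ) :
    divDiff i j (p * q) = p * divDiff i j q + divDiff i j p * rename (Equiv.swap i j) q := by
  refine eq_divDiff h ?_
  rw [mul_add, mul_left_comm, divDiff_spec h, ← mul_assoc, divDiff_spec h, map_mul]
  ring

theorem divDiff_mul_of_rename_eq {i j : ι} (h : i ≠ j) {p : MvPolynomial ι ℂ}
    (hp : rename (Equiv.swap i j) p = p) (q : MvPolynomial ι ℂ) :
    divDiff i j (p * q) = p * divDiff i j q := by
  refine eq_divDiff h ?_
  rw [mul_left_comm, divDiff_spec h, map_mul, hp, mul_sub]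

theorem divDiff_X_left {i j : ι} (h : i ≠ j) : divDiff i j (X i) = 1 :=
  eq_divDiff h (by simp)

theorem divDiff_X_right {i j : ι} (h : i ≠ j) : divDiff i j (X j) = -1 :=
  eq_divDiff h (by simp)

theorem divDiff_of_rename_eq {i j : ι} (h : i ≠ j) {p : MvPolynomial ι ℂ}
    (hp : rename (Equiv.swap i j) p = p) : divDiff i j p = 0 :=
  eq_divDiff h (by simp [hp])

theorem rename_divDiff (σ : Equiv.Perm ι) {i j : ι} (h : i ≠ j) (p : MvPolynomial ι ℂ) :
    rename σ (divDiff i j p) = divDiff (σ i) (σ j) (rename σ p) := by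
  refine (eq_divDiff (σ.injective.ne h) ?_).symm
  have := congrArg (rename σ) (divDiff_spec h p)
  rw [map_mul, map_sub, map_sub, rename_X, rename_X, rename_rename] at this
  rw [this, rename_rename]
  congr 3
  ext k
  simp [Equiv.swap_apply_apply]

end DivDiff

/-! ### Relations in the Cherednik algebra and the normal ordering map -/

variable {N : ℕ}

/-- The action of `σ` on polynomials permuting the variables `λ`. -/
abbrev permLam (σ : Equiv.Perm (Fin N)) : PolyZL N →ₐ[ℂ] PolyZL N :=
  MvPolynomial.rename (Sum.map id σ)

/-- The action of `σ` on polynomials permuting the variables `z`. -/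
abbrev permZ (σ : Equiv.Perm (Fin N)) : PolyZL N →ₐ[ℂ] PolyZL N :=
  MvPolynomial.rename (Sum.map σ id)

/-- The variable `λᵢ`. -/
abbrev lamV (i : Fin N) : PolyZL N := MvPolynomial.X (Sum.inr i)

/-- The variable `zᵢ`. -/
abbrev zV (i : Fin N) : PolyZL N := MvPolynomial.X (Sum.inl i)

theorem rename_swap_inr (i j : Fin N) (p : PolyZL N) :
    MvPolynomial.rename (Equiv.swap (Sum.inr i) (Sum.inr j)) p = permLam (Equiv.swap i j) p := by
  rw [← Equiv.Perm.sumCongr_one_swap]; rfl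

theorem rename_swap_inl (i j : Fin N) (p : PolyZL N) :
    MvPolynomial.rename (Equiv.swap (Sum.inl i) (Sum.inl j)) p = permZ (Equiv.swap i j) p := by
  rw [← Equiv.Perm.sumCongr_swap_one]; rfl

/-- The divided difference in the variables `λᵢ`, `λⱼ`. -/
abbrev divLam (i j : Fin N) : PolyZL N →ₗ[ℂ] PolyZL N := divDiff (Sum.inr i) (Sum.inr j)

/-- The divided difference in the variables `zᵢ`, `zⱼ`. -/
abbrev divZ (i j : Fin N) : PolyZL N →ₗ[ℂ] PolyZL N := divDiff (Sum.inl i) (Sum.inl j)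

theorem permLam_mul (σ τ : Equiv.Perm (Fin N)) (p : PolyZL N) :
    permLam (σ * τ) p = permLam σ (permLam τ p) := by
  rw [MvPolynomial.rename_rename, Sum.map_comp_map]; rfl

theorem permLam_one (p : PolyZL N) : permLam 1 p = p := by
  simp [permLam]

theorem permLam_permZ (σ τ : Equiv.Perm (Fin N)) (p : PolyZL N) :
    permLam σ (permZ τ p) = permZ τ (permLam σ p) := by
  rw [MvPolynomial.rename_rename, MvPolynomial.rename_rename, Sum.map_comp_map, Sum.map_comp_map]
  rfl

theorem permLam_divLam (σ : Equiv.Perm (Fin N)) {i j : Fin N} (h : i ≠ j) (p : PolyZL N) :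
    permLam σ (divLam i j p) = divLam (σ i) (σ j) (permLam σ p) :=
  rename_divDiff (Equiv.sumCongr (Equiv.refl _) σ) (Sum.inr_injective.ne h) p

namespace Cherednik

theorem x_comm (i j : Fin N) : x i * x j = x j * x i := by
  have := RingQuot.mkAlgHom_rel ℂ (CherednikRel.x_comm (N := N) i j)
  rwa [map_mul, map_mul] at this

theorem y_comm (i j : Fin N) : y i * y j = y j * y i := by
  have := RingQuot.mkAlgHom_rel ℂ (CherednikRel.y_comm (N := N) i j)
  rwa [map_mul, map_mul] at this

theorem perm_mul_x (σ : Equiv.Perm (Fin N)) (i : Fin N) :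
    perm σ * x i = x (σ i) * perm σ := by
  have := RingQuot.mkAlgHom_rel ℂ (CherednikRel.perm_x (N := N) σ i)
  rwa [map_mul, map_mul] at this

theorem perm_mul_y (σ : Equiv.Perm (Fin N)) (i : Fin N) :
    perm σ * y i = y (σ i) * perm σ := by
  have := RingQuot.mkAlgHom_rel ℂ (CherednikRel.perm_y (N := N) σ i)
  rwa [map_mul, map_mul] at this

theorem x_mul_y_of_ne {i j : Fin N} (h : i ≠ j) :
    x i * y j = y j * x i + perm (Equiv.swap i j) := by
  have := RingQuot.mkAlgHom_rel ℂ (CherednikRel.x_y_ne (N := N) i j h)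
  rw [map_sub, map_mul, map_mul] at this
  exact sub_eq_iff_eq_add'.mp this

theorem x_mul_y_self (i : Fin N) :
    x i * y i = y i * x i - ∑ a ∈ Finset.univ.erase i, perm (Equiv.swap i a) := by
  have := RingQuot.mkAlgHom_rel ℂ (CherednikRel.x_y_eq (N := N) i)
  rw [map_sub, map_mul, map_mul, map_neg, map_sum] at this
  rw [sub_eq_add_neg]
  exact sub_eq_iff_eq_add'.mp this

end Cherednik

open Cherednik

/-- The monomials in `H_N` are ordered list products; commutativity among the x's, or among the y's,
lets a new factor enter at its proper place. -/
theorem list_ofFn_pow_single_add {R : Type*} [Ring R] {n : ℕ} (g : Fin n → R)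
    (hg : ∀ i j, Commute (g i) (g j)) (i : Fin n) (m : Fin n → ℕ) :
    (List.ofFn fun j => g j ^ ((if i = j then 1 else 0) + m j)).prod =
      g i * (List.ofFn fun j => g j ^ m j).prod := by
  induction n with
  | zero => exact i.elim0
  | succ n ih =>
    rw [List.ofFn_succ, List.ofFn_succ, List.prod_cons, List.prod_cons]
    refine Fin.cases ?_ (fun i => ?_) i
    · simp [pow_add, mul_assoc, (Fin.succ_ne_zero _).symm]
    · have h := ih (fun j => g j.succ) (fun _ _ => hg _ _) i (fun j => m j.succ)
      simp only [Fin.succ_inj, Fin.succ_ne_zero, if_false, zero_add] at h ⊢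
      rw [h, ← mul_assoc, ← mul_assoc, ((hg _ _).pow_left _).eq]

theorem normalOrd_monomial (τ : Equiv.Perm (Fin N)) (m : Fin N ⊕ Fin N →₀ ℕ) :
    normalOrd τ (MvPolynomial.monomial m 1) = xMon (fun i => m (Sum.inr i)) * perm τ *
      yMon (fun i => m (Sum.inl i)) := by
  have h := (MvPolynomial.basisMonomials (Fin N ⊕ Fin N) ℂ).constr_basis ℂ (fun m =>
    xMon (fun i => m (Sum.inr i)) * perm τ * yMon (fun i => m (Sum.inl i))) m
  rwa [MvPolynomial.coe_basisMonomials] at h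

theorem linearMap_ext_monomial {ι M : Type*} [AddCommMonoid M] [Module ℂ M]
    {f g : MvPolynomial ι ℂ →ₗ[ℂ] M}
    (h : ∀ m, f (MvPolynomial.monomial m 1) = g (MvPolynomial.monomial m 1)) (p) : f p = g p :=
  LinearMap.congr_fun ((MvPolynomial.basisMonomials ι ℂ).ext fun m => by simpa using h m) p

theorem X_mul_monomial_one {ι : Type*} (i : ι) (m : ι →₀ ℕ) :
    (MvPolynomial.X i * MvPolynomial.monomial m 1 : MvPolynomial ι ℂ) =
      MvPolynomial.monomial (Finsupp.single i 1 + m) 1 := by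
  rw [MvPolynomial.X, MvPolynomial.monomial_mul, one_mul]

/-- Together with `normalOrd_z_mul` and `normalOrd_one` this characterizes `normalOrd`; later
arguments use only these three rules and `polyZL_induction`. -/
theorem normalOrd_lam_mul (τ : Equiv.Perm (Fin N)) (i : Fin N) (p : PolyZL N) :
    normalOrd τ (lamV i * p) = x i * normalOrd τ p := by
  refine linearMap_ext_monomial (f := normalOrd τ ∘ₗ LinearMap.mulLeft ℂ (lamV i))
    (g := LinearMap.mulLeft ℂ (x i) ∘ₗ normalOrd τ) (fun m => ?_) p
  simp only [LinearMap.comp_apply, LinearMap.mulLeft_apply, X_mul_monomial_one,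
    normalOrd_monomial, ← mul_assoc]
  congr 2
  · rw [xMon, xMon, ← list_ofFn_pow_single_add (fun j => x j) x_comm]
    simp [Finsupp.single_apply, Sum.inr_injective.eq_iff]
  · simp

theorem yMon_comm_y (i : Fin N) (m : Fin N → ℕ) : Commute (y i) (yMon m) := by
  unfold yMon
  refine Commute.list_prod_right _ _ fun a ha => ?_
  obtain ⟨j, rfl⟩ := (List.mem_ofFn' _ _).mp ha
  exact Commute.pow_right (y_comm i j) _

theorem normalOrd_z_mul (τ : Equiv.Perm (Fin N)) (i : Fin N) (p : PolyZL N) :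
    normalOrd τ (zV i * p) = normalOrd τ p * y i := by
  refine linearMap_ext_monomial (f := normalOrd τ ∘ₗ LinearMap.mulLeft ℂ (zV i))
    (g := LinearMap.mulRight ℂ (y i) ∘ₗ normalOrd τ) (fun m => ?_) p
  simp only [LinearMap.comp_apply, LinearMap.mulLeft_apply, LinearMap.mulRight_apply,
    X_mul_monomial_one, normalOrd_monomial, mul_assoc]
  rw [← (yMon_comm_y i _).eq]
  congr 2
  · simp
  · rw [yMon, yMon, ← list_ofFn_pow_single_add (fun j => y j) y_comm]
    simp [Finsupp.single_apply, Sum.inl_injective.eq_iff]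

theorem normalOrd_one (τ : Equiv.Perm (Fin N)) : normalOrd τ 1 = perm τ := by
  change normalOrd τ (MvPolynomial.monomial 0 1) = _
  rw [normalOrd_monomial]
  simp [xMon, yMon]

/-- Induction over polynomials in `z, λ`, by linearity and multiplication by variables. -/
theorem polyZL_induction {C : PolyZL N → Prop} (one : C 1) (smul : ∀ (c : ℂ) p, C p → C (c • p))
    (add : ∀ p q, C p → C q → C (p + q)) (lam : ∀ i p, C p → C (lamV i * p))
    (z : ∀ i p, C p → C (zV i * p)) (p : PolyZL N) : C p := by
  induction p using MvPolynomial.induction_on with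
  | C a => simpa [MvPolynomial.smul_eq_C_mul] using smul a 1 one
  | add p q hp hq => exact add p q hp hq
  | mul_X p k hp =>
    rw [mul_comm]
    rcases k with k | k
    · exact z k p hp
    · exact lam k p hp

/-! ### Multiplying normally ordered expressions by permutations and by x -/

theorem perm_mul_normalOrd (σ τ : Equiv.Perm (Fin N)) (p : PolyZL N) :
    perm σ * normalOrd τ p = normalOrd (σ * τ) (permLam σ p) := by
  induction p using polyZL_induction with
  | one => rw [map_one (MvPolynomial.rename _), normalOrd_one, normalOrd_one, map_mul]
  | smul c p hp => rw [map_smul, map_smul, map_smul, mul_smul_comm, hp]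
  | add p q hp hq => rw [map_add, map_add, map_add, mul_add, hp, hq]
  | lam i p hp =>
    rw [normalOrd_lam_mul, map_mul, MvPolynomial.rename_X, Sum.map_inr, normalOrd_lam_mul, ← hp,
      ← mul_assoc, perm_mul_x, mul_assoc]
  | z i p hp =>
    rw [normalOrd_z_mul, map_mul, MvPolynomial.rename_X, Sum.map_inl, id, normalOrd_z_mul, ← hp,
      mul_assoc]

/-- Moving σ to the left past p(y) renames the y's by σ⁻¹. -/
theorem normalOrd_mul_perm (σ τ : Equiv.Perm (Fin N)) (p : PolyZL N) :
    normalOrd τ p * perm σ = normalOrd (τ * σ) (permZ σ⁻¹ p) := by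
  induction p using polyZL_induction with
  | one => rw [map_one (MvPolynomial.rename _), normalOrd_one, normalOrd_one, map_mul]
  | smul c p hp => rw [map_smul, map_smul, map_smul, smul_mul_assoc, hp]
  | add p q hp hq => rw [map_add, map_add, map_add, add_mul, hp, hq]
  | lam i p hp =>
    rw [normalOrd_lam_mul, map_mul, MvPolynomial.rename_X, Sum.map_inr, id, normalOrd_lam_mul,
      ← hp, mul_assoc]
  | z i p hp =>
    have h : y i * perm σ = perm σ * y (σ⁻¹ i) := by
      rw [perm_mul_y]; simp
    rw [normalOrd_z_mul, map_mul, MvPolynomial.rename_X, Sum.map_inl, normalOrd_z_mul, ← hp,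
      mul_assoc, h, mul_assoc]

theorem divZ_lam_mul {i j : Fin N} (h : i ≠ j) (k : Fin N) (p : PolyZL N) :
    divZ i j (lamV k * p) = lamV k * divZ i j p :=
  divDiff_mul_of_rename_eq (Sum.inl_injective.ne h) (by rw [rename_swap_inl]; simp) p

theorem divZ_z_mul {i j : Fin N} (h : i ≠ j) (k : Fin N) (p : PolyZL N) :
    divZ i j (zV k * p) = zV k * divZ i j p + ((if k = i then 1 else 0) -
      (if k = j then 1 else 0)) * permZ (Equiv.swap i j) p := by
  have h' := (Sum.inl_injective (β := Fin N)).ne h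
  rw [divZ, divDiff_mul h', rename_swap_inl]
  congr 2
  rcases eq_or_ne k i with rfl | hi
  · simp [divDiff_X_left h', h]
  rcases eq_or_ne k j with rfl | hj
  · simp [divDiff_X_right h', h.symm]
  · rw [divDiff_of_rename_eq h']
    · simp [hi, hj]
    · rw [rename_swap_inl, MvPolynomial.rename_X, Sum.map_inl,
        Equiv.swap_apply_of_ne_of_ne hi hj]

/-- Each y that x_j crosses on its way to the left leaves transpositions behind; over a whole
polynomial p(y) they accumulate to divided differences. Crossing τ turns x_j into the x with index
τ(j). -/
theorem normalOrd_mul_x (τ : Equiv.Perm (Fin N)) (j : Fin N) (p : PolyZL N) :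
    normalOrd τ p * x j = normalOrd τ (lamV (τ j) * p) +
      ∑ a ∈ Finset.univ.erase j, normalOrd (τ * Equiv.swap j a) (divZ j a p) := by
  induction p using polyZL_induction with
  | one =>
    rw [mul_one, normalOrd_one, perm_mul_x, ← mul_one (lamV (τ j)), normalOrd_lam_mul,
      normalOrd_one, Finset.sum_eq_zero, add_zero]
    intro a ha
    rw [divDiff_of_rename_eq (Sum.inl_injective.ne (Finset.ne_of_mem_erase ha).symm) (map_one _),
      map_zero]
  | smul c p hp =>
    rw [map_smul, smul_mul_assoc, hp, mul_smul_comm, map_smul, smul_add, Finset.smul_sum]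
    simp only [map_smul]
  | add p q hp hq =>
    rw [map_add, add_mul, hp, hq, mul_add, map_add]
    simp only [map_add, Finset.sum_add_distrib]
    abel
  | lam i p hp =>
    rw [normalOrd_lam_mul, mul_assoc, hp, mul_left_comm, normalOrd_lam_mul _ i, mul_add,
      Finset.mul_sum]
    congr 1
    refine Finset.sum_congr rfl fun a ha => ?_
    rw [divZ_lam_mul (Finset.ne_of_mem_erase ha).symm, normalOrd_lam_mul]
  | z i p hp =>
    -- The twisted Leibniz rule produces exactly the commutator [y_i, x_j]: all transpositions
    -- through j if i = j, and otherwise only the term a = i.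
    have h : ∑ a ∈ Finset.univ.erase j, normalOrd (τ * Equiv.swap j a) (divZ j a (zV i * p)) =
        (∑ a ∈ Finset.univ.erase j, normalOrd (τ * Equiv.swap j a) (divZ j a p)) * y i +
        ∑ a ∈ Finset.univ.erase j, (if i = j then normalOrd τ p * perm (Equiv.swap j a) else
          if i = a then - (normalOrd τ p * perm (Equiv.swap j a)) else 0) := by
      rw [Finset.sum_mul, ← Finset.sum_add_distrib]
      refine Finset.sum_congr rfl fun a ha => ?_
      have hja := (Finset.ne_of_mem_erase ha).symm
      rw [divZ_z_mul hja, map_add, normalOrd_z_mul, normalOrd_mul_perm, Equiv.swap_inv]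
      congr 1
      split_ifs with h1 h2 h2
      · exact absurd (h1.symm.trans h2) hja
      · simp
      · simp
      · simp
    rw [normalOrd_z_mul, mul_left_comm, normalOrd_z_mul, h, ← add_assoc, ← add_mul, ← hp,
      mul_assoc, mul_assoc]
    rcases eq_or_ne i j with rfl | hij
    · simp only [if_true]
      rw [← Finset.mul_sum, ← mul_add, x_mul_y_self, sub_add_cancel]
    · simp only [if_neg hij]
      rw [Finset.sum_ite_eq, if_pos (Finset.mem_erase.mpr ⟨hij, Finset.mem_univ i⟩),
        x_mul_y_of_ne hij.symm, mul_add]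
      abel

/-! ### The PBW theorem for the Cherednik algebra -/

theorem divLam_z_mul {i j : Fin N} (h : i ≠ j) (k : Fin N) (p : PolyZL N) :
    divLam i j (zV k * p) = zV k * divLam i j p :=
  divDiff_mul_of_rename_eq (Sum.inr_injective.ne h) (by rw [rename_swap_inr]; simp) p

theorem divLam_lam_mul {i j : Fin N} (h : i ≠ j) (k : Fin N) (p : PolyZL N) :
    divLam i j (lamV k * p) = lamV k * divLam i j p + ((if k = i then 1 else 0) -
      (if k = j then 1 else 0)) * permLam (Equiv.swap i j) p := by
  have h' := (Sum.inr_injective (α := Fin N)).ne h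
  rw [divLam, divDiff_mul h', rename_swap_inr]
  congr 2
  rcases eq_or_ne k i with rfl | hi
  · simp [divDiff_X_left h', h]
  rcases eq_or_ne k j with rfl | hj
  · simp [divDiff_X_right h', h.symm]
  · rw [divDiff_of_rename_eq h']
    · simp [hi, hj]
    · rw [rename_swap_inr, MvPolynomial.rename_X, Sum.map_inr,
        Equiv.swap_apply_of_ne_of_ne hi hj]

variable (N) in
/-- The coordinate space `⨁_{τ ∈ S_N} ℂ[z, λ]`. -/
abbrev PermPoly := Equiv.Perm (Fin N) → PolyZL N

/-- The operator of left multiplication by `xᵢ` in coordinates. -/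
def opX (i : Fin N) : Module.End ℂ (PermPoly N) where
  toFun f τ := lamV i * f τ
  map_add' f g := by ext1 τ; simp [mul_add]
  map_smul' c f := by ext1 τ; simp

/-- The operator of left multiplication by a permutation in coordinates. -/
def opS (σ : Equiv.Perm (Fin N)) : Module.End ℂ (PermPoly N) where
  toFun f τ := permLam σ (f (σ⁻¹ * τ))
  map_add' f g := by ext1 τ; simp
  map_smul' c f := by ext1 τ; simp

/-- The operator of left multiplication by `yᵢ` in coordinates (a Dunkl operator). -/
def opY (i : Fin N) : Module.End ℂ (PermPoly N) where
  toFun f τ := zV (τ⁻¹ i) * f τ +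
    ∑ a ∈ Finset.univ.erase i, divLam i a (f (Equiv.swap i a * τ))
  map_add' f g := by
    ext1 τ
    simp only [Pi.add_apply, mul_add, map_add, Finset.sum_add_distrib]
    abel
  map_smul' c f := by
    ext1 τ
    simp only [Pi.smul_apply, mul_smul_comm, map_smul, smul_add, Finset.smul_sum,
      RingHom.id_apply]

/-! ### The operators in coordinates satisfy the Cherednik relations -/

theorem opX_apply (i : Fin N) (f : PermPoly N) (τ) : opX i f τ = lamV i * f τ := rfl

theorem opS_apply (σ : Equiv.Perm (Fin N)) (f : PermPoly N) (τ) :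
    opS σ f τ = permLam σ (f (σ⁻¹ * τ)) := rfl

theorem opY_apply (i : Fin N) (f : PermPoly N) (τ) : opY i f τ = zV (τ⁻¹ i) * f τ +
    ∑ a ∈ Finset.univ.erase i, divLam i a (f (Equiv.swap i a * τ)) := rfl

theorem opX_comm (i j : Fin N) : opX i * opX j = opX j * opX i := by
  refine LinearMap.ext fun f => funext fun τ => ?_
  simp only [Module.End.mul_apply, opX_apply, mul_left_comm]

theorem opS_one : (opS 1 : Module.End ℂ (PermPoly N)) = 1 := by
  refine LinearMap.ext fun f => funext fun τ => ?_
  rw [opS_apply, permLam_one, inv_one, one_mul, Module.End.one_apply]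

theorem opS_mul (σ τ : Equiv.Perm (Fin N)) : opS (σ * τ) = opS σ * opS τ := by
  refine LinearMap.ext fun f => funext fun ρ => ?_
  rw [Module.End.mul_apply, opS_apply, opS_apply, opS_apply, permLam_mul, mul_inv_rev, mul_assoc]

theorem opS_mul_opX (σ : Equiv.Perm (Fin N)) (i : Fin N) :
    opS σ * opX i = opX (σ i) * opS σ := by
  refine LinearMap.ext fun f => funext fun ρ => ?_
  simp only [Module.End.mul_apply, opX_apply, opS_apply, map_mul, MvPolynomial.rename_X,
    Sum.map_inr]

theorem opS_mul_opY (σ : Equiv.Perm (Fin N)) (i : Fin N) :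
    opS σ * opY i = opY (σ i) * opS σ := by
  refine LinearMap.ext fun f => funext fun ρ => ?_
  simp only [Module.End.mul_apply, opY_apply, opS_apply, map_mul, map_add, map_sum,
    MvPolynomial.rename_X, Sum.map_inl, id]
  congr 1
  · refine Finset.sum_bij' (fun a _ => σ a) (fun a _ => σ⁻¹ a) ?_ ?_ ?_ ?_ ?_
    · simp
    · simp [Equiv.symm_apply_eq]
    · simp
    · simp
    · intro a ha
      rw [permLam_divLam σ (Finset.ne_of_mem_erase ha).symm, Equiv.swap_apply_apply]
      simp [mul_assoc]

/-- The twisted Leibniz rule for divided differences gives both x–y relations at once: they are the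
cases k ≠ i and k = i. -/
theorem opY_opX_apply (i k : Fin N) (f : PermPoly N) (τ) :
    opY i (opX k f) τ = opX k (opY i f) τ + ∑ a ∈ Finset.univ.erase i,
      ((if k = i then 1 else 0) - (if k = a then 1 else 0)) * opS (Equiv.swap i a) f τ := by
  simp only [opY_apply, opX_apply, opS_apply, Equiv.swap_inv]
  rw [mul_add, mul_left_comm, add_assoc, Finset.mul_sum, ← Finset.sum_add_distrib]
  congr 1
  refine Finset.sum_congr rfl fun a ha => ?_
  rw [divLam_lam_mul (Finset.ne_of_mem_erase ha).symm]

theorem opX_mul_opY_of_ne {i j : Fin N} (h : i ≠ j) :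
    opX i * opY j = opY j * opX i + opS (Equiv.swap i j) := by
  refine LinearMap.ext fun f => funext fun τ => ?_
  rw [LinearMap.add_apply, Pi.add_apply, Module.End.mul_apply, Module.End.mul_apply,
    opY_opX_apply, add_assoc, Finset.sum_eq_single i]
  · simp [h, Equiv.swap_comm]
  · intro a _ ha
    simp [h, ha.symm]
  · simp [h]

theorem opX_mul_opY_self (i : Fin N) :
    opX i * opY i = opY i * opX i - ∑ a ∈ Finset.univ.erase i, opS (Equiv.swap i a) := by
  refine LinearMap.ext fun f => funext fun τ => ?_
  rw [LinearMap.sub_apply, Pi.sub_apply, Module.End.mul_apply, Module.End.mul_apply,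
    opY_opX_apply, LinearMap.sum_apply, Finset.sum_apply, eq_sub_iff_add_eq]
  congr 1
  refine Finset.sum_congr rfl fun a ha => ?_
  simp [(Finset.ne_of_mem_erase ha).symm]

/-- Commutativity of the Dunkl operators is reached without expanding double sums of divided
differences: the x–y and S_N relations alone force their commutator to commute with every x_k. -/
theorem opX_commute_opY_comm (i j k : Fin N) (h : i ≠ j) :
    opX k * (opY i * opY j - opY j * opY i) = (opY i * opY j - opY j * opY i) * opX k := by
  have key : ∀ i j : Fin N, i ≠ j →
      opX i * (opY i * opY j - opY j * opY i) = (opY i * opY j - opY j * opY i) * opX i := by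
    intro i j h
    have hj : j ∈ Finset.univ.erase i := Finset.mem_erase.mpr ⟨h.symm, Finset.mem_univ j⟩
    have h0 := opX_mul_opY_self i
    rw [← Finset.add_sum_erase _ _ hj] at h0
    -- The transposition s_{ij} is split off because it moves y_j to y_i, while the remaining s_{ia}
    -- fix the index j and so commute with y_j.
    set T := ∑ a ∈ (Finset.univ.erase i).erase j, opS (Equiv.swap i a) with hT
    have hTY : T * opY j = opY j * T := by
      rw [hT, Finset.sum_mul, Finset.mul_sum]
      refine Finset.sum_congr rfl fun a ha => ?_
      rw [opS_mul_opY, Equiv.swap_apply_of_ne_of_ne h.symm (Finset.ne_of_mem_erase ha).symm]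
    have h1 := opX_mul_opY_of_ne h
    have h2 := opS_mul_opY (Equiv.swap i j) i
    have h3 := opS_mul_opY (Equiv.swap i j) j
    rw [Equiv.swap_apply_left] at h2
    rw [Equiv.swap_apply_right] at h3
    have e1 : opX i * (opY i * opY j) = opY i * opY j * opX i - opY j * T := by
      rw [← mul_assoc, h0, sub_mul, add_mul, h3, hTY, mul_assoc, h1, mul_add, ← mul_assoc]
      abel
    have e2 : opX i * (opY j * opY i) = opY j * opY i * opX i - opY j * T := by
      rw [← mul_assoc, h1, add_mul, h2, mul_assoc, h0, mul_sub, mul_add, ← mul_assoc]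
      abel
    rw [mul_sub, e1, e2, sub_mul]
    abel
  rcases eq_or_ne k i with rfl | hi
  · exact key k j h
  rcases eq_or_ne k j with rfl | hj
  · have := key k i h.symm
    rw [mul_sub, sub_mul] at this ⊢
    rw [← neg_sub, this, neg_sub]
  -- The correction terms are symmetric in i and j, so they cancel in the commutator.
  · have e : ∀ i j : Fin N, i ≠ j → k ≠ i → k ≠ j → opX k * (opY i * opY j) =
        opY i * opY j * opX k + opY i * opS (Equiv.swap k j) + opY j * opS (Equiv.swap k i) := by
      intro i j hij hi hj
      rw [← mul_assoc, opX_mul_opY_of_ne hi, add_mul, opS_mul_opY,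
        Equiv.swap_apply_of_ne_of_ne hj.symm hij.symm, mul_assoc, opX_mul_opY_of_ne hj, mul_add,
        ← mul_assoc]
    rw [mul_sub, e i j h hi hj, e j i h.symm hj hi, sub_mul]
    abel

theorem opY_smul_z (i k : Fin N) (f : PermPoly N) :
    opY i (fun τ => zV k * f τ) = fun τ => zV k * opY i f τ := by
  ext1 τ
  simp only [opY_apply]
  rw [mul_add, mul_left_comm, Finset.mul_sum]
  congr 1
  exact Finset.sum_congr rfl fun a ha => divLam_z_mul (Finset.ne_of_mem_erase ha).symm _ _

/-- Divided differences annihilate polynomials symmetric in λ, so only the multiplication by z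
survives. -/
theorem opY_single (i : Fin N) (τ : Equiv.Perm (Fin N)) (q : PolyZL N)
    (hq : ∀ σ, permLam σ q = q) : opY i (Pi.single τ q) = Pi.single τ (zV (τ⁻¹ i) * q) := by
  ext1 ρ
  rw [opY_apply, Finset.sum_eq_zero, add_zero]
  · rcases eq_or_ne ρ τ with rfl | h
    · simp
    · simp [h]
  · intro a ha
    refine divDiff_of_rename_eq (Sum.inr_injective.ne (Finset.ne_of_mem_erase ha).symm) ?_
    rw [rename_swap_inr, Pi.single_apply]
    split_ifs
    · exact hq _
    · exact map_zero _

/-- The commutator commutes with multiplication by every λ_k and z_k and kills the constant 1 in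
each component; these generate the whole space. -/
theorem opY_comm (i j : Fin N) : opY i * opY j = opY j * opY i := by
  rcases eq_or_ne i j with rfl | h
  · rfl
  have key : ∀ (τ : Equiv.Perm (Fin N)) (p : PolyZL N),
      (opY i * opY j - opY j * opY i) (Pi.single τ p) = 0 := by
    intro τ p
    induction p using polyZL_induction with
    | one =>
      rw [LinearMap.sub_apply, Module.End.mul_apply, Module.End.mul_apply,
        opY_single _ _ _ (fun σ => map_one _), opY_single _ _ _ (fun σ => map_one _),
        opY_single _ _ _ (fun σ => by simp), opY_single _ _ _ (fun σ => by simp), mul_left_comm,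
        sub_self]
    | smul c p hp => rw [Pi.single_smul, map_smul, hp, smul_zero]
    | add p q hp hq => rw [Pi.single_add, map_add, hp, hq, add_zero]
    | lam k p hp =>
      have h1 : (Pi.single τ (lamV k * p) : PermPoly N) = opX k (Pi.single τ p) := by
        ext1 ρ
        rw [opX_apply, Pi.single_apply, Pi.single_apply, mul_ite, mul_zero]
      rw [h1, ← Module.End.mul_apply, ← opX_commute_opY_comm i j k h, Module.End.mul_apply, hp,
        map_zero]
    | z k p hp =>
      have h1 : (Pi.single τ (zV k * p) : PermPoly N) =
          fun ρ => zV k * (Pi.single τ p : PermPoly N) ρ := by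
        ext1 ρ
        rw [Pi.single_apply, Pi.single_apply, mul_ite, mul_zero]
      rw [LinearMap.sub_apply, Module.End.mul_apply, Module.End.mul_apply, sub_eq_zero] at hp ⊢
      rw [h1, opY_smul_z, opY_smul_z, opY_smul_z, opY_smul_z, hp]
  refine sub_eq_zero.mp (LinearMap.pi_ext fun τ p => ?_)
  rw [key, LinearMap.zero_apply]

/-- The operator attached to a generator of the Cherednik algebra. -/
def opGen : CherednikGen N → Module.End ℂ (PermPoly N)
  | .x i => opX i
  | .y i => opY i
  | .s σ => opS σ

/-- The polynomial representation of the Cherednik algebra. -/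
def polyRep : Cherednik N →ₐ[ℂ] Module.End ℂ (PermPoly N) :=
  RingQuot.liftAlgHom ℂ ⟨FreeAlgebra.lift ℂ opGen, by
    intro a b h
    induction h with
    | perm_one => simpa [opGen] using opS_one
    | perm_mul σ τ => simpa [opGen] using opS_mul σ τ
    | x_comm i j => simpa [opGen] using opX_comm i j
    | y_comm i j => simpa [opGen] using opY_comm i j
    | perm_x σ i => simpa [opGen] using opS_mul_opX σ i
    | perm_y σ i => simpa [opGen] using opS_mul_opY σ i
    | x_y_ne i j h => simp [opGen, opX_mul_opY_of_ne h]
    | x_y_eq i => simp [opGen, opX_mul_opY_self i, sub_eq_add_neg]⟩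

theorem polyRep_mk (a : FreeAlgebra ℂ (CherednikGen N)) :
    polyRep (Cherednik.mk N a) = FreeAlgebra.lift ℂ opGen a :=
  RingQuot.liftAlgHom_mkAlgHom_apply _ _ _ _

theorem polyRep_x (i : Fin N) : polyRep (x i) = opX i := by
  rw [x, polyRep_mk, FreeAlgebra.lift_ι_apply, opGen]

theorem polyRep_y (i : Fin N) : polyRep (y i) = opY i := by
  rw [y, polyRep_mk, FreeAlgebra.lift_ι_apply, opGen]

theorem polyRep_perm (σ : Equiv.Perm (Fin N)) : polyRep (perm σ) = opS σ := by
  change polyRep (Cherednik.mk N (genS σ)) = _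
  rw [polyRep_mk, FreeAlgebra.lift_ι_apply, opGen]

/-- A general q symmetric in λ is needed for the induction: the rightmost y_k acts first and
replaces q by z_k q, which is still symmetric in λ. -/
theorem polyRep_normalOrd (τ : Equiv.Perm (Fin N)) (p q : PolyZL N)
    (hq : ∀ σ, permLam σ q = q) :
    polyRep (normalOrd τ p) (Pi.single 1 q) = Pi.single τ (p * q) := by
  induction p using polyZL_induction generalizing q with
  | one =>
    rw [normalOrd_one, polyRep_perm, one_mul]
    ext1 ρ
    rw [opS_apply, Pi.single_apply, Pi.single_apply]
    simp only [inv_mul_eq_one, eq_comm (a := τ)]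
    split_ifs
    · exact hq _
    · exact map_zero _
  | smul c p hp =>
    rw [map_smul, map_smul, LinearMap.smul_apply, hp q hq, smul_mul_assoc, Pi.single_smul]
  | add p p' hp hp' =>
    rw [map_add, map_add, LinearMap.add_apply, hp q hq, hp' q hq, add_mul, Pi.single_add]
  | lam k p hp =>
    rw [normalOrd_lam_mul, map_mul, polyRep_x, Module.End.mul_apply, hp q hq]
    ext1 ρ
    rw [opX_apply, Pi.single_apply, Pi.single_apply, mul_ite, mul_zero, mul_assoc]
  | z k p hp =>
    rw [normalOrd_z_mul, map_mul, polyRep_y, Module.End.mul_apply, opY_single _ _ _ hq,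
      hp _ (fun σ => by rw [map_mul, hq]; simp)]
    congr 1
    rw [inv_one, Equiv.Perm.one_apply]
    ring

/-- The map `(p_τ) ↦ ∑ p_τ`, where `p(z) q(λ)` in the component `τ` is sent to `q(x) τ p(y)`. -/
def pbw : PermPoly N →ₗ[ℂ] Cherednik N :=
  ∑ τ, normalOrd τ ∘ₗ LinearMap.proj τ

theorem pbw_apply (f : PermPoly N) : pbw f = ∑ τ, normalOrd τ (f τ) := by
  simp [pbw]

theorem pbw_single (τ : Equiv.Perm (Fin N)) (p : PolyZL N) :
    pbw (Pi.single τ p) = normalOrd τ p := by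
  rw [pbw_apply, Finset.sum_eq_single τ]
  · simp
  · intro ρ _ h
    simp [h]
  · simp

theorem polyRep_pbw (f : PermPoly N) : polyRep (pbw f) (Pi.single 1 1) = f := by
  rw [pbw_apply, map_sum, LinearMap.sum_apply]
  simp only [polyRep_normalOrd _ _ 1 (fun σ => map_one _), mul_one]
  exact Finset.univ_sum_single f

theorem pbw_injective : Function.Injective (pbw (N := N)) :=
  Function.LeftInverse.injective (g := fun h => polyRep h (Pi.single 1 1)) polyRep_pbw

theorem pbw_opX (i : Fin N) (f : PermPoly N) : pbw (opX i f) = x i * pbw f := by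
  simp only [pbw_apply, opX_apply, normalOrd_lam_mul, Finset.mul_sum]

theorem pbw_opS (σ : Equiv.Perm (Fin N)) (f : PermPoly N) : pbw (opS σ f) = perm σ * pbw f := by
  simp only [pbw_apply, opS_apply, Finset.mul_sum, perm_mul_normalOrd]
  rw [← Equiv.sum_comp (Equiv.mulLeft σ)]
  simp

/-- The relations move y_i past each x at the cost of permutations; the range is already stable
under left multiplication by x's and permutations and under right multiplication by y's. -/
theorem y_mul_normalOrd_mem (i : Fin N) (τ : Equiv.Perm (Fin N)) (p : PolyZL N) :
    y i * normalOrd τ p ∈ LinearMap.range (pbw (N := N)) := by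
  have hn : ∀ σ (q : PolyZL N), normalOrd σ q ∈ LinearMap.range (pbw (N := N)) :=
    fun σ q => ⟨_, pbw_single σ q⟩
  induction p using polyZL_induction with
  | one =>
    have h : y i * perm τ = perm τ * y (τ⁻¹ i) := by rw [perm_mul_y]; simp
    rw [normalOrd_one, h, ← normalOrd_one, ← normalOrd_z_mul]
    exact hn _ _
  | smul c p hp => rw [map_smul, mul_smul_comm]; exact Submodule.smul_mem _ _ hp
  | add p q hp hq => rw [map_add, mul_add]; exact Submodule.add_mem _ hp hq
  | lam k p hp =>
    have hx : x k * (y i * normalOrd τ p) ∈ LinearMap.range (pbw (N := N)) := by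
      obtain ⟨f, hf⟩ := hp
      exact ⟨opX k f, by rw [pbw_opX, hf]⟩
    have hs : ∀ σ, perm σ * normalOrd τ p ∈ LinearMap.range (pbw (N := N)) := by
      intro σ
      rw [perm_mul_normalOrd]
      exact hn _ _
    rw [normalOrd_lam_mul, ← mul_assoc]
    rcases eq_or_ne k i with rfl | h
    · rw [sub_eq_iff_eq_add.mp (x_mul_y_self k).symm, add_mul, mul_assoc, Finset.sum_mul]
      exact Submodule.add_mem _ hx (Submodule.sum_mem _ fun a _ => hs _)
    · rw [eq_sub_of_add_eq (x_mul_y_of_ne h).symm, sub_mul, mul_assoc]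
      exact Submodule.sub_mem _ hx (hs _)
  | z k p hp =>
    obtain ⟨f, hf⟩ := hp
    refine ⟨fun τ => zV k * f τ, ?_⟩
    rw [normalOrd_z_mul, ← mul_assoc, ← hf, pbw_apply, pbw_apply, Finset.sum_mul]
    simp only [normalOrd_z_mul]

/-- The range contains 1 and is stable under left multiplication by the generators, hence is
everything. -/
theorem pbw_surjective : Function.Surjective (pbw (N := N)) := by
  have key : ∀ (a : FreeAlgebra ℂ (CherednikGen N)) (f : PermPoly N),
      Cherednik.mk N a * pbw f ∈ LinearMap.range (pbw (N := N)) := by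
    intro a
    induction a using FreeAlgebra.induction with
    | grade0 c =>
      intro f
      rw [AlgHom.commutes, ← Algebra.smul_def]
      exact ⟨c • f, map_smul _ _ _⟩
    | grade1 g =>
      intro f
      cases g with
      | x i => exact ⟨opX i f, pbw_opX i f⟩
      | y i =>
        rw [pbw_apply, Finset.mul_sum]
        exact Submodule.sum_mem _ fun τ _ => y_mul_normalOrd_mem i τ _
      | s σ => exact ⟨opS σ f, pbw_opS σ f⟩
    | mul a b ha hb =>
      intro f
      obtain ⟨g, hg⟩ := hb f
      rw [map_mul, mul_assoc, ← hg]
      exact ha g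
    | add a b ha hb =>
      intro f
      rw [map_add, add_mul]
      exact Submodule.add_mem _ (ha f) (hb f)
  intro h
  obtain ⟨a, rfl⟩ := RingQuot.mkAlgHom_surjective ℂ (CherednikRel N) h
  have := key a (Pi.single 1 1)
  rwa [pbw_single, normalOrd_one, map_one, mul_one] at this

/-! ### Coordinates on `𝒱` and on `𝒱_𝟏` -/

theorem sum_epsCoord_smul (w : TensorPow N) : ∑ f, epsCoord f w • epsVec f = w := by
  have h : (∑ f : Fin N → Fin N, (epsCoord f).smulRight (epsVec f)) = LinearMap.id := by
    refine (Basis.piTensorProduct fun _ : Fin N => Pi.basisFun ℂ (Fin N)).ext fun g => ?_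
    have hg : (Basis.piTensorProduct fun _ : Fin N => Pi.basisFun ℂ (Fin N)) g =
        epsVec g := by
      rw [Basis.piTensorProduct_apply, epsVec]
      simp
    rw [hg, LinearMap.sum_apply, LinearMap.id_apply]
    simp [epsCoord_epsVec]
  simpa using LinearMap.congr_fun h w

/-- The coordinate of a vector of `𝒱` at `ε_f`, a polynomial in `z, λ`. -/
def vCoord (f : Fin N → Fin N) : VSpace N →ₗ[ℂ] PolyZL N :=
  (TensorProduct.rid ℂ (PolyZL N)).toLinearMap ∘ₗ (epsCoord f).lTensor (PolyZL N)

theorem vCoord_tmul (f : Fin N → Fin N) (p : PolyZL N) (w : TensorPow N) :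
    vCoord f (p ⊗ₜ w) = epsCoord f w • p := by
  simp [vCoord]

theorem vCoord_tmul_epsVec (f g : Fin N → Fin N) (p : PolyZL N) :
    vCoord f (p ⊗ₜ epsVec g) = if f = g then p else 0 := by
  rw [vCoord_tmul, epsCoord_epsVec, ite_smul, one_smul, zero_smul]

theorem sum_vCoord_tmul (v : VSpace N) : ∑ f, vCoord f v ⊗ₜ[ℂ] epsVec f = v := by
  induction v using TensorProduct.induction_on with
  | zero => simp
  | tmul p w =>
    simp only [vCoord_tmul, TensorProduct.smul_tmul, ← TensorProduct.tmul_sum]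
    rw [sum_epsCoord_smul]
  | add v w hv hw =>
    simp only [map_add, TensorProduct.add_tmul, Finset.sum_add_distrib]
    rw [hv, hw]

/-! ### The current algebra on tensors and the weight space -/

theorem ulamAction_lam (i : Fin N) (v : VSpace N) : ulamAction (lam i) v = lamV i • v := by
  have h : ulamAction (lam i) = algebraMap (PolyZL N) (Module.End (PolyZL N) (VSpace N))
      (lamV i) := by
    unfold ulamAction lam ofLam
    refine (Algebra.TensorProduct.lift_tmul _ _ _ (MvPolynomial.X i)
      (1 : UCurrent N)).trans ?_
    rw [map_one, mul_one, AlgHom.comp_apply, MvPolynomial.rename_X]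
    rfl
  rw [h]; rfl

theorem ulamAction_eT (a b : Fin N) (r : ℕ) (v : VSpace N) :
    ulamAction (eT a b r) v = ∑ k, zV k ^ r •
      (Module.End.baseChangeHom ℂ (PolyZL N) (TensorPow N) (slot k (Matrix.single a b 1))) v := by
  have h : ulamAction (eT a b r) = currentAction (Matrix.single a b (Polynomial.X ^ r)) := by
    unfold ulamAction eT ofU
    refine (Algebra.TensorProduct.lift_tmul _ _ _ (1 : MvPolynomial (Fin N) ℂ) _).trans ?_
    rw [map_one, one_mul, UniversalEnvelopingAlgebra.lift_ι_apply]
  have h2 : currentAction (Matrix.single a b (Polynomial.X ^ r)) =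
      ∑ k : Fin N, slotAction k (Matrix.single a b (Polynomial.X ^ r)) :=
    LinearMap.sum_apply _ _ _
  rw [h, h2, LinearMap.sum_apply]
  refine Finset.sum_congr rfl fun k _ => ?_
  have h3 : slotAction k (Matrix.single a b (Polynomial.X ^ r)) = zV k ^ r •
      Module.End.baseChangeHom ℂ (PolyZL N) (TensorPow N) (slot k (Matrix.single a b 1)) := by
    simp only [slotAction, matExt, LinearMap.coe_mk, AddHom.coe_mk]
    rw [Finset.sum_eq_single a, Finset.sum_eq_single b]
    · rw [Matrix.single_apply_same, map_pow, Polynomial.aeval_X]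
      rfl
    · intro c _ hc
      rw [Matrix.single_apply_of_col_ne _ _ hc.symm, map_zero, zero_smul]
    · exact fun h => absurd (Finset.mem_univ _) h
    · intro c _ hc
      refine Finset.sum_eq_zero fun d _ => ?_
      rw [Matrix.single_apply_of_row_ne hc.symm, map_zero, zero_smul]
    · exact fun h => absurd (Finset.mem_univ _) h
  rw [h3, LinearMap.smul_apply]

theorem slot_single_epsVec (k a b : Fin N) (f : Fin N → Fin N) :
    slot k (Matrix.single a b 1) (epsVec f) =
      if f k = b then epsVec (Function.update f k a) else 0 := by
  change PiTensorProduct.map _ (epsVec f) = _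
  rw [epsVec, PiTensorProduct.map_tprod]
  split_ifs with h
  · rw [epsVec]
    congr 1
    funext i
    rcases eq_or_ne i k with rfl | hi
    · rw [Function.update_self, Function.update_self, Matrix.toLin'_apply, h]
      ext j
      simp [Matrix.single_apply, Pi.single_apply, eq_comm]
    · rw [Function.update_of_ne hi, Function.update_of_ne hi, LinearMap.id_apply]
  · refine (PiTensorProduct.tprod ℂ).map_coord_zero k ?_
    rw [Function.update_self, Matrix.toLin'_apply]
    ext j
    simp [Ne.symm h]

theorem ulamAction_eT_tmul (a b : Fin N) (r : ℕ) (p : PolyZL N) (f : Fin N → Fin N) :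
    ulamAction (eT a b r) (p ⊗ₜ epsVec f) =
      ∑ k, if f k = b then (zV k ^ r * p) ⊗ₜ epsVec (Function.update f k a) else 0 := by
  rw [ulamAction_eT]
  refine Finset.sum_congr rfl fun k _ => ?_
  change zV k ^ r • (slot k (Matrix.single a b 1)).baseChange (PolyZL N) (p ⊗ₜ epsVec f) = _
  rw [LinearMap.baseChange_tmul, slot_single_epsVec, TensorProduct.smul_tmul', smul_eq_mul]
  split_ifs
  · rfl
  · rw [TensorProduct.tmul_zero]

theorem vCoord_eT_zero (i : Fin N) (f : Fin N → Fin N) (v : VSpace N) :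
    vCoord f (ulamAction (eT i i 0) v) = ((Finset.univ.filter fun k => f k = i).card : ℂ) •
      vCoord f v := by
  rw [← sum_vCoord_tmul v, map_sum, map_sum, map_sum, Finset.smul_sum]
  refine Finset.sum_congr rfl fun g _ => ?_
  rw [ulamAction_eT_tmul]
  have h : ∀ k : Fin N, (if g k = i then (zV k ^ 0 * vCoord g v) ⊗ₜ[ℂ]
      epsVec (Function.update g k i) else 0) =
      if g k = i then vCoord g v ⊗ₜ[ℂ] epsVec g else 0 := by
    intro k
    split_ifs with hk
    · rw [pow_zero, one_mul, ← hk, Function.update_eq_self]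
    · rfl
  simp only [h]
  rw [← Finset.sum_filter, Finset.sum_const, map_nsmul, vCoord_tmul_epsVec]
  split_ifs with hfg
  · subst hfg
    rw [Nat.cast_smul_eq_nsmul]
  · simp

/-- The operator e_{ii} scales ε_f by the number of slots where f takes the value i; these numbers
are all 1 exactly when f is a bijection. -/
theorem mem_V1_iff (v : VSpace N) :
    v ∈ V1 N ↔ ∀ f : Fin N → Fin N, ¬ Function.Injective f → vCoord f v = 0 := by
  constructor
  · intro hv f hf
    -- A non-injective f omits some i. Then e_{ii} acts by 0 on this coordinate and must also act by
    -- 1.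
    rw [Finite.injective_iff_surjective, Function.Surjective] at hf
    push Not at hf
    obtain ⟨i, hi⟩ := hf
    have h := vCoord_eT_zero i f v
    rw [hv i, Finset.filter_false_of_mem fun k _ => hi k] at h
    simpa using h
  · intro h i
    rw [← sum_vCoord_tmul (ulamAction _ v), ← sum_vCoord_tmul v]
    refine Finset.sum_congr rfl fun f _ => ?_
    rw [sum_vCoord_tmul, vCoord_eT_zero]
    by_cases hf : Function.Injective f
    · obtain ⟨k, hk⟩ := (Finite.injective_iff_surjective.mp hf) i
      have : (Finset.univ.filter fun k => f k = i) = {k} := by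
        ext l
        simp [← hk, hf.eq_iff]
      rw [this]; simp
    · rw [h f hf]; simp

/-- The vector `∑_τ f_τ ε_τ` of `𝒱`. -/
def ofCoord : PermPoly N →ₗ[ℂ] VSpace N where
  toFun f := ∑ τ, f τ ⊗ₜ epsVec τ
  map_add' f g := by simp [TensorProduct.add_tmul, Finset.sum_add_distrib]
  map_smul' c f := by simp [TensorProduct.smul_tmul', Finset.smul_sum]

theorem ofCoord_apply (f : PermPoly N) : ofCoord f = ∑ τ, f τ ⊗ₜ epsVec τ := rfl

theorem vCoord_ofCoord (f : PermPoly N) (τ : Equiv.Perm (Fin N)) : vCoord τ (ofCoord f) = f τ := by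
  simp only [ofCoord_apply, map_sum, vCoord_tmul_epsVec, DFunLike.coe_fn_eq]
  simp

theorem ofCoord_mem (f : PermPoly N) : ofCoord f ∈ V1 N := by
  rw [mem_V1_iff]
  intro g hg
  simp only [ofCoord_apply, map_sum, vCoord_tmul_epsVec]
  exact Finset.sum_eq_zero fun τ _ => if_neg fun (h : g = τ) => hg (h.symm ▸ τ.injective)

theorem ofCoord_vCoord (v : VSpace N) (hv : v ∈ V1 N) :
    ofCoord (fun τ => vCoord τ v) = v := by
  conv_rhs => rw [← sum_vCoord_tmul v]
  rw [ofCoord_apply]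
  refine Finset.sum_of_injOn (fun τ : Equiv.Perm (Fin N) => (τ : Fin N → Fin N))
    (DFunLike.coe_injective.injOn) (by simp) ?_ (by simp)
  intro f _ hf
  rw [(mem_V1_iff v).mp hv f, TensorProduct.zero_tmul]
  intro hi
  exact hf ⟨Equiv.ofBijective f (Finite.injective_iff_bijective.mp hi), by simp, rfl⟩

/-- The coordinates on `𝒱_𝟏`. -/
def v1Equiv : PermPoly N ≃ₗ[ℂ] V1 N where
  toFun f := ⟨ofCoord f, ofCoord_mem f⟩
  invFun v τ := vCoord τ (v : VSpace N)
  map_add' _ _ := Subtype.ext (map_add _ _ _)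
  map_smul' _ _ := Subtype.ext (map_smul _ _ _)
  left_inv f := funext fun τ => vCoord_ofCoord f τ
  right_inv v := Subtype.ext (ofCoord_vCoord _ v.2)

theorem iota_v1Equiv (f : PermPoly N) : iota N (v1Equiv f) = pbw f := by
  change iotaFull (ofCoord f) = _
  rw [ofCoord_apply, map_sum, pbw_apply]
  exact Finset.sum_congr rfl fun τ _ => iotaFull_tmul_epsVec _ _

theorem iota_bijective : Function.Bijective (iota N) := by
  have h : (iota N : V1 N → Cherednik N) = pbw ∘ v1Equiv.symm := by
    ext v
    rw [Function.comp_apply, ← iota_v1Equiv, LinearEquiv.apply_symm_apply]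
  rw [h]
  exact Function.Bijective.comp ⟨pbw_injective, pbw_surjective⟩ v1Equiv.symm.bijective

/-! ### The two group actions as left and right multiplication -/

theorem leftAct_ofCoord (σ : Equiv.Perm (Fin N)) (f : PermPoly N) :
    leftAct σ (ofCoord f) = ofCoord (opS σ f) := by
  rw [ofCoord_apply, ofCoord_apply, map_sum, ← Equiv.sum_comp (Equiv.mulLeft σ) fun τ =>
    opS σ f τ ⊗ₜ[ℂ] epsVec τ]
  refine Finset.sum_congr rfl fun τ _ => ?_
  rw [leftAct_tmul_epsVec, opS_apply]
  simp only [Equiv.coe_mulLeft, inv_mul_cancel_left]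
  rfl

theorem rightAct_ofCoord (σ : Equiv.Perm (Fin N)) (f : PermPoly N) :
    rightAct σ (ofCoord f) = ofCoord fun τ => permZ σ (f (τ * σ)) := by
  rw [ofCoord_apply, ofCoord_apply, map_sum, ← Equiv.sum_comp (Equiv.mulRight σ)]
  refine Finset.sum_congr rfl fun τ _ => ?_
  rw [rightAct_tmul_epsVec, Equiv.coe_mulRight]
  congr 2
  funext k
  simp

theorem mem_V1LR_iff (f : PermPoly N) : v1Equiv f ∈ V1LR N ↔
    ∀ σ : Equiv.Perm (Fin N), (opS σ f = f) ∧ (fun τ => permZ σ (f (τ * σ))) = f := by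
  have hinj : Function.Injective (ofCoord (N := N)) := fun f g h => by
    ext1 τ
    rw [← vCoord_ofCoord f, h, vCoord_ofCoord]
  change (∀ σ, leftAct σ (ofCoord f) = ofCoord f ∧ rightAct σ (ofCoord f) = ofCoord f) ↔ _
  simp only [leftAct_ofCoord, rightAct_ofCoord, hinj.eq_iff]

theorem pbw_mul_perm (σ : Equiv.Perm (Fin N)) (f : PermPoly N) :
    pbw f * perm σ = pbw fun τ => permZ σ⁻¹ (f (τ * σ⁻¹)) := by
  simp only [pbw_apply, Finset.sum_mul, normalOrd_mul_perm]
  refine Fintype.sum_equiv (Equiv.mulRight σ) _ _ fun τ => ?_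
  simp

/-- The right action of σ is right multiplication by σ⁻¹; the inverse is harmless because invariance
is required for the whole group. -/
theorem mem_V1LR_iff_pbw (f : PermPoly N) : v1Equiv f ∈ V1LR N ↔
    ∀ σ : Equiv.Perm (Fin N), perm σ * pbw f = pbw f ∧ pbw f * perm σ = pbw f := by
  rw [mem_V1LR_iff]
  simp only [← pbw_opS, pbw_mul_perm, pbw_injective.eq_iff]
  constructor
  · exact fun h σ => ⟨(h σ).1, (h σ⁻¹).2⟩
  · intro h σ
    have := (h σ⁻¹).2
    rw [inv_inv] at this
    exact ⟨(h σ).1, this⟩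

theorem mem_V1LR_iff_iota (v : V1 N) : v ∈ V1LR N ↔
    ∀ σ : Equiv.Perm (Fin N), perm σ * iota N v = iota N v ∧ iota N v * perm σ = iota N v := by
  obtain ⟨f, rfl⟩ := v1Equiv.surjective v
  rw [mem_V1LR_iff_pbw, iota_v1Equiv]

/-! ### A Capelli identity -/

section Capelli

variable {A : Type*} [CommRing A] (D : A →+ A) (l r : Fin N → A)

/-- `D` satisfies the Leibniz rule. -/
def IsLeibniz (D : A →+ A) : Prop := ∀ a b, D (a * b) = a * D b + b * D a

theorem IsLeibniz.map_prod {D : A →+ A} (hD : IsLeibniz D) {ι : Type*} [DecidableEq ι] (s : Finset ι) (f : ι → A) :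
    D (∏ i ∈ s, f i) = ∑ i ∈ s, D (f i) * ∏ j ∈ s.erase i, f j := by
  induction s using Finset.induction_on with
  | empty =>
    have := hD 1 1
    simpa using this
  | insert a s ha ih =>
    rw [Finset.prod_insert ha, hD, ih, Finset.sum_insert ha, Finset.erase_insert ha,
      add_comm, mul_comm (D (f a)), Finset.mul_sum, mul_comm]
    congr 1
    refine Finset.sum_congr rfl fun i hi => ?_
    have hia : a ≠ i := fun h => ha (h ▸ hi)
    rw [Finset.erase_insert_of_ne hia, Finset.prod_insert (fun h => ha (Finset.mem_of_mem_erase h))]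
    ring

/-- The action of the entry `δᵢⱼ (∂ - λᵢ) - e_{ji}(u)` on vectors `a ε_f` with normally ordered
coefficients, where `lᵢ` stands for `∂ - λᵢ` and `rₖ` for `1 / (u - z_k)`. -/
def rowOp (i j : Fin N) : AddMonoid.End ((Fin N → Fin N) →₀ A) :=
  Finsupp.liftAddHom fun f =>
    -- The term `D a` is the commutator of ∂ with a coefficient depending on u, which appears when ∂
    -- is moved to the right of `a`.
    { toFun := fun a => (if i = j then Finsupp.single f (l i * a + D a) else 0) -
        ∑ k, if f k = i then Finsupp.single (Function.update f k j) (r k * a) else 0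
      map_zero' := by simp
      map_add' := fun a b => by
        have h1 : (if i = j then Finsupp.single f (l i * (a + b) + D (a + b)) else 0) =
            (if i = j then Finsupp.single f (l i * a + D a) else 0) +
            (if i = j then Finsupp.single f (l i * b + D b) else 0) := by
          split_ifs
          · rw [← Finsupp.single_add, map_add, mul_add]
            congr 1
            abel
          · rw [add_zero]
        have h2 : ∀ k, (if f k = i then Finsupp.single (Function.update f k j) (r k * (a + b))
            else 0) = (if f k = i then Finsupp.single (Function.update f k j) (r k * a) else 0) +
            (if f k = i then Finsupp.single (Function.update f k j) (r k * b) else 0) := by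
          intro k
          split_ifs
          · rw [← Finsupp.single_add, mul_add]
          · rw [add_zero]
        simp only [h1, h2, Finset.sum_add_distrib]
        abel }

theorem rowOp_single (i j : Fin N) (f : Fin N → Fin N) (a : A) :
    rowOp D l r i j (Finsupp.single f a) =
      (if i = j then Finsupp.single f (l i * a + D a) else 0) -
        ∑ k, if f k = i then Finsupp.single (Function.update f k j) (r k * a) else 0 :=
  Finsupp.liftAddHom_apply_single _ _ _

/-- The function equal to `σ` on the rows `≥ m` and to the identity on the rows `< m`. -/
def tailFun (σ : Equiv.Perm (Fin N)) (m : ℕ) (i : Fin N) : Fin N := if m ≤ i then σ i else i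

/-- The factor of row `i` in the normally ordered expansion. -/
def rowFactor (τ σ : Equiv.Perm (Fin N)) (i : Fin N) : A :=
  (if σ i = i then l i else 0) - r (τ.symm i)

/-- The rows `≥ m`. -/
def rowsFrom (N m : ℕ) : Finset (Fin N) := Finset.univ.filter fun i => m ≤ i

theorem mem_rowsFrom {m : ℕ} {i : Fin N} : i ∈ rowsFrom N m ↔ m ≤ i := by
  simp [rowsFrom]

theorem rowsFrom_eq_insert (m : Fin N) : rowsFrom N m = insert m (rowsFrom N (m + 1)) := by
  ext i
  rw [Finset.mem_insert, mem_rowsFrom, mem_rowsFrom, Fin.ext_iff]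
  lia

/-- The correction term produced by a coincidence of slots or by differentiation. -/
def corrTerm (τ σ : Equiv.Perm (Fin N)) (m i : Fin N) : A :=
  r (τ.symm i) ^ 2 * ∏ i' ∈ (rowsFrom N (m + 1)).erase i, rowFactor l r τ σ i'

variable {D l r}

theorem map_tailProd (hD : IsLeibniz D) (hl : ∀ i, D (l i) = 0) (hr : ∀ k, D (r k) = -r k ^ 2)
    (τ σ : Equiv.Perm (Fin N)) (m : Fin N) :
    D (∏ i ∈ rowsFrom N (m + 1), rowFactor l r τ σ i) =
      ∑ i ∈ rowsFrom N (m + 1), corrTerm l r τ σ m i := by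
  rw [hD.map_prod]
  refine Finset.sum_congr rfl fun i _ => ?_
  rw [corrTerm]
  congr 1
  rw [rowFactor, map_sub, hr, sub_neg_eq_add]
  split_ifs
  · rw [hl, zero_add]
  · rw [map_zero, zero_add]

/-- Row m has not yet been used, so slot τ⁻¹(m) still holds m and gives the main term. Corrections
come from a second slot holding m, present when σ(i) = m for a later row i, and, if σ(m) = m, from
the derivative of the accumulated product. -/
theorem rowOp_tail (hD : IsLeibniz D) (hl : ∀ i, D (l i) = 0) (hr : ∀ k, D (r k) = -r k ^ 2)
    (τ σ : Equiv.Perm (Fin N)) (m : Fin N) :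
    rowOp D l r m (σ m) (Finsupp.single (tailFun σ (m + 1) ∘ τ)
        (∏ i ∈ rowsFrom N (m + 1), rowFactor l r τ σ i)) =
      Finsupp.single (tailFun σ m ∘ τ) (∏ i ∈ rowsFrom N m, rowFactor l r τ σ i) +
      ∑ i ∈ rowsFrom N (m + 1),
        ((if σ m = m then Finsupp.single (tailFun σ (m + 1) ∘ τ) (corrTerm l r τ σ m i) else 0) +
          (if σ i = m then Finsupp.single (tailFun (σ * Equiv.swap m i) (m + 1) ∘ τ)
            (corrTerm l r τ σ m i) else 0)) := by
  set Q := ∏ i ∈ rowsFrom N (m + 1), rowFactor l r τ σ i with hQ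
  have hm : m ∉ rowsFrom N (m + 1) := by rw [mem_rowsFrom]; lia
  have hprod : ∏ i ∈ rowsFrom N m, rowFactor l r τ σ i = rowFactor l r τ σ m * Q := by
    rw [rowsFrom_eq_insert, Finset.prod_insert hm]
  have hself : tailFun σ (m + 1) m = m := by rw [tailFun, if_neg (by lia)]
  have htail : Function.update (tailFun σ (m + 1)) m (σ m) = tailFun σ m := by
    funext i
    rcases eq_or_ne i m with rfl | h
    · rw [Function.update_self, tailFun, if_pos le_rfl]
    · have h' : (i : ℕ) ≠ m := fun e => h (Fin.ext e)
      rw [Function.update_of_ne h, tailFun, tailFun]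
      congr 1
      simp only [eq_iff_iff]
      lia
  have hswap : ∀ i ∈ rowsFrom N (m + 1), Function.update (tailFun σ (m + 1)) i (σ m) =
      tailFun (σ * Equiv.swap m i) (m + 1) := by
    intro i hi
    rw [mem_rowsFrom] at hi
    funext j
    rcases eq_or_ne j i with rfl | h
    · rw [Function.update_self, tailFun, if_pos hi]; simp
    · rw [Function.update_of_ne h, tailFun, tailFun]
      split_ifs with hj
      · have : j ≠ m := fun e => by rw [e] at hj; lia
        rw [Equiv.Perm.mul_apply, Equiv.swap_apply_of_ne_of_ne this h]
      · rfl
  have hupd : ∀ i, Function.update (tailFun σ (m + 1) ∘ τ) (τ.symm i) (σ m) =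
      Function.update (tailFun σ (m + 1)) i (σ m) ∘ τ := by
    intro i
    funext k
    simp only [Function.update_apply, Function.comp_apply, Equiv.eq_symm_apply]
  have hsum : (∑ k, if (tailFun σ (m + 1) ∘ τ) k = m then
        Finsupp.single (Function.update (tailFun σ (m + 1) ∘ τ) k (σ m)) (r k * Q) else 0) =
      Finsupp.single (tailFun σ m ∘ τ) (r (τ.symm m) * Q) -
      ∑ i ∈ rowsFrom N (m + 1), (if σ i = m then
        Finsupp.single (tailFun (σ * Equiv.swap m i) (m + 1) ∘ τ)
          (corrTerm l r τ σ m i) else 0) := by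
    rw [← Equiv.sum_comp τ.symm]
    simp only [Function.comp_apply, Equiv.apply_symm_apply, hupd]
    rw [← Finset.sum_subset (Finset.subset_univ (rowsFrom N m)), rowsFrom_eq_insert,
      Finset.sum_insert hm, if_pos hself, htail, sub_eq_add_neg, ← Finset.sum_neg_distrib]
    · congr 1
      refine Finset.sum_congr rfl fun i hi => ?_
      have hi' := mem_rowsFrom.mp hi
      have : tailFun σ (m + 1) i = σ i := by rw [tailFun, if_pos hi']
      rw [this]
      split_ifs with h
      · rw [hswap i hi, ← Finsupp.single_neg]
        congr 1
        -- Row i is off the diagonal here, so its factor is `-r` alone; with the new `r` it gives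
        -- minus the square in `corrTerm`.
        have hne : σ i ≠ i := by
          rw [h]
          exact fun e => hm (e ▸ hi)
        rw [hQ, ← Finset.mul_prod_erase _ _ hi, corrTerm, rowFactor, if_neg hne]
        ring
      · rw [neg_zero]
    · intro i _ hi
      rw [mem_rowsFrom] at hi
      rw [if_neg]
      rw [tailFun, if_neg (by lia)]
      exact fun e => hi (by rw [e])
  rw [rowOp_single, hsum, hprod, Finset.sum_add_distrib]
  rcases eq_or_ne (σ m) m with h | h
  · have htf : tailFun σ m = tailFun σ (m + 1) := by
      rw [← htail, h]
      conv_lhs => rw [← hself]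
      rw [hself, Function.update_eq_self_iff, hself]
    simp only [h, if_true, rowFactor]
    rw [htf, hQ, map_tailProd hD hl hr, ← hQ, sub_mul, Finsupp.single_add, Finsupp.single_sub,
      Finsupp.single_finsetSum]
    abel
  · simp only [h, Ne.symm h, if_false, rowFactor, Finset.sum_const_zero]
    rw [zero_sub, zero_sub, neg_mul, Finsupp.single_neg]
    abel

theorem take_finRange_succ {m : ℕ} (hm : m < N) :
    (List.finRange N).take (m + 1) = (List.finRange N).take m ++ [⟨m, hm⟩] := by
  rw [List.take_add_one]
  simp [hm]

/-- One more row is brought to normal order. The corrections of `rowOp_tail` cancel in pairs under σ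
↦ σ s_{mi}, so only the alternating sum satisfies this identity. -/
theorem sum_sign_rows_succ (hD : IsLeibniz D) (hl : ∀ i, D (l i) = 0) (hr : ∀ k, D (r k) = -r k ^ 2)
    (τ : Equiv.Perm (Fin N)) (m : Fin N) :
    ∑ σ : Equiv.Perm (Fin N), (Equiv.Perm.sign σ : ℤ) •
      ((((List.finRange N).take (m + 1)).map fun i => rowOp D l r i (σ i)).prod
        (Finsupp.single (tailFun σ (m + 1) ∘ τ)
          (∏ i ∈ rowsFrom N (m + 1), rowFactor l r τ σ i))) =
    ∑ σ : Equiv.Perm (Fin N), (Equiv.Perm.sign σ : ℤ) •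
      ((((List.finRange N).take m).map fun i => rowOp D l r i (σ i)).prod
        (Finsupp.single (tailFun σ m ∘ τ) (∏ i ∈ rowsFrom N m, rowFactor l r τ σ i))) := by
  have hstep : ∀ σ : Equiv.Perm (Fin N),
      (((List.finRange N).take (m + 1)).map fun i => rowOp D l r i (σ i)).prod =
      (((List.finRange N).take m).map fun i => rowOp D l r i (σ i)).prod *
        rowOp D l r m (σ m) := by
    intro σ
    rw [take_finRange_succ m.2, List.map_append, List.prod_append]
    simp
  -- Rows before m do not see the exchange, since m and i are both at least m.
  have hpre : ∀ (σ : Equiv.Perm (Fin N)) (i), i ∈ rowsFrom N (m + 1) →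
      (((List.finRange N).take m).map fun j => rowOp D l r j ((σ * Equiv.swap m i) j)) =
      (((List.finRange N).take m).map fun j => rowOp D l r j (σ j)) := by
    intro σ i hi
    rw [mem_rowsFrom] at hi
    refine List.map_congr_left fun j hj => ?_
    have hj' : (j : ℕ) < m := by
      obtain ⟨n, hn, rfl⟩ := List.getElem_of_mem hj
      rw [List.length_take] at hn
      simp only [List.getElem_take, List.getElem_finRange]
      exact (lt_min_iff.mp hn).1
    rw [Equiv.Perm.mul_apply, Equiv.swap_apply_of_ne_of_ne]
    · exact fun e => by rw [e] at hj'; lia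
    · exact fun e => by rw [e] at hj'; lia
  simp only [hstep]
  rw [← sub_eq_zero, ← Finset.sum_sub_distrib]
  have h1 : ∀ σ : Equiv.Perm (Fin N), (Equiv.Perm.sign σ : ℤ) •
      (((((List.finRange N).take m).map fun i => rowOp D l r i (σ i)).prod *
        rowOp D l r m (σ m)) (Finsupp.single (tailFun σ (m + 1) ∘ τ)
          (∏ i ∈ rowsFrom N (m + 1), rowFactor l r τ σ i))) - (Equiv.Perm.sign σ : ℤ) •
      ((((List.finRange N).take m).map fun i => rowOp D l r i (σ i)).prod
        (Finsupp.single (tailFun σ m ∘ τ) (∏ i ∈ rowsFrom N m, rowFactor l r τ σ i))) =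
      ∑ i ∈ rowsFrom N (m + 1), ((Equiv.Perm.sign σ : ℤ) •
        (((List.finRange N).take m).map fun i => rowOp D l r i (σ i)).prod
        (if σ m = m then Finsupp.single (tailFun σ (m + 1) ∘ τ) (corrTerm l r τ σ m i) else 0) +
        (Equiv.Perm.sign σ : ℤ) •
        (((List.finRange N).take m).map fun i => rowOp D l r i (σ i)).prod
          (if σ i = m then Finsupp.single (tailFun (σ * Equiv.swap m i) (m + 1) ∘ τ)
            (corrTerm l r τ σ m i) else 0)) := by
    intro σ
    rw [AddMonoid.End.coe_mul, Function.comp_apply, rowOp_tail hD hl hr, map_add, smul_add, add_sub_cancel_left, map_sum,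
      Finset.smul_sum]
    simp only [map_add, smul_add]
  simp only [h1]
  rw [Finset.sum_comm]
  refine Finset.sum_eq_zero fun i hi => ?_
  have hmi : m ≠ i := fun e => by rw [← e, mem_rowsFrom] at hi; lia
  -- After the substitution σ ↦ σ s_{mi}, the condition on i becomes σ(m) = m, the target vector
  -- becomes that of the derivative term, and the sign is reversed.
  rw [Finset.sum_add_distrib, ← Equiv.sum_comp (Equiv.mulRight (Equiv.swap m i))
    (fun σ => (Equiv.Perm.sign σ : ℤ) •
        (((List.finRange N).take m).map fun i => rowOp D l r i (σ i)).prod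
          (if σ i = m then Finsupp.single (tailFun (σ * Equiv.swap m i) (m + 1) ∘ τ)
            (corrTerm l r τ σ m i) else 0)), ← Finset.sum_add_distrib]
  refine Finset.sum_eq_zero fun σ _ => ?_
  have hcorr : corrTerm l r τ (σ * Equiv.swap m i) m i = corrTerm l r τ σ m i := by
    rw [corrTerm, corrTerm]
    congr 1
    refine Finset.prod_congr rfl fun j hj => ?_
    have hjm : j ≠ m := fun e => by
      rw [Finset.mem_erase, e, mem_rowsFrom] at hj
      lia
    rw [rowFactor, rowFactor, Equiv.Perm.mul_apply,
      Equiv.swap_apply_of_ne_of_ne hjm (Finset.ne_of_mem_erase hj)]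
  rw [Equiv.coe_mulRight, hpre σ i hi, hcorr, mul_assoc, Equiv.swap_mul_self, mul_one,
    Equiv.Perm.mul_apply, Equiv.swap_apply_right, Equiv.Perm.sign_mul, Equiv.Perm.sign_swap hmi]
  simp

/-- The normally ordered form of the row determinant on a vector of weight `(1, …, 1)`. -/
theorem sum_sign_rowOp (hD : IsLeibniz D) (hl : ∀ i, D (l i) = 0) (hr : ∀ k, D (r k) = -r k ^ 2)
    (τ : Equiv.Perm (Fin N)) :
    ∑ σ : Equiv.Perm (Fin N), (Equiv.Perm.sign σ : ℤ) •
      ((List.ofFn fun i => rowOp D l r i (σ i)).prod (Finsupp.single (τ : Fin N → Fin N) 1)) =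
    ∑ σ : Equiv.Perm (Fin N), (Equiv.Perm.sign σ : ℤ) •
      Finsupp.single ((σ * τ : Equiv.Perm (Fin N)) : Fin N → Fin N)
        (∏ i, rowFactor l r τ σ i) := by
  -- Here m counts the rows still applied as operators: m = N is the row determinant, m = 0 its
  -- normally ordered form.
  have key : ∀ m ≤ N, ∑ σ : Equiv.Perm (Fin N), (Equiv.Perm.sign σ : ℤ) •
      ((((List.finRange N).take m).map fun i => rowOp D l r i (σ i)).prod
        (Finsupp.single (tailFun σ m ∘ τ) (∏ i ∈ rowsFrom N m, rowFactor l r τ σ i))) =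
      ∑ σ : Equiv.Perm (Fin N), (Equiv.Perm.sign σ : ℤ) •
      Finsupp.single ((σ * τ : Equiv.Perm (Fin N)) : Fin N → Fin N)
        (∏ i, rowFactor l r τ σ i) := by
    intro m
    induction m with
    | zero =>
      intro _
      refine Finset.sum_congr rfl fun σ _ => ?_
      have h1 : rowsFrom N 0 = Finset.univ := by ext; simp [mem_rowsFrom]
      have h2 : tailFun σ 0 = σ := by funext i; simp [tailFun]
      rw [h1, h2, List.take_zero, List.map_nil, List.prod_nil]
      rfl
    | succ m ih =>
      intro hm
      exact (sum_sign_rows_succ hD hl hr τ ⟨m, hm⟩).trans (ih (Nat.le_of_succ_le hm))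
  rw [← key N le_rfl]
  refine Finset.sum_congr rfl fun σ _ => ?_
  have h1 : rowsFrom N N = ∅ := by
    ext i
    simp [mem_rowsFrom]
  have h2 : tailFun σ N = id := by
    funext i
    rw [tailFun, if_neg (by lia)]; rfl
  rw [h1, h2, Finset.prod_empty, List.ofFn_eq_map, List.take_of_length_le (by simp)]
  rfl

end Capelli

/-! ### The action of the universal operator on `𝒱_𝟏` -/

variable (N) in
/-- Normally ordered symbols: power series in `u⁻¹` over polynomials in `∂` over `ℂ[z, λ]`. -/
def Sym := PowerSeries (Polynomial (PolyZL N))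

instance : CommRing (Sym N) := inferInstanceAs (CommRing (PowerSeries (Polynomial (PolyZL N))))

/-- The coefficient at `u⁻ⁿ`. -/
def Sym.uCoeff (n : ℕ) : Sym N →+ Polynomial (PolyZL N) :=
  (PowerSeries.coeff (R := Polynomial (PolyZL N)) n).toAddMonoidHom

/-- The coefficient at `∂ᵏ u⁻ⁿ`. -/
def Sym.coeff (k n : ℕ) : Sym N →+ PolyZL N :=
  (Polynomial.lcoeff (PolyZL N) k).toAddMonoidHom.comp (Sym.uCoeff n)

theorem Sym.coeff_eq (k n : ℕ) (a : Sym N) : Sym.coeff k n a = (Sym.uCoeff n a).coeff k := rfl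

/-- The derivation `d/du` of the symbols. -/
def symDer : Sym N →+ Sym N := (duSeries (A := Polynomial (PolyZL N))).toAddMonoidHom

/-- The inclusion of polynomials in `∂`. -/
def Sym.C : Polynomial (PolyZL N) →+* Sym N := PowerSeries.C (R := Polynomial (PolyZL N))

/-- The element `u⁻¹`. -/
def Sym.t : Sym N := (PowerSeries.X : PowerSeries (Polynomial (PolyZL N)))

/-- The symbol `1 / (u - z_k)`. -/
def symR (k : Fin N) : Sym N :=
  (PowerSeries.mk fun n => Nat.casesOn n 0 fun s => Polynomial.C (zV k ^ s) :
    PowerSeries (Polynomial (PolyZL N)))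

/-- The symbol `∂ - λᵢ`. -/
def symL (i : Fin N) : Sym N := Sym.C (Polynomial.X - Polynomial.C (lamV i))

/-! ### Arithmetic of symbols -/

theorem Sym.ext {a b : Sym N} (h : ∀ n, Sym.uCoeff n a = Sym.uCoeff n b) : a = b :=
  PowerSeries.ext h

theorem Sym.uCoeff_mul (n : ℕ) (a b : Sym N) : Sym.uCoeff n (a * b) =
    ∑ p ∈ Finset.HasAntidiagonal.antidiagonal n, Sym.uCoeff p.1 a * Sym.uCoeff p.2 b :=
  PowerSeries.coeff_mul n _ _

theorem Sym.uCoeff_C_mul (n : ℕ) (p : Polynomial (PolyZL N)) (a : Sym N) :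
    Sym.uCoeff n (Sym.C p * a) = p * Sym.uCoeff n a :=
  PowerSeries.coeff_C_mul n _ _

theorem Sym.uCoeff_one (n : ℕ) : Sym.uCoeff n (1 : Sym N) = if n = 0 then 1 else 0 :=
  PowerSeries.coeff_one n

theorem Sym.uCoeff_zero_C (p : Polynomial (PolyZL N)) : Sym.uCoeff 0 (Sym.C p) = p :=
  PowerSeries.coeff_zero_C p

theorem Sym.uCoeff_succ_C (n : ℕ) (p : Polynomial (PolyZL N)) :
    Sym.uCoeff (n + 1) (Sym.C p) = 0 :=
  (PowerSeries.coeff_C _ _).trans (if_neg n.succ_ne_zero)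

theorem Sym.uCoeff_zero_t_mul (a : Sym N) : Sym.uCoeff 0 (Sym.t * a) = 0 :=
  PowerSeries.coeff_zero_X_mul _

theorem Sym.uCoeff_succ_t_mul (n : ℕ) (a : Sym N) :
    Sym.uCoeff (n + 1) (Sym.t * a) = Sym.uCoeff n a :=
  PowerSeries.coeff_succ_X_mul n _

theorem uCoeff_symDer_zero (a : Sym N) : Sym.uCoeff 0 (symDer a) = 0 := coeff_duSeries_zero _

theorem uCoeff_symDer_succ (a : Sym N) (m : ℕ) :
    Sym.uCoeff (m + 1) (symDer a) = -((m : Polynomial (PolyZL N)) * Sym.uCoeff m a) :=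
  coeff_duSeries_succ _ _

theorem uCoeff_zero_symR (k : Fin N) : Sym.uCoeff 0 (symR k) = 0 :=
  PowerSeries.coeff_mk _ _

theorem uCoeff_succ_symR (k : Fin N) (s : ℕ) :
    Sym.uCoeff (s + 1) (symR k) = Polynomial.C (zV k ^ s) :=
  PowerSeries.coeff_mk _ _

theorem isLeibniz_symDer : IsLeibniz (symDer (N := N)) := fun a b => by
  have h : symDer (a * b) = symDer a * b + a * symDer b := duSeries_mul _ _
  rw [h]
  ring

theorem Sym.t_ne_zero : (Sym.t : Sym N) ≠ 0 := PowerSeries.X_ne_zero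

instance : IsDomain (Sym N) := inferInstanceAs (IsDomain (PowerSeries (Polynomial (PolyZL N))))

theorem symR_eq (k : Fin N) :
    symR k = Sym.t * (1 + Sym.C (Polynomial.C (zV k)) * symR k) := by
  refine Sym.ext fun n => ?_
  cases n with
  | zero => rw [uCoeff_zero_symR, Sym.uCoeff_zero_t_mul]
  | succ s =>
    rw [Sym.uCoeff_succ_t_mul, uCoeff_succ_symR, map_add, Sym.uCoeff_C_mul, Sym.uCoeff_one]
    cases s with
    | zero => simp [uCoeff_zero_symR]
    | succ s => rw [uCoeff_succ_symR]; simp [pow_succ']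

theorem symDer_C (p : Polynomial (PolyZL N)) : symDer (Sym.C p) = 0 := by
  refine Sym.ext fun n => ?_
  cases n with
  | zero => rw [uCoeff_symDer_zero, map_zero]
  | succ m =>
    rw [uCoeff_symDer_succ, map_zero]
    cases m with
    | zero => simp
    | succ m => rw [Sym.uCoeff_succ_C]; simp

theorem symDer_t : symDer (Sym.t : Sym N) = -Sym.t ^ 2 := by
  refine Sym.ext fun n => ?_
  rw [← mul_one Sym.t, mul_pow, one_pow, pow_two, mul_assoc, map_neg]
  cases n with
  | zero => rw [uCoeff_symDer_zero, Sym.uCoeff_zero_t_mul, neg_zero]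
  | succ m =>
    rw [uCoeff_symDer_succ, Sym.uCoeff_succ_t_mul]
    cases m with
    | zero => rw [Sym.uCoeff_zero_t_mul, mul_zero]
    | succ m =>
      rw [Sym.uCoeff_succ_t_mul, Sym.uCoeff_one]
      rcases eq_or_ne m 0 with rfl | h <;> simp [*]

theorem one_sub_mul_symR (k : Fin N) :
    (1 - Sym.t * Sym.C (Polynomial.C (zV k))) * symR k = Sym.t := by
  linear_combination symR_eq k

theorem one_sub_ne_zero (k : Fin N) : 1 - Sym.t * Sym.C (Polynomial.C (zV k)) ≠ 0 := by
  intro h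
  have := one_sub_mul_symR k
  rw [h, zero_mul] at this
  exact Sym.t_ne_zero this.symm

/-- Differentiate the geometric series equation `symR_eq` and cancel the nonzero factor 1 - z_k u⁻¹.
-/
theorem symDer_symR (k : Fin N) : symDer (symR k) = -symR k ^ 2 := by
  have h1 : symDer (1 : Sym N) = 0 := by rw [← map_one Sym.C, symDer_C]
  have hd := congrArg symDer (symR_eq k)
  rw [isLeibniz_symDer, symDer_t, map_add, h1, isLeibniz_symDer, symDer_C, mul_zero, zero_add,
    add_zero] at hd
  refine mul_left_cancel₀ (one_sub_ne_zero k) ?_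
  linear_combination hd + (symR k + Sym.t) * one_sub_mul_symR k - Sym.t * one_sub_mul_symR k +
    Sym.t * symR_eq k

theorem symDer_symL (i : Fin N) : symDer (symL i) = 0 := symDer_C _

/-- The coefficient at `∂ᵏ u⁻ⁿ` of a `V^{⊗N}`-valued symbol. -/
def symCoeff (k n : ℕ) : ((Fin N → Fin N) →₀ Sym N) →+ VSpace N :=
  Finsupp.liftAddHom fun f =>
    { toFun := fun a => Sym.coeff k n a ⊗ₜ epsVec f
      map_zero' := by simp
      map_add' := fun a b => by simp [TensorProduct.add_tmul] }

theorem symCoeff_single (k n : ℕ) (f : Fin N → Fin N) (a : Sym N) :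
    symCoeff k n (Finsupp.single f a) = Sym.coeff k n a ⊗ₜ epsVec f :=
  Finsupp.liftAddHom_apply_single _ _ _

/-- The operator `∂` on coefficients. -/
def dCoeff (G : ℕ → ℕ → VSpace N) (k n : ℕ) : VSpace N :=
  -- Differentiation carries u⁻⁽ⁿ⁻¹⁾ to -(n-1) u⁻ⁿ; the guards keep truncated subtraction from
  -- rereading index 0.
  (if n = 0 then 0 else -(((n - 1 : ℕ) : PolyZL N) • G k (n - 1))) +
    if k = 0 then 0 else G (k - 1) n

/-- The entry of the matrix `δᵢⱼ (∂ - λᵢ) - e_{ji}(u)` on coefficients. -/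
def entryCoeff (i j : Fin N) (G : ℕ → ℕ → VSpace N) (k n : ℕ) : VSpace N :=
  (if i = j then dCoeff G k n - lamV i • G k n else 0) -
    ∑ p ∈ Finset.HasAntidiagonal.antidiagonal n, ulamAction (PowerSeries.coeff p.1 (eSeries j i)) (G k p.2)

theorem entryCoeff_add (i j : Fin N) (G H : ℕ → ℕ → VSpace N) (k n : ℕ) :
    entryCoeff i j (fun k n => G k n + H k n) k n = entryCoeff i j G k n + entryCoeff i j H k n := by
  have hd : dCoeff (fun k n => G k n + H k n) k n = dCoeff G k n + dCoeff H k n := by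
    simp only [dCoeff, smul_add]
    split_ifs <;> abel
  unfold entryCoeff
  simp only [hd, map_add, Finset.sum_add_distrib, smul_add]
  split_ifs <;> abel

/-- With `symCoeff_rowOp` this shows that matrix entries, acting on a vector, and row operators,
acting on symbols, obey the same recursion `entryCoeff`. This transfers the Capelli identity to the
universal operator. -/
theorem ulamAction_betheMatrix (i j : Fin N) (P : DiffOp (ULam N)) (v : VSpace N) (k n : ℕ) :
    ulamAction (PowerSeries.coeff n (betheMatrix N i j P k)) v =
      entryCoeff i j (fun k n => ulamAction (PowerSeries.coeff n (P k)) v) k n := by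
  have h1 : betheMatrix N i j P k =
      (if i = j then dOp P k - PowerSeries.C (lam i) * P k else 0) - eSeries j i * P k := by
    unfold betheMatrix
    rw [LinearMap.sub_apply, Finsupp.sub_apply]
    congr 1
    split_ifs <;> rfl
  have h2 : ulamAction (PowerSeries.coeff n (dOp P k)) v =
      dCoeff (fun k n => ulamAction (PowerSeries.coeff n (P k)) v) k n := by
    have hd : dOp P k = duSeries (P k) + (Finsupp.mapDomain Nat.succ P) k := rfl
    rw [hd, map_add, map_add, LinearMap.add_apply, dCoeff]
    congr 1
    · cases n with
      | zero => rw [coeff_duSeries_zero, map_zero, LinearMap.zero_apply, if_pos rfl]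
      | succ m =>
        rw [if_neg m.succ_ne_zero, Nat.add_sub_cancel, coeff_duSeries_succ, map_neg, LinearMap.neg_apply, map_mul, map_natCast]
        simp only [Nat.cast_smul_eq_nsmul]
        rw [← nsmul_eq_mul, LinearMap.smul_apply]
    · cases k with
      | zero =>
        rw [Finsupp.mapDomain_of_notMem_range _ _ (by simp), map_zero, map_zero,
          LinearMap.zero_apply, if_pos rfl]
      | succ k =>
        rw [if_neg k.succ_ne_zero, Nat.add_sub_cancel, ← Nat.succ_eq_add_one, Finsupp.mapDomain_apply Nat.succ_injective]
  rw [h1, map_sub, map_sub, LinearMap.sub_apply, entryCoeff]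
  congr 1
  · split_ifs
    · rw [map_sub, map_sub, LinearMap.sub_apply, h2, PowerSeries.coeff_C_mul, map_mul,
        Module.End.mul_apply, ulamAction_lam]
    · rw [map_zero, map_zero, LinearMap.zero_apply]
  · rw [PowerSeries.coeff_mul, map_sum, LinearMap.sum_apply]
    simp only [map_mul, Module.End.mul_apply]

theorem symCoeff_rowOp (i j : Fin N) (F : (Fin N → Fin N) →₀ Sym N) (k n : ℕ) :
    symCoeff k n (rowOp symDer symL symR i j F) =
      entryCoeff i j (fun k n => symCoeff k n F) k n := by
  induction F using Finsupp.induction_linear with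
  | zero =>
    have hd : dCoeff (fun _ _ => (0 : VSpace N)) k n = 0 := by
      cases n <;> cases k <;> simp [dCoeff]
    simp only [map_zero, entryCoeff, hd, smul_zero, Finset.sum_const_zero]
    simp
  | add F G hF hG =>
    rw [map_add, map_add, hF, hG, ← entryCoeff_add]
    simp only [map_add]
  | single f a =>
    rw [rowOp_single, map_sub, entryCoeff]
    congr 1
    · split_ifs
      · have h : dCoeff (fun k n => symCoeff k n (Finsupp.single f a)) k n =
            Sym.coeff k n (Sym.C Polynomial.X * a + symDer a) ⊗ₜ epsVec f := by
          simp only [symCoeff_single, dCoeff, Sym.coeff_eq]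
          rw [map_add, Polynomial.coeff_add, TensorProduct.add_tmul, add_comm]
          congr 1
          · rw [Sym.uCoeff_C_mul]
            cases k with
            | zero => rw [Polynomial.coeff_X_mul_zero, TensorProduct.zero_tmul, if_pos rfl]
            | succ k =>
              rw [Polynomial.coeff_X_mul, if_neg k.succ_ne_zero, Nat.add_sub_cancel]
          · cases n with
            | zero =>
              rw [uCoeff_symDer_zero, Polynomial.coeff_zero,
                TensorProduct.zero_tmul, if_pos rfl]
            | succ m =>
              rw [uCoeff_symDer_succ, if_neg m.succ_ne_zero, Nat.add_sub_cancel,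
                Polynomial.coeff_neg, TensorProduct.neg_tmul, TensorProduct.smul_tmul',
                smul_eq_mul, ← Polynomial.C_eq_natCast, Polynomial.coeff_C_mul]
        have h2 : Sym.coeff k n (Sym.C (Polynomial.C (lamV i)) * a) = lamV i * Sym.coeff k n a := by
          rw [Sym.coeff_eq, Sym.uCoeff_C_mul, Polynomial.coeff_C_mul, Sym.coeff_eq]
        rw [h, symCoeff_single, symCoeff_single, TensorProduct.smul_tmul', smul_eq_mul, ← h2,
          ← TensorProduct.sub_tmul, ← map_sub, symL, map_sub]
        congr 2
        ring
      · rw [map_zero]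
    · rw [map_sum]
      have h : ∀ p ∈ Finset.HasAntidiagonal.antidiagonal n, ulamAction (PowerSeries.coeff p.1 (eSeries j i))
          (symCoeff k p.2 (Finsupp.single f a)) = ∑ s, if f s = i then
            ((Sym.uCoeff p.1 (symR s) * Sym.uCoeff p.2 a).coeff k) ⊗ₜ
              epsVec (Function.update f s j) else 0 := by
        rintro ⟨p, q⟩ _
        rw [symCoeff_single]
        cases p with
        | zero =>
          simp [eSeries, uCoeff_zero_symR]
        | succ p =>
          have : PowerSeries.coeff (p + 1) (eSeries j i) = eT j i p := by simp [eSeries]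
          simp only [this, ulamAction_eT_tmul, uCoeff_succ_symR, Polynomial.coeff_C_mul,
            Sym.coeff_eq]
      rw [Finset.sum_congr rfl h, Finset.sum_comm]
      refine Finset.sum_congr rfl fun s _ => ?_
      split_ifs
      · rw [symCoeff_single, Sym.coeff_eq, Sym.uCoeff_mul, Polynomial.finsetSum_coeff,
          TensorProduct.sum_tmul]
      · rw [map_zero, Finset.sum_const_zero]

theorem ulamAction_list_prod (τ : Equiv.Perm (Fin N)) (c : List (Fin N × Fin N)) (k n : ℕ) :
    ulamAction (PowerSeries.coeff n ((c.map fun x => betheMatrix N x.1 x.2).prod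
      (Finsupp.single 0 1) k)) (1 ⊗ₜ epsVec τ) =
    symCoeff k n ((c.map fun x => rowOp symDer symL symR x.1 x.2).prod
      (Finsupp.single (τ : Fin N → Fin N) 1)) := by
  induction c generalizing k n with
  | nil =>
    rw [List.map_nil, List.map_nil, List.prod_nil, List.prod_nil, Module.End.one_apply,
      AddMonoid.End.coe_one, id, symCoeff_single, Sym.coeff_eq, Sym.uCoeff_one, Finsupp.single_apply]
    simp only [eq_comm (a := (0 : ℕ))]
    by_cases hk : k = 0 <;> by_cases hn : n = 0 <;>
      simp [hk, hn, PowerSeries.coeff_one, Polynomial.coeff_one]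
  | cons x c ih =>
    rw [List.map_cons, List.map_cons, List.prod_cons, List.prod_cons, Module.End.mul_apply,
      ulamAction_betheMatrix, AddMonoid.End.coe_mul, Function.comp_apply, symCoeff_rowOp]
    simp only [ih]

variable (N) in
/-- The coefficient at `∂ᵏ u⁻ⁿ` of `∏ᵢ (δ_{σ(i) i} (∂ - λᵢ) - 1 / (u - z_{τ⁻¹(i)}))`. -/
def betheSym (k n : ℕ) (τ σ : Equiv.Perm (Fin N)) : PolyZL N :=
  Sym.coeff k n (∏ i, rowFactor symL symR τ σ i)

/-- Since the action is linear over ℂ[z, λ], the Capelli identity on ε_τ determines it on all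
multiples. -/
theorem ulamAction_betheCoeff (i j : ℕ) (p : PolyZL N) (τ : Equiv.Perm (Fin N)) :
    ulamAction (betheCoeff N i j) (p ⊗ₜ epsVec τ) =
      ∑ σ : Equiv.Perm (Fin N), ((Equiv.Perm.sign σ : ℤ) • (p * betheSym N (N - i) j τ σ)) ⊗ₜ
        epsVec (σ * τ : Equiv.Perm (Fin N)) := by
  have h1 : ulamAction (betheCoeff N i j) (1 ⊗ₜ epsVec τ) =
      symCoeff (N - i) j (∑ σ : Equiv.Perm (Fin N), (Equiv.Perm.sign σ : ℤ) •
      ((List.ofFn fun i => rowOp symDer symL symR i (σ i)).prod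
        (Finsupp.single (τ : Fin N → Fin N) 1))) := by
    unfold betheCoeff universalOp normalForm rdet
    rw [LinearMap.sum_apply, Finsupp.finsetSum_apply, map_sum, map_sum, LinearMap.sum_apply,
      map_sum]
    refine Finset.sum_congr rfl fun σ _ => ?_
    have h := ulamAction_list_prod τ ((List.finRange N).map fun i => (i, σ i)) (N - i) j
    rw [List.map_map, List.map_map] at h
    rw [map_zsmul (symCoeff _ _), List.ofFn_eq_map, List.ofFn_eq_map]
    refine Eq.trans ?_ (congrArg _ h)
    rw [LinearMap.smul_apply, Finsupp.smul_apply, map_zsmul, map_zsmul]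
    rfl
  have h2 : (p ⊗ₜ epsVec τ : VSpace N) = p • (1 ⊗ₜ epsVec τ) := by
    rw [TensorProduct.smul_tmul', smul_eq_mul, mul_one]
  rw [h2, map_smul, h1, sum_sign_rowOp isLeibniz_symDer symDer_symL symDer_symR, map_sum, Finset.smul_sum]
  refine Finset.sum_congr rfl fun σ _ => ?_
  rw [map_zsmul, symCoeff_single, betheSym, smul_comm, TensorProduct.smul_tmul',
    TensorProduct.smul_tmul', smul_eq_mul]

/-- The action of the generator `B_{N-k, n}` of the Bethe algebra in coordinates. -/
def betheOp (k n : ℕ) (f : PermPoly N) : PermPoly N := fun ρ =>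
  ∑ τ : Equiv.Perm (Fin N), (Equiv.Perm.sign (ρ * τ⁻¹) : ℤ) • (f τ * betheSym N k n τ (ρ * τ⁻¹))

theorem ulamAction_betheCoeff_ofCoord (i j : ℕ) (f : PermPoly N) :
    ulamAction (betheCoeff N i j) (ofCoord f) = ofCoord (betheOp (N - i) j f) := by
  simp only [ofCoord_apply, map_sum, ulamAction_betheCoeff, betheOp, TensorProduct.sum_tmul]
  conv_rhs => rw [Finset.sum_comm]
  refine Finset.sum_congr rfl fun τ _ => ?_
  refine Fintype.sum_equiv (Equiv.mulRight τ) _ _ fun σ => ?_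
  rw [Equiv.coe_mulRight, mul_inv_cancel_right]

/-! ### The elements of the Cherednik algebra attached to the Bethe algebra -/

/-- The action of an endomorphism of `ℂ[z, λ]` on symbols. -/
def Sym.map (φ : PolyZL N →+* PolyZL N) : Sym N →+* Sym N :=
  PowerSeries.map (Polynomial.mapRingHom φ)

theorem Sym.uCoeff_map (φ : PolyZL N →+* PolyZL N) (n : ℕ) (a : Sym N) :
    Sym.uCoeff n (Sym.map φ a) = (Sym.uCoeff n a).map φ :=
  PowerSeries.coeff_map (Polynomial.mapRingHom φ) n (a : PowerSeries (Polynomial (PolyZL N)))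

theorem Sym.coeff_map (φ : PolyZL N →+* PolyZL N) (k n : ℕ) (a : Sym N) :
    Sym.coeff k n (Sym.map φ a) = φ (Sym.coeff k n a) := by
  rw [Sym.coeff_eq, Sym.uCoeff_map, Polynomial.coeff_map, Sym.coeff_eq]

/-- The inclusion of `ℂ[z, λ]` in the symbols. -/
def Sym.const : PolyZL N →+* Sym N := Sym.C.comp Polynomial.C

theorem Sym.coeff_const_mul (k n : ℕ) (p : PolyZL N) (a : Sym N) :
    Sym.coeff k n (Sym.const p * a) = p * Sym.coeff k n a := by
  rw [Sym.coeff_eq, Sym.const, RingHom.comp_apply, Sym.uCoeff_C_mul, Polynomial.coeff_C_mul,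
    Sym.coeff_eq]

theorem Sym.map_C (φ : PolyZL N →+* PolyZL N) (p : Polynomial (PolyZL N)) :
    Sym.map φ (Sym.C p) = Sym.C (p.map φ) :=
  PowerSeries.map_C _ _

/-! ### Equivariance and divided differences of the Bethe symbols -/

theorem map_permLam_symL (σ : Equiv.Perm (Fin N)) (i : Fin N) :
    Sym.map (permLam σ).toRingHom (symL i) = symL (σ i) := by
  rw [symL, Sym.map_C, symL]
  simp

theorem map_permZ_symL (σ : Equiv.Perm (Fin N)) (i : Fin N) :
    Sym.map (permZ σ).toRingHom (symL i) = symL i := by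
  rw [symL, Sym.map_C]
  simp

theorem map_permZ_symR (σ : Equiv.Perm (Fin N)) (i : Fin N) :
    Sym.map (permZ σ).toRingHom (symR i) = symR (σ i) := by
  refine Sym.ext fun n => ?_
  rw [Sym.uCoeff_map]
  cases n with
  | zero => rw [uCoeff_zero_symR, uCoeff_zero_symR, Polynomial.map_zero]
  | succ s => rw [uCoeff_succ_symR, uCoeff_succ_symR]; simp

theorem map_permLam_symR (σ : Equiv.Perm (Fin N)) (i : Fin N) :
    Sym.map (permLam σ).toRingHom (symR i) = symR i := by
  refine Sym.ext fun n => ?_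
  rw [Sym.uCoeff_map]
  cases n with
  | zero => rw [uCoeff_zero_symR, Polynomial.map_zero]
  | succ s => rw [uCoeff_succ_symR]; simp

theorem permZ_betheSym (k n : ℕ) (τ σ : Equiv.Perm (Fin N)) :
    permZ τ⁻¹ (betheSym N k n 1 σ) = betheSym N k n τ σ := by
  rw [betheSym, betheSym]
  refine (Sym.coeff_map (permZ τ⁻¹).toRingHom k n _).symm.trans ?_
  rw [map_prod]
  congr 1
  refine Finset.prod_congr rfl fun i _ => ?_
  rw [rowFactor, rowFactor, map_sub, map_permZ_symR, apply_ite (Sym.map _), map_zero,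
    map_permZ_symL]
  rfl

/-- Permuting λ by σ turns the factor of row i for ρ into that of row σ(i) for σρσ⁻¹, except that
the pole stays at z_i; the permutation of z compensates for this. -/
theorem permLam_betheSym (k n : ℕ) (ρ σ : Equiv.Perm (Fin N)) :
    permLam σ (betheSym N k n 1 ρ) = permZ σ⁻¹ (betheSym N k n 1 (σ * ρ * σ⁻¹)) := by
  rw [permZ_betheSym, betheSym, betheSym]
  refine (Sym.coeff_map (permLam σ).toRingHom k n _).symm.trans ?_
  rw [map_prod]
  congr 1
  refine Fintype.prod_equiv σ _ _ fun i => ?_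
  rw [rowFactor, rowFactor, map_sub, map_permLam_symR, apply_ite (Sym.map _), map_zero,
    map_permLam_symL]
  simp [Equiv.Perm.one_def]

/-- Partial fractions: the difference of two simple poles is divisible by the difference of their
positions. -/
theorem symR_sub_symR (j a : Fin N) :
    symR j - symR a = Sym.const (zV j - zV a) * (symR j * symR a) := by
  refine mul_left_cancel₀ Sym.t_ne_zero ?_
  have hj := one_sub_mul_symR j
  have ha := one_sub_mul_symR a
  rw [Sym.const, RingHom.comp_apply, map_sub, map_sub]
  linear_combination symR a * hj - symR j * ha

/-- The symbol of the divided difference of `betheSym`. -/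
theorem divZ_betheSym (k n : ℕ) (ρ : Equiv.Perm (Fin N)) {j a : Fin N} (h : j ≠ a) :
    divZ j a (betheSym N k n 1 (ρ * Equiv.swap j a)) =
      Sym.coeff k n (((if ρ a = j then symL j else 0) - (if ρ j = a then symL a else 0)) *
        (symR j * symR a * ∏ i ∈ (Finset.univ.erase j).erase a, rowFactor symL symR 1 ρ i)) := by
  have hz := (Sum.inl_injective (β := Fin N)).ne h
  refine eq_divDiff hz ?_
  set Q := ∏ i ∈ (Finset.univ.erase j).erase a, rowFactor symL symR 1 ρ i with hQ
  have hfac : ∏ i, rowFactor symL symR 1 (ρ * Equiv.swap j a) i =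
      ((if ρ a = j then symL j else 0) - symR j) * (((if ρ j = a then symL a else 0) - symR a) *
        Q) := by
    rw [← Finset.mul_prod_erase _ _ (Finset.mem_univ j), ← Finset.mul_prod_erase _ _
      (Finset.mem_erase.mpr ⟨h.symm, Finset.mem_univ a⟩)]
    rw [rowFactor, rowFactor, Equiv.Perm.mul_apply, Equiv.Perm.mul_apply, Equiv.swap_apply_left,
      Equiv.swap_apply_right]
    refine congrArg₂ (· * ·) rfl (congrArg₂ (· * ·) rfl (Finset.prod_congr rfl fun i hi => ?_))
    rw [Finset.mem_erase, Finset.mem_erase] at hi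
    rw [rowFactor, rowFactor, Equiv.Perm.mul_apply, Equiv.swap_apply_of_ne_of_ne hi.2.1 hi.1]
  have hQs : Sym.map (permZ (Equiv.swap j a)).toRingHom Q = Q := by
    rw [hQ, map_prod]
    refine Finset.prod_congr rfl fun i hi => ?_
    rw [Finset.mem_erase, Finset.mem_erase] at hi
    rw [rowFactor, map_sub, map_permZ_symR, apply_ite (Sym.map _), map_zero, map_permZ_symL]
    congr 2
    exact Equiv.swap_apply_of_ne_of_ne hi.2.1 hi.1
  rw [rename_swap_inl, betheSym, ← Sym.coeff_const_mul]
  have hsw : permZ (Equiv.swap j a) (Sym.coeff k n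
      (∏ i, rowFactor symL symR 1 (ρ * Equiv.swap j a) i)) = Sym.coeff k n
        (((if ρ a = j then symL j else 0) - symR a) *
          (((if ρ j = a then symL a else 0) - symR j) * Q)) := by
    refine (Sym.coeff_map (permZ (Equiv.swap j a)).toRingHom k n _).symm.trans ?_
    rw [hfac, map_mul (Sym.map _), map_mul (Sym.map _), hQs, map_sub, map_sub, map_permZ_symR, map_permZ_symR,
      apply_ite (Sym.map _), apply_ite (Sym.map _), map_zero, map_permZ_symL, map_permZ_symL,
      Equiv.swap_apply_left, Equiv.swap_apply_right]
  rw [hsw, hfac, ← map_sub]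
  congr 1
  -- With A, B the diagonal parts of rows j and a, (A - r_j)(B - r_a) - (A - r_a)(B - r_j) = (A -
  -- B)(r_j - r_a).
  have := symR_sub_symR j a
  linear_combination (((if ρ a = j then symL j else 0) - (if ρ j = a then symL a else 0)) * Q) *
    (-this)

/-- If ρ fixes j, every summand vanishes. Otherwise only a = ρ⁻¹(j) and a = ρ(j) contribute; both
complete to the full product for ρ, and the two diagonal factors differ by (∂ - λ_j) - (∂ -
λ_{ρ(j)}). -/
theorem sum_divZ_betheSym (k n : ℕ) (ρ : Equiv.Perm (Fin N)) (j : Fin N) :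
    ∑ a ∈ Finset.univ.erase j, divZ j a (betheSym N k n 1 (ρ * Equiv.swap j a)) =
      (lamV (ρ j) - lamV j) * betheSym N k n 1 ρ := by
  rw [betheSym, ← Sym.coeff_const_mul]
  rw [Finset.sum_congr rfl fun a ha => divZ_betheSym k n ρ (Finset.ne_of_mem_erase ha).symm,
    ← map_sum]
  congr 1
  rcases eq_or_ne (ρ j) j with h | h
  · rw [h, sub_self, map_zero, zero_mul]
    refine Finset.sum_eq_zero fun a ha => ?_
    have ha' := Finset.ne_of_mem_erase ha
    rw [if_neg (fun e => ha' (ρ.injective (e.trans h.symm))), if_neg ha'.symm, sub_self, zero_mul]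
  · have hU : ∀ a, a ≠ j → ρ a ≠ a → symR j * symR a *
        ∏ i ∈ (Finset.univ.erase j).erase a, rowFactor symL symR 1 ρ i =
        ∏ i, rowFactor symL symR 1 ρ i := by
      intro a ha hρ
      rw [← Finset.mul_prod_erase _ _ (Finset.mem_univ j), ← Finset.mul_prod_erase _ _
        (Finset.mem_erase.mpr ⟨ha, Finset.mem_univ a⟩), rowFactor, rowFactor, if_neg h, if_neg hρ]
      simp only [Equiv.Perm.one_def, Equiv.refl_symm, Equiv.refl_apply]
      ring
    simp only [sub_mul, ite_mul, zero_mul]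
    rw [Finset.sum_sub_distrib, Finset.sum_eq_single (ρ.symm j), Finset.sum_eq_single (ρ j)]
    · have h1 : ρ.symm j ≠ j := fun e => h (by conv_lhs => rw [← e, Equiv.apply_symm_apply])
      rw [if_pos (by simp), if_pos rfl, hU _ h1, hU _ h, symL, symL, map_sub, map_sub, map_sub,
        Sym.const, RingHom.comp_apply, RingHom.comp_apply]
      · ring
      · exact fun e => h (ρ.injective e)
      · rw [Equiv.apply_symm_apply]
        exact h1.symm
    · intro a _ ha
      rw [if_neg ha.symm]
    · intro hn
      exact absurd (Finset.mem_erase.mpr ⟨h, Finset.mem_univ _⟩) hn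
    · intro a _ ha
      rw [if_neg fun e => ha (by rw [← e, Equiv.symm_apply_apply])]
    · intro hn
      refine absurd (Finset.mem_erase.mpr ⟨fun e => h ?_, Finset.mem_univ _⟩) hn
      conv_lhs => rw [← e, Equiv.apply_symm_apply]

/-- The element of `H_N` by which a generator of the Bethe algebra acts on `𝒱_𝟏 ≃ H_N`. -/
def betheElt (k n : ℕ) : Cherednik N :=
  ∑ σ : Equiv.Perm (Fin N), (Equiv.Perm.sign σ : ℤ) • normalOrd σ (betheSym N k n 1 σ)

/-- Moving x_j to the left gives λ_{ρ(j)} on the component ρ plus divided differences. Reindexing by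
s_{ja} reverses signs, so the latter contribute -(λ_{ρ(j)} - λ_j), and λ_j remains. -/
theorem betheElt_mul_x (k n : ℕ) (j : Fin N) :
    betheElt k n * x j = x j * betheElt k n := by
  unfold betheElt
  simp only [Finset.sum_mul, Finset.mul_sum, smul_mul_assoc, mul_smul_comm, normalOrd_mul_x,
    ← normalOrd_lam_mul, smul_add]
  rw [Finset.sum_add_distrib]
  have h : ∑ σ : Equiv.Perm (Fin N), (Equiv.Perm.sign σ : ℤ) • ∑ a ∈ Finset.univ.erase j,
      normalOrd (σ * Equiv.swap j a) (divZ j a (betheSym N k n 1 σ)) =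
      -∑ ρ : Equiv.Perm (Fin N), (Equiv.Perm.sign ρ : ℤ) •
        normalOrd ρ ((lamV (ρ j) - lamV j) * betheSym N k n 1 ρ) := by
    simp only [Finset.smul_sum, ← sum_divZ_betheSym, map_sum]
    rw [Finset.sum_comm, Finset.sum_comm (s := Finset.univ), ← Finset.sum_neg_distrib]
    refine Finset.sum_congr rfl fun a ha => ?_
    rw [← Finset.sum_neg_distrib]
    refine Fintype.sum_equiv (Equiv.mulRight (Equiv.swap j a)) _ _ fun σ => ?_
    rw [Equiv.coe_mulRight, mul_assoc, Equiv.swap_mul_self, mul_one, Equiv.Perm.sign_mul,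
      Equiv.Perm.sign_swap (Finset.ne_of_mem_erase ha).symm]
    simp
  rw [h, ← sub_eq_add_neg, ← Finset.sum_sub_distrib]
  refine Finset.sum_congr rfl fun ρ _ => ?_
  rw [← smul_sub, ← map_sub]
  congr 2
  ring

theorem perm_mul_betheElt (k n : ℕ) (σ : Equiv.Perm (Fin N)) :
    perm σ * betheElt k n = betheElt k n * perm σ := by
  unfold betheElt
  simp only [Finset.sum_mul, Finset.mul_sum, smul_mul_assoc, mul_smul_comm, normalOrd_mul_perm,
    perm_mul_normalOrd, permLam_betheSym]
  refine Fintype.sum_equiv (MulAut.conj σ).toEquiv _ _ fun ρ => ?_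
  have h : Equiv.Perm.sign (σ * ρ * σ⁻¹) = Equiv.Perm.sign ρ := by
    rw [map_mul, map_mul, mul_right_comm, ← map_mul, mul_inv_cancel, map_one, one_mul]
  change _ = (Equiv.Perm.sign (σ * ρ * σ⁻¹) : ℤ) • normalOrd (σ * ρ * σ⁻¹ * σ)
    (permZ σ⁻¹ (betheSym N k n 1 (σ * ρ * σ⁻¹)))
  rw [h, inv_mul_cancel_right]

/-- The λ's pass as left factors x, which commute with `betheElt`, and the z's as right factors y.
Only p = 1 is left, where right multiplication by τ renames the poles. -/
theorem betheElt_mul_normalOrd (k n : ℕ) (τ : Equiv.Perm (Fin N)) (p : PolyZL N) :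
    betheElt k n * normalOrd τ p = ∑ σ : Equiv.Perm (Fin N), (Equiv.Perm.sign σ : ℤ) •
      normalOrd (σ * τ) (p * betheSym N k n τ σ) := by
  induction p using polyZL_induction with
  | one =>
    rw [normalOrd_one, betheElt, Finset.sum_mul]
    refine Finset.sum_congr rfl fun σ _ => ?_
    rw [smul_mul_assoc, normalOrd_mul_perm, permZ_betheSym, one_mul]
  | smul c p hp =>
    rw [map_smul, mul_smul_comm, hp, Finset.smul_sum]
    refine Finset.sum_congr rfl fun σ _ => ?_
    rw [smul_mul_assoc, map_smul, smul_comm]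
  | add p q hp hq =>
    rw [map_add, mul_add, hp, hq, ← Finset.sum_add_distrib]
    refine Finset.sum_congr rfl fun σ _ => ?_
    rw [add_mul, map_add, smul_add]
  | lam i p hp =>
    rw [normalOrd_lam_mul, ← mul_assoc, betheElt_mul_x, mul_assoc, hp, Finset.mul_sum]
    refine Finset.sum_congr rfl fun σ _ => ?_
    rw [mul_assoc (lamV i), normalOrd_lam_mul, mul_smul_comm]
  | z i p hp =>
    rw [normalOrd_z_mul, ← mul_assoc, hp, Finset.sum_mul]
    refine Finset.sum_congr rfl fun σ _ => ?_
    rw [mul_assoc (zV i), normalOrd_z_mul, smul_mul_assoc]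

theorem pbw_betheOp (k n : ℕ) (f : PermPoly N) :
    pbw (betheOp k n f) = betheElt k n * pbw f := by
  rw [pbw_apply, pbw_apply, Finset.mul_sum]
  simp only [betheElt_mul_normalOrd, betheOp, map_sum]
  rw [Finset.sum_comm]
  refine Finset.sum_congr rfl fun τ _ => ?_
  refine Fintype.sum_equiv (Equiv.mulRight τ⁻¹) _ _ fun ρ => ?_
  rw [Equiv.coe_mulRight, inv_mul_cancel_right, map_zsmul]

theorem exists_elt_of_mem_betheAlgebra {b : ULam N} (hb : b ∈ betheAlgebra N) :
    ∃ c : Cherednik N, (∀ j, c * x j = x j * c) ∧ (∀ σ, perm σ * c = c * perm σ) ∧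
      ∀ v ∈ V1 N, iotaFull (ulamAction b v) = c * iotaFull v := by
  refine Algebra.adjoin_induction
    (p := fun b _ => ∃ c : Cherednik N, (∀ j, c * x j = x j * c) ∧
      (∀ σ, perm σ * c = c * perm σ) ∧
      ∀ v ∈ V1 N, iotaFull (ulamAction b v) = c * iotaFull v) ?_ ?_ ?_ ?_ hb
  · rintro _ ⟨i, j, -, -, rfl⟩
    refine ⟨betheElt (N - i) j, betheElt_mul_x _ _, perm_mul_betheElt _ _, fun v hv => ?_⟩
    obtain ⟨f, hf⟩ := v1Equiv.surjective ⟨v, hv⟩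
    have hf' : ofCoord f = v := congrArg Subtype.val hf
    have hi : ∀ g : PermPoly N, iotaFull (ofCoord g) = pbw g := iota_v1Equiv
    rw [← hf', ulamAction_betheCoeff_ofCoord, hi, hi, pbw_betheOp]
  · intro r
    refine ⟨algebraMap ℂ _ r, fun j => Algebra.commutes _ _, fun σ => (Algebra.commutes _ _).symm,
      fun v _ => ?_⟩
    rw [AlgHom.commutes, ← Algebra.smul_def, ← map_smul]
    rfl
  · rintro b b' _ _ ⟨c, h1, h2, h3⟩ ⟨c', h1', h2', h3'⟩
    refine ⟨c + c', fun j => ?_, fun σ => ?_, fun v hv => ?_⟩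
    · rw [add_mul, mul_add, h1, h1']
    · rw [add_mul, mul_add, h2, h2']
    · rw [map_add, LinearMap.add_apply, map_add, h3 v hv, h3' v hv, add_mul]
  · rintro b b' _ hb' ⟨c, h1, h2, h3⟩ ⟨c', h1', h2', h3'⟩
    refine ⟨c * c', fun j => ?_, fun σ => ?_, fun v hv => ?_⟩
    · rw [mul_assoc, h1', ← mul_assoc, h1, mul_assoc]
    · rw [← mul_assoc, h2, mul_assoc, h2', mul_assoc]
    · rw [map_mul, Module.End.mul_apply, h3 _ (betheAlgebra_preserves hb' v hv), h3' v hv,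
        mul_assoc]

/-- Elements of the Bethe algebra act on `𝒱_𝟏 ≃ H_N` as left multiplications by elements
commuting with the `x_j` and with `S_N`. -/
theorem exists_elt_of_mem_betheImage {b : Module.End ℂ (V1 N)} (hb : b ∈ betheImage N) :
    ∃ c : Cherednik N, (∀ j, c * x j = x j * c) ∧ (∀ σ, perm σ * c = c * perm σ) ∧
      ∀ v, iota N (b v) = c * iota N v := by
  obtain ⟨b', rfl⟩ := hb
  obtain ⟨c, h1, h2, h3⟩ := exists_elt_of_mem_betheAlgebra b'.2
  exact ⟨c, h1, h2, fun v => h3 v v.2⟩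

/-- The multiplier commutes with S_N, which handles left invariance; right invariance is untouched
by a left multiplication. -/
theorem betheImage_stable {b : Module.End ℂ (V1 N)} (hb : b ∈ betheImage N) {v : V1 N}
    (hv : v ∈ V1LR N) : b v ∈ V1LR N := by
  obtain ⟨c, -, h2, h3⟩ := exists_elt_of_mem_betheImage hb
  rw [mem_V1LR_iff_iota] at hv ⊢
  intro σ
  rw [h3]
  exact ⟨by rw [← mul_assoc, h2, mul_assoc, (hv σ).1], by rw [mul_assoc, (hv σ).2]⟩

/-! ### Degree filtrations -/

variable (N) in
/-- Polynomials in `z, λ` of degree at most `d`. -/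
def degLE (d : ℤ) : Submodule ℂ (PolyZL N) where
  -- Zero is admitted separately so that a negative bound forces p = 0, which starts the induction
  -- on degree.
  carrier := {p | p = 0 ∨ (p.totalDegree : ℤ) ≤ d}
  zero_mem' := Or.inl rfl
  add_mem' {p q} hp hq := by
    rcases hp with rfl | hp
    · rwa [zero_add]
    rcases hq with rfl | hq
    · rw [add_zero]; exact Or.inr hp
    · refine Or.inr (le_trans ?_ (max_le hp hq))
      exact_mod_cast MvPolynomial.totalDegree_add p q
  smul_mem' c p hp := by
    rcases hp with rfl | hp
    · rw [smul_zero]; exact Or.inl rfl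
    · refine Or.inr (le_trans ?_ hp)
      exact_mod_cast MvPolynomial.totalDegree_smul_le c p

theorem degLE_mono {d e : ℤ} (h : d ≤ e) {p : PolyZL N} (hp : p ∈ degLE N d) : p ∈ degLE N e :=
  hp.imp id fun hp => hp.trans h

theorem mul_mem_degLE {d e : ℤ} {p q : PolyZL N} (hp : p ∈ degLE N d) (hq : q ∈ degLE N e) :
    p * q ∈ degLE N (d + e) := by
  rcases hp with rfl | hp
  · rw [zero_mul]; exact Or.inl rfl
  rcases hq with rfl | hq
  · rw [mul_zero]; exact Or.inl rfl
  · refine Or.inr (le_trans ?_ (add_le_add hp hq))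
    exact_mod_cast MvPolynomial.totalDegree_mul p q

theorem one_mem_degLE : (1 : PolyZL N) ∈ degLE N 0 :=
  Or.inr (by rw [MvPolynomial.totalDegree_one]; rfl)

theorem X_mem_degLE (i) : (MvPolynomial.X i : PolyZL N) ∈ degLE N 1 :=
  Or.inr (by rw [MvPolynomial.totalDegree_X]; rfl)

theorem X_pow_mem_degLE (i) (s : ℕ) : (MvPolynomial.X i ^ s : PolyZL N) ∈ degLE N s :=
  Or.inr (by rw [MvPolynomial.totalDegree_X_pow])

theorem permLam_mem_degLE (σ : Equiv.Perm (Fin N)) {d : ℤ} {p : PolyZL N} (hp : p ∈ degLE N d) :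
    permLam σ p ∈ degLE N d := by
  rcases hp with rfl | hp
  · rw [map_zero]; exact Or.inl rfl
  · refine Or.inr (le_trans ?_ hp)
    exact_mod_cast MvPolynomial.totalDegree_rename_le _ p

theorem eq_zero_of_mem_degLE {d : ℤ} (hd : d < 0) {p : PolyZL N} (hp : p ∈ degLE N d) : p = 0 := by
  rcases hp with hp | hp
  · exact hp
  · lia

variable (N) in
/-- Symbols of weight at most `w`, where `∂, z, λ` have weight `1` and `u⁻¹` has weight `-1`. -/
def wtLE (w : ℤ) : AddSubgroup (Sym N) where
  carrier := {a | ∀ k n : ℕ, Sym.coeff k n a ∈ degLE N (w + n - k)}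
  zero_mem' k n := by rw [map_zero]; exact Submodule.zero_mem _
  add_mem' ha hb k n := by rw [map_add]; exact Submodule.add_mem _ (ha k n) (hb k n)
  neg_mem' ha k n := by rw [map_neg]; exact Submodule.neg_mem _ (ha k n)

theorem wtLE_mono {w w' : ℤ} (h : w ≤ w') {a : Sym N} (ha : a ∈ wtLE N w) : a ∈ wtLE N w' :=
  fun k n => degLE_mono (by lia) (ha k n)

theorem mul_mem_wtLE {w w' : ℤ} {a b : Sym N} (ha : a ∈ wtLE N w) (hb : b ∈ wtLE N w') :
    a * b ∈ wtLE N (w + w') := by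
  intro k n
  rw [Sym.coeff_eq, Sym.uCoeff_mul, Polynomial.finsetSum_coeff]
  refine Submodule.sum_mem _ fun p hp => ?_
  rw [Polynomial.coeff_mul]
  refine Submodule.sum_mem _ fun q hq => ?_
  rw [Finset.HasAntidiagonal.mem_antidiagonal] at hp hq
  refine degLE_mono ?_ (mul_mem_degLE (ha q.1 p.1) (hb q.2 p.2))
  rw [← hp, ← hq]
  push_cast
  lia

theorem one_mem_wtLE : (1 : Sym N) ∈ wtLE N 0 := by
  intro k n
  rw [Sym.coeff_eq, Sym.uCoeff_one]
  split_ifs with hn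
  · rw [Polynomial.coeff_one]
    split_ifs with hk
    · subst hn hk
      exact one_mem_degLE
    · exact Submodule.zero_mem _
  · rw [Polynomial.coeff_zero]
    exact Submodule.zero_mem _

theorem symL_mem_wtLE (i : Fin N) : symL i ∈ wtLE N 1 := by
  intro k n
  rw [Sym.coeff_eq, symL]
  cases n with
  | zero =>
    rw [Sym.uCoeff_zero_C, Polynomial.coeff_sub, Polynomial.coeff_X, Polynomial.coeff_C]
    refine Submodule.sub_mem _ ?_ ?_
    · split_ifs with h
      · subst h
        exact one_mem_degLE
      · exact Submodule.zero_mem _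
    · split_ifs with h
      · subst h
        exact X_mem_degLE _
      · exact Submodule.zero_mem _
  | succ n =>
    rw [Sym.uCoeff_succ_C, Polynomial.coeff_zero]
    exact Submodule.zero_mem _

theorem symR_mem_wtLE (i : Fin N) : symR i ∈ wtLE N (-1) := by
  intro k n
  rw [Sym.coeff_eq]
  cases n with
  | zero =>
    rw [uCoeff_zero_symR, Polynomial.coeff_zero]
    exact Submodule.zero_mem _
  | succ n =>
    rw [uCoeff_succ_symR, Polynomial.coeff_C]
    split_ifs with h
    · subst h
      refine degLE_mono ?_ (X_pow_mem_degLE _ n)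
      push_cast
      lia
    · exact Submodule.zero_mem _

theorem prod_mem_wtLE (s : Finset (Fin N)) (a : Fin N → Sym N) (h : ∀ i, a i ∈ wtLE N 1) :
    ∏ i ∈ s, a i ∈ wtLE N s.card := by
  induction s using Finset.induction_on with
  | empty => exact one_mem_wtLE
  | insert i s hi ih =>
    rw [Finset.prod_insert hi, Finset.card_insert_of_notMem hi]
    refine wtLE_mono ?_ (mul_mem_wtLE (h i) ih)
    push_cast
    lia

theorem rowFactor_mem_wtLE (τ σ : Equiv.Perm (Fin N)) (i : Fin N) :
    rowFactor symL symR τ σ i ∈ wtLE N 1 := by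
  refine AddSubgroup.sub_mem _ ?_ (wtLE_mono (by lia) (symR_mem_wtLE _))
  split_ifs
  · exact symL_mem_wtLE i
  · exact AddSubgroup.zero_mem _

theorem rowFactor_mem_wtLE_of_ne (τ σ : Equiv.Perm (Fin N)) {i : Fin N} (h : σ i ≠ i) :
    rowFactor symL symR τ σ i ∈ wtLE N (-1) := by
  rw [rowFactor, if_neg h, zero_sub]
  exact AddSubgroup.neg_mem _ (symR_mem_wtLE _)

/-- A nontrivial σ moves at least the two rows i and σ(i), and each of their factors has weight at
most -1 instead of 1. -/
theorem prod_rowFactor_mem_wtLE (τ : Equiv.Perm (Fin N)) {σ : Equiv.Perm (Fin N)} (h : σ ≠ 1) :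
    ∏ i, rowFactor symL symR τ σ i ∈ wtLE N (N - 4) := by
  obtain ⟨i, hi⟩ : ∃ i, σ i ≠ i := by
    by_contra hc
    push Not at hc
    exact h (Equiv.ext hc)
  have hmem : σ i ∈ Finset.univ.erase i := Finset.mem_erase.mpr ⟨hi, Finset.mem_univ _⟩
  rw [← Finset.mul_prod_erase _ _ (Finset.mem_univ i), ← Finset.mul_prod_erase _ _ hmem]
  refine wtLE_mono ?_ (mul_mem_wtLE (rowFactor_mem_wtLE_of_ne τ σ hi)
    (mul_mem_wtLE (rowFactor_mem_wtLE_of_ne τ σ fun e => hi (σ.injective e))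
      (prod_mem_wtLE _ _ (rowFactor_mem_wtLE τ σ))))
  have h1 := Finset.card_erase_add_one hmem
  have h2 := Finset.card_erase_add_one (Finset.mem_univ i)
  rw [Finset.card_univ, Fintype.card_fin] at h2
  lia

/-- The part of `∏ (lᵢ - rᵢ)` of degree at most one in the `rᵢ`. -/
def leadSym (s : Finset (Fin N)) : Sym N :=
  ∏ i ∈ s, symL i - ∑ j ∈ s, symR j * ∏ i ∈ s.erase j, symL i

theorem sum_symR_mem_wtLE (s : Finset (Fin N)) :
    ∑ j ∈ s, symR j * ∏ i ∈ s.erase j, symL i ∈ wtLE N (s.card - 2) := by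
  refine AddSubgroup.sum_mem _ fun j hj => ?_
  refine wtLE_mono ?_ (mul_mem_wtLE (symR_mem_wtLE j) (prod_mem_wtLE _ _ symL_mem_wtLE))
  have := Finset.card_erase_add_one hj
  lia

/-- Replacing a factor ∂ - λ_i by 1/(u - z_i) lowers the weight by 2, and at least two replacements
remain in the difference. -/
theorem prod_sub_leadSym_mem (s : Finset (Fin N)) :
    ∏ i ∈ s, (symL i - symR i) - leadSym s ∈ wtLE N (s.card - 4) := by
  induction s using Finset.induction_on with
  | empty => simp [leadSym]
  | insert a s ha ih =>
    have h1 : ∏ i ∈ insert a s, (symL i - symR i) - leadSym (insert a s) =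
        symR a * (∑ j ∈ s, symR j * ∏ i ∈ s.erase j, symL i) +
        (symL a - symR a) * (∏ i ∈ s, (symL i - symR i) - leadSym s) := by
      have h2 : ∑ j ∈ s, symR j * ∏ i ∈ (insert a s).erase j, symL i =
          symL a * ∑ j ∈ s, symR j * ∏ i ∈ s.erase j, symL i := by
        rw [Finset.mul_sum]
        refine Finset.sum_congr rfl fun j hj => ?_
        have hja : a ≠ j := fun e => ha (e ▸ hj)
        rw [Finset.erase_insert_of_ne hja,
          Finset.prod_insert fun h => ha (Finset.mem_of_mem_erase h)]
        ring
      rw [leadSym, leadSym, Finset.prod_insert ha, Finset.prod_insert ha, Finset.sum_insert ha,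
        Finset.erase_insert ha, h2]
      ring
    rw [h1, Finset.card_insert_of_notMem ha]
    refine AddSubgroup.add_mem _ ?_ ?_
    · refine wtLE_mono ?_ (mul_mem_wtLE (symR_mem_wtLE a) (sum_symR_mem_wtLE s))
      push_cast
      lia
    · refine wtLE_mono ?_ (mul_mem_wtLE (w := 1) ?_ ih)
      · push_cast
        lia
      · exact AddSubgroup.sub_mem _ (symL_mem_wtLE a) (wtLE_mono (by lia) (symR_mem_wtLE a))

/-- The polynomial `∏_{i ∈ s} (v - λᵢ)`. -/
def lamPoly (s : Finset (Fin N)) : Polynomial (PolyZL N) :=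
  ∏ i ∈ s, (Polynomial.X - Polynomial.C (lamV i))

theorem prod_symL (s : Finset (Fin N)) : ∏ i ∈ s, symL i = Sym.C (lamPoly s) := by
  rw [lamPoly, map_prod]; rfl

theorem coeff_lamPoly_mem (s : Finset (Fin N)) (k : ℕ) :
    (lamPoly s).coeff k ∈ degLE N (s.card - k) := by
  have := prod_mem_wtLE s symL symL_mem_wtLE k 0
  rw [prod_symL, Sym.coeff_eq, Sym.uCoeff_zero_C] at this
  simpa using this

theorem coeff_leadSym_zero (k : ℕ) (s : Finset (Fin N)) :
    Sym.coeff k 0 (leadSym s) = (lamPoly s).coeff k := by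
  rw [leadSym, map_sub, prod_symL, Sym.coeff_eq, Sym.uCoeff_zero_C, map_sum, Finset.sum_eq_zero,
    sub_zero]
  intro j _
  rw [prod_symL, mul_comm, Sym.coeff_eq, Sym.uCoeff_C_mul, uCoeff_zero_symR, mul_zero,
    Polynomial.coeff_zero]

theorem coeff_leadSym_succ (k n : ℕ) (s : Finset (Fin N)) :
    Sym.coeff k (n + 1) (leadSym s) = -∑ j ∈ s, zV j ^ n * (lamPoly (s.erase j)).coeff k := by
  rw [leadSym, map_sub, prod_symL, Sym.coeff_eq, Sym.uCoeff_succ_C, map_sum, Polynomial.coeff_zero,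
    zero_sub]
  congr 1
  refine Finset.sum_congr rfl fun j _ => ?_
  rw [prod_symL, mul_comm, Sym.coeff_eq, Sym.uCoeff_C_mul, uCoeff_succ_symR, mul_comm,
    Polynomial.coeff_C_mul]

/-! ### Symbols of elements of the Bethe algebra -/

/-- The coordinate of a vector of `𝒱_𝟏` at `ε_1 ⊗ ⋯ ⊗ ε_N`. -/
def idCoord : V1 N →ₗ[ℂ] PolyZL N := LinearMap.proj 1 ∘ₗ v1Equiv.symm.toLinearMap

theorem idCoord_v1Equiv (f : PermPoly N) : idCoord (v1Equiv f) = f 1 := by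
  simp [idCoord]

theorem eq_permLam_of_mem {f : PermPoly N} (hf : v1Equiv f ∈ V1LR N) (τ : Equiv.Perm (Fin N)) :
    f τ = permLam τ (f 1) := by
  have := congrFun (((mem_V1LR_iff f).mp hf τ).1) τ
  rwa [opS_apply, inv_mul_cancel, eq_comm] at this

/-- Left invariance makes the component σ the λ-permuted identity component; right invariance
carries it back through a permutation of z. -/
theorem diag_invariant_of_mem {v : V1 N} (hv : v ∈ V1LR N) (σ : Equiv.Perm (Fin N)) :
    permLam σ (permZ σ (idCoord v)) = idCoord v := by
  obtain ⟨f, rfl⟩ := v1Equiv.surjective v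
  rw [idCoord_v1Equiv, permLam_permZ, ← eq_permLam_of_mem hv]
  have := congrFun (((mem_V1LR_iff f).mp hv σ).2) 1
  rwa [one_mul] at this

theorem eq_zero_of_idCoord {v : V1 N} (hv : v ∈ V1LR N) (h : idCoord v = 0) : v = 0 := by
  obtain ⟨f, rfl⟩ := v1Equiv.surjective v
  rw [idCoord_v1Equiv] at h
  have : f = 0 := by
    ext1 τ
    rw [eq_permLam_of_mem hv, h, map_zero, Pi.zero_apply]
  rw [this, map_zero]

variable (N) in
/-- The vector `∑_τ ε_τ`. -/
def cyclicVec : V1 N := v1Equiv fun _ => 1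

theorem cyclicVec_mem : cyclicVec N ∈ V1LR N := by
  rw [cyclicVec, mem_V1LR_iff]
  intro σ
  constructor
  · ext1 τ
    rw [opS_apply, map_one]
  · ext1 τ
    rw [map_one]

theorem idCoord_cyclicVec : idCoord (cyclicVec N) = 1 := idCoord_v1Equiv _

/-- The polynomial `g` of degree at most `e` is the symbol of an element of the Bethe algebra:
the latter acts on the invariants of `𝒱_𝟏` as the multiplication by `g`, up to lower terms. -/
def IsSymbol (g : PolyZL N) (e : ℤ) : Prop :=
  g ∈ degLE N e ∧ ∃ b ∈ betheImage N, ∀ v ∈ V1LR N, ∀ d, idCoord v ∈ degLE N d →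
    idCoord (b v) - g * idCoord v ∈ degLE N (d + e - 1)

theorem IsSymbol.mono {g : PolyZL N} {e e' : ℤ} (h : IsSymbol g e) (he : e ≤ e') :
    IsSymbol g e' := by
  obtain ⟨h1, b, hb, h2⟩ := h
  exact ⟨degLE_mono he h1, b, hb, fun v hv d hd => degLE_mono (by lia) (h2 v hv d hd)⟩

theorem IsSymbol.add {g g' : PolyZL N} {e : ℤ} (h : IsSymbol g e) (h' : IsSymbol g' e) :
    IsSymbol (g + g') e := by
  obtain ⟨h1, b, hb, h2⟩ := h
  obtain ⟨h1', b', hb', h2'⟩ := h'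
  refine ⟨Submodule.add_mem _ h1 h1', b + b', Subalgebra.add_mem _ hb hb', fun v hv d hd => ?_⟩
  have : idCoord ((b + b') v) - (g + g') * idCoord v =
      (idCoord (b v) - g * idCoord v) + (idCoord (b' v) - g' * idCoord v) := by
    rw [LinearMap.add_apply, map_add]
    ring
  rw [this]
  exact Submodule.add_mem _ (h2 v hv d hd) (h2' v hv d hd)

theorem IsSymbol.smul {g : PolyZL N} {e : ℤ} (h : IsSymbol g e) (c : ℂ) :
    IsSymbol (c • g) e := by
  obtain ⟨h1, b, hb, h2⟩ := h
  refine ⟨Submodule.smul_mem _ c h1, c • b, Subalgebra.smul_mem _ hb c, fun v hv d hd => ?_⟩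
  rw [LinearMap.smul_apply, map_smul, smul_mul_assoc, ← smul_sub]
  exact Submodule.smul_mem _ c (h2 v hv d hd)

theorem isSymbol_zero (e : ℤ) : IsSymbol (0 : PolyZL N) e :=
  ⟨Submodule.zero_mem _, 0, Subalgebra.zero_mem _, fun v _ d _ => by simp⟩

theorem isSymbol_one : IsSymbol (1 : PolyZL N) 0 :=
  ⟨one_mem_degLE, 1, Subalgebra.one_mem _, fun v _ d _ => by simp⟩

theorem IsSymbol.neg {g : PolyZL N} {e : ℤ} (h : IsSymbol g e) : IsSymbol (-g) e := by
  have := h.smul (-1)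
  rwa [neg_one_smul] at this

theorem IsSymbol.sub {g g' : PolyZL N} {e : ℤ} (h : IsSymbol g e) (h' : IsSymbol g' e) :
    IsSymbol (g - g') e := by
  rw [sub_eq_add_neg]
  exact h.add h'.neg

theorem isSymbol_sum {ι : Type*} (s : Finset ι) (g : ι → PolyZL N) (e : ℤ)
    (h : ∀ i ∈ s, IsSymbol (g i) e) : IsSymbol (∑ i ∈ s, g i) e := by
  classical
  induction s using Finset.induction_on with
  | empty => exact isSymbol_zero e
  | insert a s ha ih =>
    rw [Finset.sum_insert ha]
    exact (h a (Finset.mem_insert_self a s)).add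
      (ih fun i hi => h i (Finset.mem_insert_of_mem hi))

/-- The symbol estimate for b is applied to b' v, which is again invariant and has degree at most d
+ e'. -/
theorem IsSymbol.mul {g g' : PolyZL N} {e e' : ℤ} (h : IsSymbol g e) (h' : IsSymbol g' e') :
    IsSymbol (g * g') (e + e') := by
  obtain ⟨h1, b, hb, h2⟩ := h
  obtain ⟨h1', b', hb', h2'⟩ := h'
  refine ⟨mul_mem_degLE h1 h1', b * b', Subalgebra.mul_mem _ hb hb', fun v hv d hd => ?_⟩
  have hv' := h2' v hv d hd
  have hd' : idCoord (b' v) ∈ degLE N (d + e') := by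
    have : idCoord (b' v) = (idCoord (b' v) - g' * idCoord v) + g' * idCoord v := by ring
    rw [this]
    exact Submodule.add_mem _ (degLE_mono (by lia) hv')
      (degLE_mono (by lia) (mul_mem_degLE h1' hd))
  have : idCoord ((b * b') v) - g * g' * idCoord v =
      (idCoord (b (b' v)) - g * idCoord (b' v)) + g * (idCoord (b' v) - g' * idCoord v) := by
    rw [Module.End.mul_apply]
    ring
  rw [this]
  exact Submodule.add_mem _
    (degLE_mono (by lia) (h2 _ (betheImage_stable hb' hv) _ hd'))
    (degLE_mono (by lia) (mul_mem_degLE h1 hv'))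

/-- The components of an invariant vector are permuted copies of the identity component, so all obey
its degree bound; the terms from τ ≠ 1 are small because of their off-diagonal rows. -/
theorem betheOp_sub_leadSym_mem {f : PermPoly N} (hf : v1Equiv f ∈ V1LR N) {d : ℤ}
    (hd : f 1 ∈ degLE N d) (k n : ℕ) :
    betheOp k n f 1 - Sym.coeff k n (leadSym Finset.univ) * f 1 ∈
      degLE N (d + (N - 4 + n - k)) := by
  have h1 : betheSym N k n 1 1 = Sym.coeff k n (∏ i, (symL i - symR i)) := by
    rw [betheSym]
    congr 1
    refine Finset.prod_congr rfl fun i _ => ?_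
    rw [rowFactor, if_pos (Equiv.Perm.one_apply i)]
    rfl
  unfold betheOp
  rw [← Finset.add_sum_erase _ _ (Finset.mem_univ (1 : Equiv.Perm (Fin N)))]
  have hcomm : ∀ a b c : PolyZL N, a + b - c = a - c + b := fun a b c => by ring
  rw [hcomm]
  refine Submodule.add_mem _ ?_ (Submodule.sum_mem _ fun τ hτ => ?_)
  · rw [inv_one, mul_one, map_one, Units.val_one, one_smul, h1, mul_comm (f 1), ← sub_mul,
      ← map_sub, add_comm]
    refine mul_mem_degLE ?_ hd
    have := prod_sub_leadSym_mem (Finset.univ : Finset (Fin N)) k n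
    rwa [Finset.card_univ, Fintype.card_fin] at this
  · rw [one_mul, ← Int.cast_smul_eq_zsmul ℂ]
    refine Submodule.smul_mem _ _ (mul_mem_degLE ?_ ?_)
    · rw [eq_permLam_of_mem hf]
      exact permLam_mem_degLE τ hd
    · exact prod_rowFactor_mem_wtLE τ (inv_ne_one.mpr (Finset.ne_of_mem_erase hτ)) k n

/-- The numerical hypothesis says that the error N - 4 + n - k lies strictly below the allotted
degree e. -/
theorem isSymbol_coeff_leadSym {k : ℕ} (hk : k < N) (n : ℕ) {e : ℤ}
    (he : Sym.coeff k n (leadSym (Finset.univ : Finset (Fin N))) ∈ degLE N e)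
    (h : (N : ℤ) - 3 + n - k ≤ e) :
    IsSymbol (Sym.coeff k n (leadSym (Finset.univ : Finset (Fin N)))) e := by
  have hb : betheCoeff N (N - k) n ∈ betheAlgebra N :=
    Algebra.subset_adjoin ⟨N - k, n, by lia, by lia, rfl⟩
  refine ⟨he, betheAction N ⟨_, hb⟩, ⟨_, rfl⟩, fun v hv d hd => ?_⟩
  obtain ⟨f, rfl⟩ := v1Equiv.surjective v
  have hact : betheAction N ⟨_, hb⟩ (v1Equiv f) = v1Equiv (betheOp k n f) := by
    refine Subtype.ext ((ulamAction_betheCoeff_ofCoord _ _ f).trans ?_)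
    rw [Nat.sub_sub_self hk.le]
    rfl
  rw [idCoord_v1Equiv] at hd
  rw [hact, idCoord_v1Equiv, idCoord_v1Equiv]
  exact degLE_mono (by lia) (betheOp_sub_leadSym_mem hv hd k n)

/-! ### From leading symbols to polarized power sums -/

theorem isSymbol_coeff_lamPoly {k : ℕ} (hk : k < N) :
    IsSymbol ((lamPoly (Finset.univ : Finset (Fin N))).coeff k) (N - k) := by
  have hc := coeff_lamPoly_mem (Finset.univ : Finset (Fin N)) k
  rw [Finset.card_univ, Fintype.card_fin] at hc
  rw [← coeff_leadSym_zero] at hc ⊢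
  exact isSymbol_coeff_leadSym hk 0 hc (by push_cast; lia)

/-- The sums `∑ⱼ zⱼˢ λⱼᵃ hⱼ`, where `hⱼ` is the coefficient at `vᵐ` of `∏_{i ≠ j} (v - λᵢ)`. -/
def mixedSum (m a s : ℕ) : PolyZL N :=
  ∑ j, zV j ^ s * lamV j ^ a * (lamPoly (Finset.univ.erase j)).coeff m

theorem isSymbol_mixedSum_zero {m : ℕ} (hm : m < N) (s : ℕ) :
    IsSymbol (mixedSum (N := N) m 0 s) (N - 1 - m + s) := by
  have h : (mixedSum (N := N) m 0 s) = -Sym.coeff m (s + 1) (leadSym Finset.univ) := by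
    rw [coeff_leadSym_succ, neg_neg, mixedSum]
    simp only [pow_zero, mul_one]
  have hmem : (mixedSum (N := N) m 0 s) ∈ degLE N (N - 1 - m + s) := by
    refine Submodule.sum_mem _ fun j _ => ?_
    rw [pow_zero, mul_one, add_comm]
    refine mul_mem_degLE (X_pow_mem_degLE _ s) (degLE_mono ?_ (coeff_lamPoly_mem _ m))
    have h2 := Finset.card_erase_add_one (Finset.mem_univ j)
    rw [Finset.card_univ, Fintype.card_fin] at h2
    lia
  rw [h] at hmem ⊢
  refine (isSymbol_coeff_leadSym hm (s + 1) ?_ ?_).neg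
  · simpa using Submodule.neg_mem _ hmem
  · push_cast
    lia

theorem lamPoly_univ_eq (j : Fin N) : lamPoly Finset.univ =
    lamPoly (Finset.univ.erase j) * (Polynomial.X - Polynomial.C (lamV j)) := by
  rw [lamPoly, ← Finset.mul_prod_erase _ _ (Finset.mem_univ j), mul_comm]
  rfl

theorem coeff_lamPoly_erase (j : Fin N) : (lamPoly (Finset.univ.erase j)).coeff (N - 1) = 1 := by
  have h1 : (lamPoly (Finset.univ.erase j)).natDegree = N - 1 := by
    rw [lamPoly, Polynomial.natDegree_finsetProd_X_sub_C_eq_card,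
      Finset.card_erase_of_mem (Finset.mem_univ j), Finset.card_univ, Fintype.card_fin]
  rw [← h1]
  exact Polynomial.monic_prod_of_monic _ _ fun i _ => Polynomial.monic_X_sub_C _

/-- The polarized power sum `∑ⱼ zⱼˢ λⱼᵃ`. -/
theorem mixedSum_eq_powerSum (a s : ℕ) :
    mixedSum (N := N) (N - 1) a s = ∑ j, zV j ^ s * lamV j ^ a := by
  simp only [mixedSum, coeff_lamPoly_erase, mul_one]

/-- Comparing coefficients in ∏_i (v - λ_i) = (v - λ_j) ∏_{i≠j} (v - λ_i) trades a factor λ_j for a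
lower coefficient index and a symmetric multiple of a power sum. At the constant coefficient only
the latter term is present. -/
theorem mixedSum_zero_succ (a s : ℕ) : mixedSum (N := N) 0 (a + 1) s =
    -((lamPoly Finset.univ).coeff 0 * mixedSum (N - 1) a s) := by
  rw [mixedSum_eq_powerSum, mixedSum, Finset.mul_sum, ← Finset.sum_neg_distrib]
  refine Finset.sum_congr rfl fun j _ => ?_
  rw [lamPoly_univ_eq j, Polynomial.mul_coeff_zero, Polynomial.coeff_sub, Polynomial.coeff_X_zero,
    Polynomial.coeff_C_zero]
  ring

theorem mixedSum_succ_succ (m a s : ℕ) : mixedSum (N := N) (m + 1) (a + 1) s =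
    mixedSum m a s - (lamPoly Finset.univ).coeff (m + 1) * mixedSum (N - 1) a s := by
  rw [mixedSum_eq_powerSum, mixedSum, mixedSum, Finset.mul_sum, ← Finset.sum_sub_distrib]
  refine Finset.sum_congr rfl fun j _ => ?_
  rw [lamPoly_univ_eq j, Polynomial.coeff_mul_X_sub_C]
  ring

/-- The induction on a treats all m together: reducing a leads both to m - 1 and to the power sum at
m = N - 1. -/
theorem isSymbol_mixedSum {m : ℕ} (hm : m < N) (a s : ℕ) :
    IsSymbol (mixedSum (N := N) m a s) (N - 1 - m + a + s) := by
  induction a generalizing m with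
  | zero =>
    refine (isSymbol_mixedSum_zero hm s).mono ?_
    push_cast
    lia
  | succ a ih =>
    have hp := ih (m := N - 1) (by lia)
    cases m with
    | zero =>
      rw [mixedSum_zero_succ]
      refine ((isSymbol_coeff_lamPoly hm).mul hp).neg.mono ?_
      push_cast [Nat.cast_sub (show 1 ≤ N by lia)]
      lia
    | succ m =>
      rw [mixedSum_succ_succ]
      refine ((ih (m := m) (by lia)).mono ?_).sub (((isSymbol_coeff_lamPoly hm).mul hp).mono ?_)
      · push_cast
        lia
      · push_cast [Nat.cast_sub (show 1 ≤ N by lia)]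
        lia

theorem isSymbol_powerSum (a s : ℕ) :
    IsSymbol (∑ j : Fin N, zV j ^ s * lamV j ^ a) (s + a) := by
  rcases Nat.eq_zero_or_pos N with rfl | hN
  · rw [Finset.univ_eq_empty, Finset.sum_empty]
    exact isSymbol_zero _
  · rw [← mixedSum_eq_powerSum]
    refine (isSymbol_mixedSum (by lia) a s).mono ?_
    push_cast [Nat.cast_sub (show 1 ≤ N by lia)]
    lia

/-! ### Diagonal invariants and cyclicity -/

/-- The monomial `zⱼˢ λⱼᵃ` with exponents `x = (s, a)`. -/
def pairMon (x : ℕ × ℕ) (j : Fin N) : PolyZL N := zV j ^ x.1 * lamV j ^ x.2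

theorem pairMon_zero (j : Fin N) : pairMon 0 j = 1 := by simp [pairMon]

theorem pairMon_add (x y : ℕ × ℕ) (j : Fin N) :
    pairMon (x + y) j = pairMon x j * pairMon y j := by
  simp only [pairMon, Prod.fst_add, Prod.snd_add, pow_add]
  ring

/-- The degree of the monomial with exponents `x`. -/
def pairDeg : ℕ × ℕ →+ ℕ := AddMonoidHom.coprod (AddMonoidHom.id ℕ) (AddMonoidHom.id ℕ)

theorem pairDeg_apply (x : ℕ × ℕ) : pairDeg x = x.1 + x.2 := rfl

/-- The symmetrization of the monomial `∏ₖ z_k^{m_k.1} λ_k^{m_k.2}`. -/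
def symMon (m : Fin N → ℕ × ℕ) : PolyZL N :=
  ∑ σ : Equiv.Perm (Fin N), ∏ k, pairMon (m k) (σ k)

theorem symMon_comp (m : Fin N → ℕ × ℕ) (π : Equiv.Perm (Fin N)) :
    symMon (m ∘ π) = symMon m := by
  refine Fintype.sum_equiv (Equiv.mulRight π⁻¹) _ _ fun σ => ?_
  refine Fintype.prod_equiv π _ _ fun k => ?_
  simp

theorem powerSum_mul_symMon (x : ℕ × ℕ) (m : Fin N → ℕ × ℕ) :
    (∑ j, pairMon x j) * symMon m = ∑ k, symMon (m + Pi.single k x) := by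
  have h : ∀ (k : Fin N) (σ : Equiv.Perm (Fin N)),
      ∏ i, pairMon ((m + Pi.single k x : Fin N → ℕ × ℕ) i) (σ i) =
        pairMon x (σ k) * ∏ i, pairMon (m i) (σ i) := by
    intro k σ
    simp only [Pi.add_apply, pairMon_add, Finset.prod_mul_distrib]
    rw [mul_comm, Finset.prod_eq_single k]
    · rw [Pi.single_eq_same]
    · intro i _ hi
      rw [Pi.single_eq_of_ne hi, pairMon_zero]
    · simp
  simp only [symMon, h]
  rw [Finset.sum_comm, Finset.mul_sum]
  refine Finset.sum_congr rfl fun σ _ => ?_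
  rw [← Finset.sum_mul, Equiv.sum_comp σ fun j => pairMon x j]

/-- Weyl's argument, by induction on the number of indices with nonzero exponent. Remove one pair x
from m and multiply the smaller symmetrized monomial by the power sum of x; the product contains m
with positive multiplicity, and every other term has smaller support. -/
theorem isSymbol_symMon (c : ℕ) (m : Fin N → ℕ × ℕ)
    (hc : (Finset.univ.filter fun k => m k ≠ 0).card ≤ c) :
    IsSymbol (symMon m) (∑ k, pairDeg (m k) : ℕ) := by
  induction c generalizing m with
  | zero =>
    have h0 : m = 0 := by
      ext1 k
      by_contra hk
      have : k ∈ Finset.univ.filter fun k => m k ≠ 0 := by simpa using hk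
      rw [Finset.card_eq_zero.mp (Nat.le_zero.mp hc)] at this
      simp at this
    have h1 : symMon m = (N.factorial : ℂ) • (1 : PolyZL N) := by
      rw [h0]
      simp only [symMon, Pi.zero_apply, pairMon_zero, Finset.prod_const_one]
      rw [Finset.sum_const, Finset.card_univ, Fintype.card_perm, Fintype.card_fin,
        Nat.cast_smul_eq_nsmul]
    rw [h1]
    exact (isSymbol_one.smul _).mono (by positivity)
  | succ c ih =>
    by_cases hm : ∃ k₀, m k₀ ≠ 0
    swap
    · refine ih m ?_
      push Not at hm
      rw [Finset.filter_false_of_mem fun k _ => not_not.mpr (hm k)]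
      simp
    obtain ⟨k₀, hk₀⟩ := hm
    set x := m k₀ with hx
    set m' := Function.update m k₀ 0 with hm'
    have hsupp : (Finset.univ.filter fun k => m' k ≠ 0) =
        (Finset.univ.filter fun k => m k ≠ 0).erase k₀ := by
      ext k
      rcases eq_or_ne k k₀ with rfl | h
      · simp [hm']
      · simp [hm', h]
    have hcard : (Finset.univ.filter fun k => m' k ≠ 0).card ≤ c := by
      rw [hsupp, Finset.card_erase_of_mem (by simpa using hk₀)]
      lia
    have hm0 : m = m' + Pi.single k₀ x := by
      ext1 k
      rcases eq_or_ne k k₀ with rfl | h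
      · simp [hm', hx]
      · simp [hm', h]
    have hdeg : ∀ k, ∑ i, pairDeg ((m' + Pi.single k x : Fin N → ℕ × ℕ) i) =
        ∑ i, pairDeg (m' i) + pairDeg x := by
      intro k
      simp only [Pi.add_apply, map_add, Finset.sum_add_distrib]
      congr 1
      rw [Finset.sum_eq_single k]
      · rw [Pi.single_eq_same]
      · intro i _ hi
        rw [Pi.single_eq_of_ne hi, map_zero]
      · simp
    have hdm : ∑ i, pairDeg (m i) = ∑ i, pairDeg (m' i) + pairDeg x := by
      conv_lhs => rw [hm0]
      exact hdeg k₀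
    have hprod : IsSymbol (∑ k, symMon (m' + Pi.single k x)) (∑ k, pairDeg (m k) : ℕ) := by
      rw [← powerSum_mul_symMon]
      refine ((isSymbol_powerSum x.2 x.1).mul (ih m' hcard)).mono ?_
      rw [hdm, pairDeg_apply]
      push_cast
      lia
    -- If x lands on an index already occupied, the support does not grow beyond that of m', so the
    -- induction hypothesis applies.
    have hrest : IsSymbol (∑ k ∈ Finset.univ.filter fun k => m' k ≠ 0,
        symMon (m' + Pi.single k x)) (∑ k, pairDeg (m k) : ℕ) := by
      refine isSymbol_sum _ _ _ fun k hk => ?_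
      rw [hdm, ← hdeg k]
      refine ih _ (le_trans (Finset.card_le_card fun i hi => ?_) hcard)
      rcases eq_or_ne i k with rfl | h
      · exact hk
      · simpa [Pi.single_eq_of_ne h] using hi
    -- If x lands on a free index k, exchanging k with k₀ recovers m; the index k₀ itself is free,
    -- so this occurs at least once.
    have hzero : ∑ k ∈ Finset.univ.filter fun k => ¬ m' k ≠ 0, symMon (m' + Pi.single k x) =
        ((Finset.univ.filter fun k => ¬ m' k ≠ 0).card : ℂ) • symMon m := by
      rw [Nat.cast_smul_eq_nsmul, ← Finset.sum_const]
      refine Finset.sum_congr rfl fun k hk => ?_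
      have hk' : m' k = 0 := by simpa using hk
      rw [← symMon_comp m (Equiv.swap k₀ k)]
      congr 1
      ext1 i
      rw [Function.comp_apply]
      conv_rhs => rw [hm0]
      have hk₀' : m' k₀ = 0 := by simp [hm']
      rw [Pi.add_apply, Pi.add_apply]
      rcases eq_or_ne i k with rfl | h
      · rw [Equiv.swap_apply_right, hk', hk₀', Pi.single_eq_same, Pi.single_eq_same]
      rcases eq_or_ne i k₀ with rfl | h'
      · rw [Equiv.swap_apply_left, hk', hk₀', Pi.single_eq_of_ne h, Pi.single_eq_of_ne h.symm]
      · rw [Equiv.swap_apply_of_ne_of_ne h' h, Pi.single_eq_of_ne h, Pi.single_eq_of_ne h']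
    have hne : ((Finset.univ.filter fun k => ¬ m' k ≠ 0).card : ℂ) ≠ 0 := by
      rw [Nat.cast_ne_zero]
      refine Finset.card_ne_zero_of_mem (a := k₀) ?_
      simp [hm']
    rw [← Finset.sum_filter_add_sum_filter_not Finset.univ fun k => m' k ≠ 0, hzero] at hprod
    have h := (hprod.sub hrest).smul ((Finset.univ.filter fun k => ¬ m' k ≠ 0).card : ℂ)⁻¹
    rwa [add_sub_cancel_left, inv_smul_smul₀ hne] at h

theorem monomial_eq_prod_pairMon (μ : Fin N ⊕ Fin N →₀ ℕ) :
    (MvPolynomial.monomial μ 1 : PolyZL N) =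
      ∏ k, pairMon (μ (Sum.inl k), μ (Sum.inr k)) k := by
  rw [MvPolynomial.monomial_eq, map_one, one_mul, Finsupp.prod_fintype _ _ fun i => pow_zero _,
    Fintype.prod_sum_type, ← Finset.prod_mul_distrib]
  rfl

theorem permLam_permZ_pairMon (σ : Equiv.Perm (Fin N)) (x : ℕ × ℕ) (j : Fin N) :
    permLam σ (permZ σ (pairMon x j)) = pairMon x (σ j) := by
  simp [pairMon]

/-- Averaging over S_N writes an invariant as a combination of symmetrized monomials, none exceeding
its total degree. -/
theorem isSymbol_of_invariant {p : PolyZL N} (hp : ∀ σ, permLam σ (permZ σ p) = p) {d : ℤ}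
    (hd : p ∈ degLE N d) : IsSymbol p d := by
  rcases hd with rfl | hd
  · exact isSymbol_zero d
  have h1 : (N.factorial : ℂ) • p = ∑ μ ∈ p.support, MvPolynomial.coeff μ p •
      symMon fun k => (μ (Sum.inl k), μ (Sum.inr k)) := by
    have h2 : ∑ σ : Equiv.Perm (Fin N), permLam σ (permZ σ p) = (N.factorial : ℂ) • p := by
      simp only [hp]
      rw [Finset.sum_const, Finset.card_univ, Fintype.card_perm, Fintype.card_fin,
        Nat.cast_smul_eq_nsmul]
    rw [← h2]
    conv_lhs => rw [MvPolynomial.as_sum p]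
    simp only [map_sum]
    rw [Finset.sum_comm]
    refine Finset.sum_congr rfl fun μ _ => ?_
    rw [symMon, Finset.smul_sum]
    refine Finset.sum_congr rfl fun σ _ => ?_
    have h3 : (MvPolynomial.monomial μ (MvPolynomial.coeff μ p) : PolyZL N) =
        MvPolynomial.coeff μ p • MvPolynomial.monomial μ 1 := by
      rw [MvPolynomial.smul_monomial, smul_eq_mul, mul_one]
    rw [h3, map_smul, map_smul, monomial_eq_prod_pairMon, map_prod, map_prod]
    simp only [permLam_permZ_pairMon]
  have h2 : IsSymbol ((N.factorial : ℂ) • p) d := by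
    rw [h1]
    refine isSymbol_sum _ _ _ fun μ hμ => ((isSymbol_symMon _ _ le_rfl).smul _).mono ?_
    refine le_trans ?_ hd
    have := MvPolynomial.le_totalDegree hμ
    rw [Finsupp.sum_fintype _ _ fun _ => rfl, Fintype.sum_sum_type,
      ← Finset.sum_add_distrib] at this
    exact_mod_cast this
  have h3 := h2.smul (N.factorial : ℂ)⁻¹
  rwa [inv_smul_smul₀ (by exact_mod_cast N.factorial_ne_zero)] at h3

theorem exists_mem_degLE (p : PolyZL N) : ∃ n : ℕ, p ∈ degLE N ((n : ℤ) - 1) := by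
  refine ⟨p.totalDegree + 1, Or.inr ?_⟩
  push_cast
  rw [add_sub_cancel_right]

/-- The invariants in `𝒱_𝟏` are generated by `∑_τ ε_τ` over the Bethe algebra. -/
theorem exists_betheImage_apply_cyclicVec {v : V1 N} (hv : v ∈ V1LR N) :
    ∃ b ∈ betheImage N, b (cyclicVec N) = v := by
  have key : ∀ (n : ℕ) (v : V1 N), v ∈ V1LR N → idCoord v ∈ degLE N (n - 1) →
      ∃ b ∈ betheImage N, b (cyclicVec N) = v := by
    intro n
    induction n with
    | zero =>
      intro v hv hd
      refine ⟨0, Subalgebra.zero_mem _, ?_⟩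
      rw [eq_zero_of_idCoord hv (eq_zero_of_mem_degLE (by simp) hd), LinearMap.zero_apply]
    | succ n ih =>
      intro v hv hd
      -- The identity coordinate of v is itself a symbol; applied to the vector with coordinate 1,
      -- its Bethe element reproduces v up to degree one less.
      obtain ⟨-, b, hb, h⟩ := isSymbol_of_invariant (diag_invariant_of_mem hv) hd
      have h0 := h _ cyclicVec_mem 0 (by rw [idCoord_cyclicVec]; exact one_mem_degLE)
      have hdeg : (0 : ℤ) + ((n + 1 : ℕ) - 1) - 1 = (n : ℤ) - 1 := by push_cast; ring
      have hc : idCoord (b (cyclicVec N) + (-1 : ℂ) • v) ∈ degLE N (n - 1) := by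
        rwa [map_add, map_smul, neg_one_smul, ← sub_eq_add_neg, ← hdeg,
          ← mul_one (idCoord v), ← idCoord_cyclicVec]
      obtain ⟨b', hb', h'⟩ := ih _ ((V1LR N).add_mem (betheImage_stable hb cyclicVec_mem)
        ((V1LR N).smul_mem (-1) hv)) hc
      refine ⟨b + (-1 : ℂ) • b', (betheImage N).add_mem hb ((betheImage N).smul_mem hb' _), ?_⟩
      rw [LinearMap.add_apply, LinearMap.smul_apply, h']
      module
  obtain ⟨n, hn⟩ := exists_mem_degLE (idCoord v)
  exact key n v hv hn

/-! ### The isomorphism with the spherical subalgebra -/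

/-- In PBW coordinates this left factor is multiplication by λ_k - λ_j in a domain. -/
theorem eq_zero_of_x_sub_x_mul {j k : Fin N} (h : k ≠ j) {a : Cherednik N}
    (ha : (x k - x j) * a = 0) : a = 0 := by
  obtain ⟨f, rfl⟩ := pbw_surjective a
  rw [sub_mul, ← pbw_opX, ← pbw_opX, ← map_sub] at ha
  have h0 := pbw_injective (ha.trans (map_zero pbw).symm)
  have hf : f = 0 := by
    ext1 τ
    have h1 : lamV k * f τ - lamV j * f τ = 0 := congrFun h0 τ
    rw [← sub_mul] at h1
    exact (mul_eq_zero.mp h1).resolve_left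
      (X_sub_X_ne_zero fun h' => h (Sum.inr_injective h'))
  rw [hf, map_zero]

/-- The product of the elements `x_k - x_{τ(j)}` over the pairs `(j, k)` of a list. -/
def xDiffProd (τ : Equiv.Perm (Fin N)) (L : List (Fin N × Fin N)) : Cherednik N :=
  (L.map fun p => x p.2 - x (τ p.1)).prod

theorem xDiffProd_commute_x (τ : Equiv.Perm (Fin N)) (L : List (Fin N × Fin N)) (i : Fin N) :
    Commute (xDiffProd τ L) (x i) := by
  refine Commute.list_prod_left _ _ fun a ha => ?_
  obtain ⟨p, -, rfl⟩ := List.mem_map.mp ha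
  exact Commute.sub_left (x_comm _ _) (x_comm _ _)

/-- Since x_k τ - τ x_j = (x_k - x_{τ(j)}) τ, a further factor arises from a left multiplication by
x_k, which passes through c, and a right multiplication by x_j. -/
theorem mul_sum_xDiffProd_eq_zero {c : Cherednik N} (hc : ∀ j, c * x j = x j * c)
    (h : c * ∑ τ : Equiv.Perm (Fin N), perm τ = 0) (L : List (Fin N × Fin N)) :
    c * ∑ τ : Equiv.Perm (Fin N), xDiffProd τ L * perm τ = 0 := by
  induction L with
  | nil => simpa [xDiffProd] using h
  | cons p L ih =>
    have hs : ∑ τ : Equiv.Perm (Fin N), xDiffProd τ (p :: L) * perm τ =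
        x p.2 * (∑ τ : Equiv.Perm (Fin N), xDiffProd τ L * perm τ) -
          (∑ τ : Equiv.Perm (Fin N), xDiffProd τ L * perm τ) * x p.1 := by
      rw [Finset.mul_sum, Finset.sum_mul, ← Finset.sum_sub_distrib]
      refine Finset.sum_congr rfl fun τ _ => ?_
      have h1 : xDiffProd τ (p :: L) = (x p.2 - x (τ p.1)) * xDiffProd τ L := by
        simp [xDiffProd]
      rw [h1, sub_mul, sub_mul, mul_assoc (xDiffProd τ L), perm_mul_x, ← mul_assoc,
        ← mul_assoc, (xDiffProd_commute_x τ L (τ p.1)).eq]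
    rw [hs, mul_sub, ← mul_assoc, hc, mul_assoc, ih, mul_zero, ← mul_assoc, ih, zero_mul, sub_zero]

/-- Take the factors for all pairs j ≠ k. If τ moves j, the pair (j, τ(j)) gives a zero factor, so
only the identity term survives; its factors x_k - x_j can be cancelled. -/
theorem eq_zero_of_mul_sum_perm {c : Cherednik N} (hc : ∀ j, c * x j = x j * c)
    (h : c * ∑ τ : Equiv.Perm (Fin N), perm τ = 0) : c = 0 := by
  set L : List (Fin N × Fin N) := (Finset.univ.filter fun p : Fin N × Fin N => p.2 ≠ p.1).toList
    with hL
  have hmem : ∀ p, p ∈ L ↔ p.2 ≠ p.1 := fun p => by simp [hL]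
  have h1 := mul_sum_xDiffProd_eq_zero hc h L
  rw [Finset.sum_eq_single 1, map_one, mul_one] at h1
  · have hcomm : xDiffProd 1 L * c = 0 := by
      rw [← h1]
      refine Commute.list_prod_left _ _ fun a ha => ?_
      obtain ⟨p, -, rfl⟩ := List.mem_map.mp ha
      exact Commute.sub_left (hc _).symm (hc _).symm
    have key : ∀ L' : List (Fin N × Fin N), (∀ p ∈ L', p.2 ≠ p.1) →
        xDiffProd 1 L' * c = 0 → c = 0 := by
      intro L'
      induction L' with
      | nil => exact fun _ h => by simpa [xDiffProd] using h
      | cons p L' ih =>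
        intro hL' h
        refine ih (fun q hq => hL' q (List.mem_cons_of_mem _ hq)) ?_
        refine eq_zero_of_x_sub_x_mul (hL' p List.mem_cons_self) ?_
        rw [← mul_assoc]
        simpa [xDiffProd] using h
    exact key L (fun p hp => (hmem p).mp hp) hcomm
  · intro τ _ hτ
    obtain ⟨j, hj⟩ : ∃ j, τ j ≠ j := by
      by_contra! h
      exact hτ (Equiv.ext h)
    have h0 : xDiffProd τ L = 0 := by
      refine List.prod_eq_zero (List.mem_map.mpr ⟨(j, τ j), (hmem _).mpr hj, ?_⟩)
      rw [sub_self]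
    rw [h0, zero_mul]
  · simp

/-! ### The symmetrizer and the comparison with the spherical subalgebra -/

theorem perm_mul_symmetrizer (σ : Equiv.Perm (Fin N)) :
    perm σ * symmetrizer N = symmetrizer N := by
  rw [symmetrizer, mul_smul_comm, Finset.mul_sum]
  simp only [← map_mul]
  exact congrArg _ (Equiv.sum_comp (Equiv.mulLeft σ) fun τ => (perm τ : Cherednik N))

theorem symmetrizer_mul_perm (σ : Equiv.Perm (Fin N)) :
    symmetrizer N * perm σ = symmetrizer N := by
  rw [symmetrizer, smul_mul_assoc, Finset.sum_mul]
  simp only [← map_mul]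
  exact congrArg _ (Equiv.sum_comp (Equiv.mulRight σ) fun τ => (perm τ : Cherednik N))

theorem factorial_smul_symmetrizer :
    (N.factorial : ℂ) • symmetrizer N = ∑ τ : Equiv.Perm (Fin N), perm τ := by
  rw [symmetrizer, smul_inv_smul₀ (by exact_mod_cast N.factorial_ne_zero)]

theorem symmetrizer_mul_of_invariant {a : Cherednik N} (h : ∀ σ, perm σ * a = a) :
    symmetrizer N * a = a := by
  rw [symmetrizer, smul_mul_assoc, Finset.sum_mul]
  simp only [h]
  rw [Finset.sum_const, Finset.card_univ, Fintype.card_perm, Fintype.card_fin,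
    ← Nat.cast_smul_eq_nsmul ℂ, inv_smul_smul₀ (by exact_mod_cast N.factorial_ne_zero)]

theorem mul_symmetrizer_of_invariant {a : Cherednik N} (h : ∀ σ, a * perm σ = a) :
    a * symmetrizer N = a := by
  rw [symmetrizer, mul_smul_comm, Finset.mul_sum]
  simp only [h]
  rw [Finset.sum_const, Finset.card_univ, Fintype.card_perm, Fintype.card_fin,
    ← Nat.cast_smul_eq_nsmul ℂ, inv_smul_smul₀ (by exact_mod_cast N.factorial_ne_zero)]

theorem mem_V1LR_iff_symmetrizer (v : V1 N) : v ∈ V1LR N ↔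
    symmetrizer N * iota N v = iota N v ∧ iota N v * symmetrizer N = iota N v := by
  rw [mem_V1LR_iff_iota]
  constructor
  · exact fun h => ⟨symmetrizer_mul_of_invariant fun σ => (h σ).1,
      mul_symmetrizer_of_invariant fun σ => (h σ).2⟩
  · rintro ⟨h1, h2⟩ σ
    constructor
    · rw [← h1, ← mul_assoc, perm_mul_symmetrizer]
    · rw [← h2, mul_assoc, symmetrizer_mul_perm]

theorem mem_spherical_iff {a : Cherednik N} : a ∈ Subsemigroup.corner (symmetrizer N) ↔
    symmetrizer N * a = a ∧ a * symmetrizer N = a :=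
  Subsemigroup.mem_corner_iff (symmetrizer_idem N)

variable (N)

/-- The identification of the invariants in `𝒱_𝟏` with the spherical subalgebra. -/
def sphericalEquiv : V1LR N ≃ₗ[ℂ] Spherical N where
  toFun v := ⟨iota N v, mem_spherical_iff.mpr ((mem_V1LR_iff_symmetrizer _).mp v.2)⟩
  map_add' v w := Subtype.ext (map_add (iota N) (v : V1 N) w)
  map_smul' c v := Subtype.ext (map_smul (iota N) c (v : V1 N))
  invFun a := ⟨(LinearEquiv.ofBijective (iota N) iota_bijective).symm a.1, by
    rw [mem_V1LR_iff_symmetrizer, ← LinearEquiv.ofBijective_apply (iota N) (hf := iota_bijective),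
      LinearEquiv.apply_symm_apply]
    exact mem_spherical_iff.mp a.2⟩
  left_inv v := Subtype.ext
    ((LinearEquiv.ofBijective (iota N) iota_bijective).symm_apply_apply (v : V1 N))
  right_inv a := Subtype.ext
    ((LinearEquiv.ofBijective (iota N) iota_bijective).apply_symm_apply a.1)

theorem coe_sphericalEquiv (v : V1LR N) : (sphericalEquiv N v).1 = iota N v := rfl

theorem iota_v1Equiv_one : iota N (v1Equiv (Pi.single 1 1)) = 1 := by
  rw [iota_v1Equiv, pbw_single, normalOrd_one, map_one]

variable {N}

/-- The multiplier of b is recovered by applying b to the vector that ι sends to 1, which makes it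
canonical and multiplicative in b. -/
theorem iota_apply_of_mem {b : Module.End ℂ (V1 N)} (hb : b ∈ betheImage N) (v : V1 N) :
    iota N (b v) = iota N (b (v1Equiv (Pi.single 1 1))) * iota N v := by
  obtain ⟨c, -, -, h⟩ := exists_elt_of_mem_betheImage hb
  rw [h, h, iota_v1Equiv_one, mul_one]

variable (N)

/-- The map from the image of the Bethe algebra to the Cherednik algebra, such that an operator on
`𝒱_𝟏` corresponds under `ι` to the left multiplication by its value. -/
def leftMultiplier : betheImage N →ₐ[ℂ] Cherednik N :=
  AlgHom.ofLinearMap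
    { toFun := fun b => iota N ((b : Module.End ℂ (V1 N)) (v1Equiv (Pi.single 1 1)))
      map_add' := fun _ _ => map_add (iota N) _ _
      map_smul' := fun _ _ => map_smul (iota N) _ _ }
    (iota_v1Equiv_one N)
    (fun b b' => iota_apply_of_mem b.2 ((b' : Module.End ℂ (V1 N)) (v1Equiv (Pi.single 1 1))))

variable {N}

theorem iota_apply (b : betheImage N) (v : V1 N) :
    iota N ((b : Module.End ℂ (V1 N)) v) = leftMultiplier N b * iota N v :=
  iota_apply_of_mem b.2 v

theorem leftMultiplier_commute (b : betheImage N) :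
    (∀ j, leftMultiplier N b * x j = x j * leftMultiplier N b) ∧
      ∀ σ, perm σ * leftMultiplier N b = leftMultiplier N b * perm σ := by
  obtain ⟨c, h1, h2, h3⟩ := exists_elt_of_mem_betheImage b.2
  have hc : leftMultiplier N b = c := (h3 _).trans (by rw [iota_v1Equiv_one, mul_one])
  rw [hc]
  exact ⟨h1, h2⟩

theorem symmetrizer_mul_leftMultiplier (b : betheImage N) :
    symmetrizer N * leftMultiplier N b = leftMultiplier N b * symmetrizer N := by
  rw [symmetrizer, smul_mul_assoc, mul_smul_comm, Finset.sum_mul, Finset.mul_sum]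
  exact congrArg _ (Finset.sum_congr rfl fun σ _ => (leftMultiplier_commute b).2 σ)

variable (N)

/-- The homomorphism from the image of the Bethe algebra to the spherical subalgebra. -/
def sphericalHom : betheImage N →ₐ[ℂ] Spherical N :=
  AlgHom.ofLinearMap
    { toFun := fun b => ⟨leftMultiplier N b * symmetrizer N, mem_spherical_iff.mpr
        ⟨by rw [← mul_assoc, symmetrizer_mul_leftMultiplier, mul_assoc, symmetrizer_idem N],
          by rw [mul_assoc, symmetrizer_idem N]⟩⟩
      map_add' := fun b b' => Subtype.ext (by
        change leftMultiplier N (b + b') * _ = leftMultiplier N b * _ + leftMultiplier N b' * _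
        rw [map_add, add_mul])
      map_smul' := fun c b => Subtype.ext (by
        change leftMultiplier N (c • b) * _ = c • (leftMultiplier N b * _)
        rw [map_smul, smul_mul_assoc]) }
    (Subtype.ext (by
      change leftMultiplier N 1 * symmetrizer N = symmetrizer N
      rw [map_one, one_mul]))
    (fun b b' => Subtype.ext (by
      change leftMultiplier N (b * b') * symmetrizer N =
        leftMultiplier N b * symmetrizer N * (leftMultiplier N b' * symmetrizer N)
      rw [map_mul, mul_assoc (leftMultiplier N b) (symmetrizer N), ← mul_assoc (symmetrizer N),
        symmetrizer_mul_leftMultiplier, mul_assoc (leftMultiplier N b') (symmetrizer N),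
        symmetrizer_idem N, mul_assoc]))

theorem sphericalHom_injective : Function.Injective (sphericalHom N) := by
  intro b b' hb
  have h0 : leftMultiplier N b * symmetrizer N = leftMultiplier N b' * symmetrizer N :=
    congrArg Subtype.val hb
  have h1 : leftMultiplier N b - leftMultiplier N b' = 0 := by
    refine eq_zero_of_mul_sum_perm (fun j => ?_) ?_
    · rw [sub_mul, mul_sub, (leftMultiplier_commute b).1, (leftMultiplier_commute b').1]
    · rw [← factorial_smul_symmetrizer, mul_smul_comm, sub_mul, h0, sub_self, smul_zero]
  refine Subtype.ext (LinearMap.ext fun v => iota_bijective.1 ?_)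
  rw [iota_apply, iota_apply, sub_eq_zero.mp h1]

theorem iota_cyclicVec : iota N (cyclicVec N) = (N.factorial : ℂ) • symmetrizer N := by
  rw [cyclicVec, iota_v1Equiv, pbw_apply, factorial_smul_symmetrizer]
  simp only [normalOrd_one]

/-- Cyclicity supplies b carrying the cyclic vector, which is N! e under ι, to N! times the preimage
of a; the factorials cancel. -/
theorem sphericalHom_surjective : Function.Surjective (sphericalHom N) := by
  intro a
  obtain ⟨b, hb, h⟩ := exists_betheImage_apply_cyclicVec
    ((V1LR N).smul_mem (N.factorial : ℂ) ((sphericalEquiv N).symm a).2)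
  refine ⟨⟨b, hb⟩, Subtype.ext ?_⟩
  have h1 := congrArg (iota N) h
  rw [iota_apply ⟨b, hb⟩, iota_cyclicVec, mul_smul_comm, map_smul, ← coe_sphericalEquiv,
    LinearEquiv.apply_symm_apply] at h1
  exact smul_right_injective _ (by exact_mod_cast N.factorial_ne_zero) h1

/-- The image of the Bethe algebra is isomorphic to the spherical subalgebra. -/
def betheSphericalEquiv : betheImage N ≃ₐ[ℂ] Spherical N :=
  AlgEquiv.ofBijective (sphericalHom N) ⟨sphericalHom_injective N, sphericalHom_surjective N⟩

theorem iota_apply_eq_betheSphericalEquiv_mul (b : betheImage N) (v : V1LR N) :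
    iota N ((b : Module.End ℂ (V1 N)) v) = (betheSphericalEquiv N b * sphericalEquiv N v).1 := by
  change _ = leftMultiplier N b * symmetrizer N * iota N v
  rw [iota_apply, mul_assoc, ((mem_V1LR_iff_symmetrizer _).mp v.2).1]

end Gaudin

end

theorem corollary3p7 (N : ℕ) (hN : 1 ≤ N) :
    Function.Bijective (Gaudin.iota N) ∧
    (∀ b ∈ Gaudin.betheImage N, ∀ v ∈ Gaudin.V1LR N, b v ∈ Gaudin.V1LR N) ∧
    (∃ v₀ ∈ Gaudin.V1LR N, ∀ v ∈ Gaudin.V1LR N, ∃ b ∈ Gaudin.betheImage N, b v₀ = v) ∧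
    ∃ (Φ : Gaudin.betheImage N ≃ₐ[ℂ] Gaudin.Spherical N)
      (J : Gaudin.V1LR N ≃ₗ[ℂ] Gaudin.Spherical N),
      (∀ v : Gaudin.V1LR N, ((J v).1 : Gaudin.Cherednik N) = Gaudin.iota N v) ∧
      ∀ (b : Gaudin.betheImage N) (v : Gaudin.V1LR N),
        Gaudin.iota N ((b : Module.End ℂ (Gaudin.V1 N)) v) = (Φ b * J v).1 := by
  refine ⟨Gaudin.iota_bijective, fun b hb v hv => Gaudin.betheImage_stable hb hv,
    ⟨Gaudin.cyclicVec N, Gaudin.cyclicVec_mem, fun v hv =>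
      Gaudin.exists_betheImage_apply_cyclicVec hv⟩,
    Gaudin.betheSphericalEquiv N, Gaudin.sphericalEquiv N, fun v => rfl,
    Gaudin.iota_apply_eq_betheSphericalEquiv_mul N⟩
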